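/- **Differential operators.** Let $D=t\,d/dt$ and let $\mathcal D$ be the associative algebra $\mathcal D=\bigoplus_{k\in\mathbb Z}t^k\mathbb C[D]$, $f(D)t^k=t^kf(D+k)$. On the subalgebra $\mathcal D D$ consider the anti-involutions $\sigma_\pm(t^kf(D)D)=-(\pm t)^kf(-D-k)D$. Let $\mathcal D_x^\pm=\{d\in\mathcal DD:\sigma_\pm(d)=-d\}$ (a Lie algebra under the commutator), and let $\widehat{\mathcal D}_x^\pm=\mathcal D_x^\pm\oplus\mathbb CC$ be its central extension by the restriction of the 2-cocycle $\Psi$ of $\mathcal D$ given by $\Psi(t^rf(D),t^sg(D))=\sum_{-r\le n\le-1}f(n)g(n+r)$ if $r=-s>0$, and $\Psi=0$ if $r+s\ne0$ or $r=s=0$. Its principal gradation is $\mathrm{wt}\,t^kf(D)D=k$, $\mathrm{wt}\,C=0$. **Infinite matrices.** Let $m\ge 0$, $R_m=\mathbb C[u]/(u^{m+1})$, and let $\mathfrak{gl}_\infty^{[m]}$ be the Lie algebra of matrices $(a_{ij})_{i,j\in\mathbb Z}$ over $R_m$ with finitely many nonzero diagonals. Put $$\overline{\mathfrak g}_+^{[m]}=\{A:A_{ij}(u)=(-1)^{i+j+1}A_{1-j,1-i}(-u)\},\qquad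 \overline{\mathfrak g}_-^{[m]}=\{A:A_{ij}(u)=-A_{1-j,1-i}(-u)\},$$ and let $\mathfrak g_+^{[m]}=c_\infty^{[m]}$ and $\mathfrak g_-^{[m]}=d_\infty^{[m]}$ be the central extensions $\overline{\mathfrak g}_\pm^{[m]}\oplus R_m$ by the cocycle $\mathrm{tr}([J,A]B)$, $J=\sum_{j\le0}E_{jj}$. They are graded by $\mathrm{wt}\,E_{ij}=j-i$, $\mathrm{wt}\,R_m=0$. For $\lambda\in(\mathfrak g_\pm^{[m]})_0^*$ and $0\le i\le m$ put $$c_i=\lambda(u^i),\qquad \lambda_k^{(i)}=\lambda\big(u^iE_{kk}-(-u)^iE_{1-k,1-k}\big),\qquad h_k^{(i)}=\lambda_k^{(i)}-\lambda_{k+1}^{(i)}\quad(k\ge1),$$ and $h_0^{(i)}=c_i-\lambda_1^{(i)}$ for $i$ even, $h_0^{(i)}=0$ for $i$ odd. **The homomorphism.** Let $\varphi(t^kf(D))=\sum_{j\in\mathbb Z}f(\tfrac12+u-j)E_{j-k,j}$, and let $T$ be the automorphism of $\mathfrak{gl}_\infty^{[m]}$ which multiplies the $(i,j)$ entry by $\prod_{k=i}^{j-1}(u-k-\tfrac12)$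 if $i\le j$ and by $\prod_{k=j}^{i-1}(u-k-\tfrac12)^{-1}$ if $i>j$. Then $T^{-1}\varphi$ maps $\mathcal D_x^\pm$ into $\overline{\mathfrak g}_\pm^{[m]}$, and it lifts to the Lie algebra homomorphism $\widehat\varphi=\widehat\varphi_{1/2}^{[m],\pm}:\widehat{\mathcal D}_x^\pm\to\mathfrak g_\pm^{[m]}$ with $\widehat\varphi(C)=1$, $\widehat\varphi=T^{-1}\varphi$ in nonzero degrees, and, in degree zero (as an identity of power series in $x$), $$\widehat\varphi(\sinh(xD))=\sum_{j\in\mathbb Z}\sinh\!\big((\tfrac12+u-j)x\big)E_{jj}+\frac{\cosh(x/2)-\cosh(ux)}{2\sinh(x/2)}.$$ **Highest weight modules and exponents.** For a $\mathbb Z$-graded Lie algebra $\mathfrak a$ and $\lambda\in\mathfrak a_0^*$ let $L(\mathfrak a,\lambda)$ be the irreducible graded module generated by a vector $v\neq0$ of degree $0$ with $\mathfrak a_kv=0$ for $k>0$ and $hv=\lambda(h)v$ for $h\in\mathfrak a_0$; it is quasifinite if all its homogeneous components are finite-dimensional. A module $L(\widehat{\mathcal D}_x^\pm,\Lambda)$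 is quasifinite if and only if $$\sum_{l\ \mathrm{even}}\frac{x^l}{l!}\big(-\Lambda(D^{l+1})\big)=\frac{d}{dx}\left(\frac{\phi(x)}{2\sinh(x/2)}\right)$$ with an even quasipolynomial $\phi$ such that $\phi(0)=0$. One writes, with $c_0=\Lambda(C)$, $$\phi(x)+c_0\cosh(x/2)=\sum_iq_i(x)\cosh(e_i^+x)+\sum_jr_j(x)\sinh(e_j^-x)$$ (finite sums), where the $q_i$ are nonzero even and the $r_j$ nonzero odd polynomials, the $e_i^+$ are distinct up to sign, and the $e_j^-$ are nonzero and distinct up to sign. The $e_i^+$ (resp. $e_j^-$) are the exponents of even (resp. odd) type with multiplicities $q_i$ (resp. $r_j$); they are determined up to the sign of $e_i^+$ and the simultaneous change of signs of $e_j^-$ and $r_j$. They determine the module, which is denoted by $L(\widehat{\mathcal D}_x^\pm;e^+,e^-)$, where $e^+$, $e^-$ are the sets of the exponents of even and of odd type with their multiplicities. **Proposition.** Let $\lambda\in(\mathfrak g_\pm^{[m]})_0^*$ be such that $L(\mathfrak g_\pm^{[m]},\lambda)$ is quasifinite. Then $L(\mathfrak g_\pm^{[m]},\lambda)$, regarded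 as a $\widehat{\mathcal D}_x^\pm$-module via $\widehat\varphi_{1/2}^{[m],\pm}$, is irreducible and isomorphic to $L(\widehat{\mathcal D}_x^\pm;e^+,e^-)$, where $e^+$ consists of the exponents $k$ and $e^-$ of the exponents $-k$, $k\in\mathbb Z_+=\{0,1,2,\dots\}$, with multiplicities $$\sum_{\substack{0\le i\le m\\ i\ \mathrm{even}}}\frac{h_k^{(i)}x^i}{i!}\qquad\text{and}\qquad\sum_{\substack{0\le i\le m\\ i\ \mathrm{odd}}}\frac{h_k^{(i)}x^i}{i!},$$ respectively; exponents whose multiplicity is zero are omitted. (Equivalently, the exponents of odd type are $k$ with the opposite multiplicities.) The gradation of $L(\widehat{\mathcal D}_x^\pm;e^+,e^-)$ may be taken to be that of $L(\mathfrak g_\pm^{[m]},\lambda)$. -/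

import Mathlib

open scoped Polynomial

namespace Circle

/-! ### Differential operators on the circle -/

/-- The associative algebra of regular differential operators on the circle. A finitely supported
family `k ↦ f_k` of polynomials stands for the operator `∑ t^k f_k(D)`, where `D = t d/dt`. -/
def DiffOp : Type := ℤ →₀ ℂ[X]

namespace DiffOp

noncomputable instance : AddCommGroup DiffOp := inferInstanceAs (AddCommGroup (ℤ →₀ ℂ[X]))
noncomputable instance : Module ℂ DiffOp := inferInstanceAs (Module ℂ (ℤ →₀ ℂ[X]))

/-- The coefficient `f_k` of `t^k` in `∑ t^k f_k(D)`. -/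
noncomputable def coeff (k : ℤ) : DiffOp →ₗ[ℂ] ℂ[X] := Finsupp.lapply k

/-- The operator `t^k f(D)`, as a linear function of `f`. -/
noncomputable def mono (k : ℤ) : ℂ[X] →ₗ[ℂ] DiffOp := Finsupp.lsingle k

@[simp] theorem coeff_mono (k l : ℤ) (f : ℂ[X]) :
    coeff k (mono l f) = if l = k then f else 0 :=
  Finsupp.single_apply

theorem ext_coeff {x y : DiffOp} (h : ∀ k, coeff k x = coeff k y) : x = y := Finsupp.ext h

theorem induct {p : DiffOp → Prop} (x : DiffOp) (h0 : p 0)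
    (hadd : ∀ x y, p x → p y → p (x + y)) (hm : ∀ k f, p (mono k f)) : p x :=
  Finsupp.induction_linear x h0 hadd hm

/-- Linear maps out of the space of differential operators, given on each `t^k f(D)`. -/
noncomputable def lift {M : Type*} [AddCommGroup M] [Module ℂ M] (F : ℤ → ℂ[X] →ₗ[ℂ] M) :
    DiffOp →ₗ[ℂ] M := Finsupp.lsum ℂ F

@[simp] theorem lift_mono {M : Type*} [AddCommGroup M] [Module ℂ M] (F : ℤ → ℂ[X] →ₗ[ℂ] M)
    (k : ℤ) (f : ℂ[X]) : lift F (mono k f) = F k f := by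
  exact Finsupp.lsum_single ℂ F k f

/-- `f(D + s)`, as a linear function of `f`. -/
noncomputable def translate (s : ℤ) : ℂ[X] →ₗ[ℂ] ℂ[X] :=
  (Polynomial.aeval (Polynomial.X + Polynomial.C (s : ℂ))).toLinearMap

@[simp] theorem translate_apply (s : ℤ) (f : ℂ[X]) :
    translate s f = f.comp (Polynomial.X + Polynomial.C (s : ℂ)) := by
  simp [translate, Polynomial.comp, Polynomial.aeval_def]

/-- The product of differential operators: `t^r f(D) * t^s g(D) = t^(r+s) f(D+s) g(D)`. -/
noncomputable def mulL : DiffOp →ₗ[ℂ] DiffOp →ₗ[ℂ] DiffOp :=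
  lift fun r => LinearMap.flip <| lift fun s => LinearMap.flip <|
    ((LinearMap.mul ℂ ℂ[X]) ∘ₗ translate s).compr₂ (mono (r + s))

noncomputable instance : Mul DiffOp := ⟨fun x y => mulL x y⟩
noncomputable instance : One DiffOp := ⟨mono 0 1⟩

theorem one_def : (1 : DiffOp) = mono 0 1 := rfl
theorem mul_def (x y : DiffOp) : x * y = mulL x y := rfl

theorem mono_mul_mono (r s : ℤ) (f g : ℂ[X]) :
    mono r f * mono s g
      = mono (r + s) (f.comp (Polynomial.X + Polynomial.C (s : ℂ)) * g) := by
  simp [mul_def, mulL]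

noncomputable instance : Ring DiffOp :=
  { (inferInstance : AddCommGroup DiffOp) with
    mul := (· * ·)
    one := 1
    left_distrib := fun x y z => by simp [mul_def]
    right_distrib := fun x y z => by simp [mul_def]
    zero_mul := fun x => by rw [mul_def, map_zero, LinearMap.zero_apply]
    mul_zero := fun x => by rw [mul_def, map_zero]
    one_mul := fun x => by
      change 1 * x = x
      refine induct (p := fun x => 1 * x = x) x (by rw [mul_def, map_zero])
        (fun x y hx hy => ?_) (fun k f => ?_)
      · simp only [mul_def, map_add] at *; rw [hx, hy]
      · rw [one_def, mono_mul_mono]; simp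
    mul_one := fun x => by
      change x * 1 = x
      refine induct (p := fun x => x * 1 = x) x (by rw [mul_def, map_zero, LinearMap.zero_apply])
        (fun x y hx hy => ?_) (fun k f => ?_)
      · simp only [mul_def, map_add, LinearMap.add_apply] at *; rw [hx, hy]
      · rw [one_def, mono_mul_mono]; simp
    mul_assoc := fun x y z => by
      change x * y * z = x * (y * z)
      refine induct (p := fun x => x * y * z = x * (y * z)) x (by simp [mul_def])
        (fun x x' hx hy => ?_) (fun k f => ?_)
      · simp only [mul_def, map_add, LinearMap.add_apply] at *; rw [hx, hy]
      refine induct (p := fun y => mono k f * y * z = mono k f * (y * z)) y (by simp [mul_def])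
        (fun x x' hx hy => ?_) (fun l g => ?_)
      · simp only [mul_def, map_add, LinearMap.add_apply] at *; rw [hx, hy]
      refine induct (p := fun z => mono k f * mono l g * z = mono k f * (mono l g * z)) z
        (by simp [mul_def]) (fun x x' hx hy => ?_) (fun n h => ?_)
      · simp only [mul_def, map_add] at *; rw [hx, hy]
      simp only [mono_mul_mono]
      rw [add_assoc]
      congr 1
      simp only [Polynomial.mul_comp, Polynomial.comp_assoc, Polynomial.add_comp,
        Polynomial.X_comp, Polynomial.C_comp, mul_assoc]
      push_cast
      rw [map_add, add_comm (Polynomial.C (l : ℂ)), add_assoc] }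

noncomputable instance : Algebra ℂ DiffOp :=
  Algebra.ofModule (fun r x y => by simp [mul_def]) (fun r x y => by simp [mul_def])

noncomputable instance : LieRing DiffOp := LieRing.ofAssociativeRing
noncomputable instance : LieAlgebra ℂ DiffOp := LieAlgebra.ofAssociativeAlgebra

/-- The bracket `[t^r f(D), t^s g(D)] = t^(r+s) (f(D+s) g(D) - f(D) g(D+r))`. -/
theorem mono_lie_mono (r s : ℤ) (f g : ℂ[X]) :
    ⁅mono r f, mono s g⁆ = mono (r + s)
      (f.comp (Polynomial.X + Polynomial.C (s : ℂ)) * g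
        - f * g.comp (Polynomial.X + Polynomial.C (r : ℂ))) := by
  rw [Ring.lie_def, mono_mul_mono, mono_mul_mono, add_comm s r, ← map_sub, mul_comm f]

end DiffOp

/-! ### Infinite matrices with finitely many nonzero diagonals -/

section Matrices

variable {R : Type*} [CommRing R] [Algebra ℂ R]

/-- The algebra of matrices `(a_ij)`, `i j : ℤ`, over `R` with finitely many nonzero diagonals,
acting on the free module with basis `v_j`, `j : ℤ`. -/
def bandEnd (R : Type*) [CommRing R] [Algebra ℂ R] :
    Subring (Module.End R (ℤ →₀ R)) where
  carrier := {A | ∃ N : ℕ, ∀ i j : ℤ, N < |i - j| → A (Finsupp.single j 1) i = 0}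
  add_mem' := by
    rintro A B ⟨N, hN⟩ ⟨M, hM⟩
    refine ⟨max N M, fun i j h => ?_⟩
    push_cast at h
    have h := max_lt_iff.1 h
    simp [hN i j h.1, hM i j h.2]
  mul_mem' := by
    rintro A B ⟨N, hN⟩ ⟨M, hM⟩
    refine ⟨N + M, fun i j h => ?_⟩
    have key : B (Finsupp.single j 1) = (B (Finsupp.single j 1)).sum
        fun k c => c • Finsupp.single k (1 : R) := by
      conv_lhs => rw [← Finsupp.sum_single (B (Finsupp.single j 1))]
      simp
    rw [Module.End.mul_apply, key, Finsupp.sum, map_sum, Finsupp.finsetSum_apply]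
    refine Finset.sum_eq_zero fun k _ => ?_
    rw [map_smul, Finsupp.smul_apply]
    by_cases hk : (M : ℤ) < |k - j|
    · rw [hM k j hk, zero_smul]
    · rw [hN i k, smul_zero]
      have := abs_sub_le i k j
      push_cast at h
      linarith
  zero_mem' := ⟨0, fun i j _ => by simp⟩
  neg_mem' := by
    rintro A ⟨N, hN⟩
    exact ⟨N, fun i j h => by simp [hN i j h]⟩
  one_mem' := by
    refine ⟨0, fun i j h => ?_⟩
    have : j ≠ i := by rintro rfl; simp at h
    simp [this]

/-- The algebra of matrices `(a_ij)`, `i j : ℤ`, over `R` with finitely many nonzero diagonals. -/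
def GlInf (R : Type*) [CommRing R] [Algebra ℂ R] : Type _ := ↥(bandEnd R)

noncomputable instance : Ring (GlInf R) := inferInstanceAs (Ring ↥(bandEnd R))

noncomputable instance : Module ℂ (GlInf R) where
  smul c A := ⟨c • A.1, by
    obtain ⟨N, hN⟩ := A.2
    exact ⟨N, fun i j h => by simp [hN i j h]⟩⟩
  one_smul A := Subtype.ext (one_smul ℂ A.1)
  mul_smul c d A := Subtype.ext (mul_smul c d A.1)
  smul_zero c := Subtype.ext (smul_zero c)
  smul_add c A B := Subtype.ext (smul_add c A.1 B.1)
  add_smul c d A := Subtype.ext (add_smul c d A.1)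
  zero_smul A := Subtype.ext (zero_smul ℂ A.1)

noncomputable instance : Algebra ℂ (GlInf R) :=
  Algebra.ofModule (fun c A B => Subtype.ext (smul_mul_assoc c A.1 B.1))
    (fun c A B => Subtype.ext (mul_smul_comm c A.1 B.1))

noncomputable instance : LieRing (GlInf R) := LieRing.ofAssociativeRing
noncomputable instance : LieAlgebra ℂ (GlInf R) := LieAlgebra.ofAssociativeAlgebra

/-- The action of a matrix on the free module with basis `v_j`. -/
def toEnd (A : GlInf R) : Module.End R (ℤ →₀ R) := A.val

/-- The `(i, j)` entry of a matrix. -/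
noncomputable def entry (A : GlInf R) (i j : ℤ) : R := toEnd A (Finsupp.single j 1) i

@[simp] theorem entry_add (A B : GlInf R) (i j : ℤ) :
    entry (A + B) i j = entry A i j + entry B i j := rfl
@[simp] theorem entry_sub (A B : GlInf R) (i j : ℤ) :
    entry (A - B) i j = entry A i j - entry B i j := rfl
@[simp] theorem entry_smul (c : ℂ) (A : GlInf R) (i j : ℤ) :
    entry (c • A) i j = c • entry A i j := rfl
@[simp] theorem entry_neg (A : GlInf R) (i j : ℤ) : entry (-A) i j = -entry A i j := rfl
@[simp] theorem entry_zero (i j : ℤ) : entry (0 : GlInf R) i j = 0 := rfl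

theorem glInf_ext {A B : GlInf R} (h : ∀ i j, entry A i j = entry B i j) : A = B := by
  apply Subtype.ext
  refine Finsupp.lhom_ext' fun j => LinearMap.ext_ring ?_
  exact Finsupp.ext fun i => h i j

theorem finite_col (A : GlInf R) (j : ℤ) : {k | entry A k j ≠ 0}.Finite := by
  refine (toEnd A (Finsupp.single j 1)).support.finite_toSet.subset ?_
  intro k hk
  simpa [entry] using hk

/-- Multiplication of matrices is given by the usual formula. -/
theorem entry_mul (A B : GlInf R) (i j : ℤ) :
    entry (A * B) i j = ∑ᶠ k, entry A i k * entry B k j := by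
  have key : toEnd B (Finsupp.single j 1)
      = (toEnd B (Finsupp.single j 1)).sum
        fun k c => c • Finsupp.single k (1 : R) := by
    conv_lhs => rw [← Finsupp.sum_single (toEnd B (Finsupp.single j 1))]
    simp
  have h1 : entry (A * B) i j = toEnd A
      (toEnd B (Finsupp.single j 1)) i := rfl
  rw [h1, key, Finsupp.sum, map_sum, Finsupp.finsetSum_apply,
    finsum_eq_sum_of_support_subset
      (s := (toEnd B (Finsupp.single j 1)).support)]
  · refine Finset.sum_congr rfl fun k _ => ?_
    rw [map_smul, Finsupp.smul_apply, smul_eq_mul, mul_comm]; rfl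
  · intro k hk
    have : entry B k j ≠ 0 := right_ne_zero_of_mul hk
    simpa [entry] using this

/-- The matrix `∑ j, c j E_{j-k, j}`. -/
noncomputable def shiftDiag (k : ℤ) (c : ℤ → R) : GlInf R :=
  ⟨Finsupp.lsum R fun j => (Finsupp.lsingle (j - k)).comp (LinearMap.mulLeft R (c j)), by
    refine ⟨k.natAbs, fun i j h => ?_⟩
    have : j - k ≠ i := by
      rintro rfl
      simp at h
    simp [this]⟩

@[simp] theorem entry_shiftDiag (k : ℤ) (c : ℤ → R) (i j : ℤ) :
    entry (shiftDiag k c) i j = if j - k = i then c j else 0 := by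
  change (Finsupp.lsum R fun j => (Finsupp.lsingle (j - k)).comp (LinearMap.mulLeft R (c j)))
    (Finsupp.single j 1) i = _
  simp [Finsupp.single_apply]

theorem entry_mul_shiftDiag (A : GlInf R) (k : ℤ) (c : ℤ → R) (i j : ℤ) :
    entry (A * shiftDiag k c) i j = entry A i (j - k) * c j := by
  rw [entry_mul, finsum_eq_single _ (j - k)]
  · simp
  · intro l hl
    simp [hl.symm]

theorem entry_shiftDiag_mul (A : GlInf R) (k : ℤ) (c : ℤ → R) (i j : ℤ) :
    entry (shiftDiag k c * A) i j = c (i + k) * entry A (i + k) j := by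
  rw [entry_mul, finsum_eq_single _ (i + k)]
  · simp
  · intro l hl
    have : ¬ (l - k = i) := fun h => hl (by omega)
    simp [this]

theorem shiftDiag_mul_shiftDiag (k l : ℤ) (c d : ℤ → R) :
    shiftDiag k c * shiftDiag l d = shiftDiag (k + l) fun j => c (j - l) * d j := by
  refine glInf_ext fun i j => ?_
  rw [entry_mul_shiftDiag, entry_shiftDiag, entry_shiftDiag]
  by_cases h : j - l - k = i
  · rw [if_pos h, if_pos (by omega)]
  · rw [if_neg h, if_neg (by omega), zero_mul]

theorem shiftDiag_zero_one : shiftDiag 0 (fun _ => (1 : R)) = 1 := by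
  refine glInf_ext fun i j => ?_
  rw [entry_shiftDiag]
  change _ = Finsupp.single j (1 : R) i
  simp [Finsupp.single_apply]

/-- Conjugation `A ↦ G A G⁻¹` by an invertible diagonal matrix `G = diag (g i)`. -/
noncomputable def conjDiag (g : ℤ → Rˣ) : GlInf R →ₐ[ℂ] GlInf R :=
  AlgHom.ofLinearMap
    ((LinearMap.mulLeft ℂ (shiftDiag 0 fun j => (g j : R))).comp
      (LinearMap.mulRight ℂ (shiftDiag 0 fun j => ((g j)⁻¹ : Rˣ).val)))
    (by simp [shiftDiag_mul_shiftDiag, shiftDiag_zero_one])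
    (by
      intro A B
      have h : (shiftDiag 0 fun j => ((g j)⁻¹ : Rˣ).val) * (shiftDiag 0 fun j => (g j : R))
          = 1 := by
        simp [shiftDiag_mul_shiftDiag, shiftDiag_zero_one]
      simp only [LinearMap.comp_apply, LinearMap.mulLeft_apply, LinearMap.mulRight_apply]
      rw [show ∀ a b c d : GlInf R, a * (b * c) * (a * (d * c)) = a * (b * (c * a) * d * c) by
        intros; noncomm_ring, h]
      noncomm_ring)

@[simp] theorem entry_conjDiag (g : ℤ → Rˣ) (A : GlInf R) (i j : ℤ) :
    entry (conjDiag g A) i j = g i * entry A i j * ((g j)⁻¹ : Rˣ).val := by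
  simp only [conjDiag, AlgHom.ofLinearMap_apply, LinearMap.comp_apply, LinearMap.mulLeft_apply,
    LinearMap.mulRight_apply]
  rw [entry_shiftDiag_mul, entry_mul_shiftDiag]
  simp [mul_assoc]

/-! ### Lie algebra cocycles and central extensions -/

/-- The trace of a matrix with finitely many nonzero diagonal entries. -/
noncomputable def tr (A : GlInf R) : R := ∑ᶠ i, entry A i i

/-- The matrix `J = ∑_{j ≤ 0} E_{jj}`. -/
noncomputable def matJ (R : Type*) [CommRing R] [Algebra ℂ R] : GlInf R :=
  shiftDiag 0 fun j => if j ≤ 0 then 1 else 0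

/-- All entries of the matrix outside a finite square vanish. -/
def FinSq (A : GlInf R) : Prop :=
  ∃ N : ℕ, ∀ i j : ℤ, entry A i j ≠ 0 → |i| ≤ N ∧ |j| ≤ N

theorem exists_band (A : GlInf R) : ∃ N : ℕ, ∀ i j : ℤ, entry A i j ≠ 0 → |i - j| ≤ N := by
  obtain ⟨N, hN⟩ := A.2
  exact ⟨N, fun i j h => not_lt.1 fun h' => h (hN i j h')⟩

theorem entry_matJ_lie (A : GlInf R) (i j : ℤ) :
    entry ⁅matJ R, A⁆ i j
      = ((if i ≤ 0 then 1 else 0) - (if j ≤ 0 then 1 else 0)) * entry A i j := by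
  rw [Ring.lie_def, entry_sub, matJ, entry_shiftDiag_mul, entry_mul_shiftDiag]
  simp only [add_zero, sub_zero]
  ring

theorem finSq_matJ_lie (A : GlInf R) : FinSq ⁅matJ R, A⁆ := by
  obtain ⟨N, hN⟩ := exists_band A
  refine ⟨N, fun i j h => ?_⟩
  rw [entry_matJ_lie] at h
  have h1 := hN i j (right_ne_zero_of_mul h)
  have h2 := left_ne_zero_of_mul h
  rw [abs_le] at *
  rw [abs_le]
  by_cases hi : i ≤ 0 <;> by_cases hj : j ≤ 0 <;> simp [hi, hj] at h2 <;> omega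

theorem FinSq.add {A B : GlInf R} (hA : FinSq A) (hB : FinSq B) : FinSq (A + B) := by
  obtain ⟨N, hN⟩ := hA
  obtain ⟨M, hM⟩ := hB
  refine ⟨N + M, fun i j h => ?_⟩
  push_cast
  by_cases hA : entry A i j = 0
  · have := hM i j (by simpa [hA] using h)
    constructor <;> linarith [this.1, this.2, Int.natCast_nonneg N]
  · have := hN i j hA
    constructor <;> linarith [this.1, this.2, Int.natCast_nonneg M]

theorem exists_of_entry_mul_ne {A B : GlInf R} {i j : ℤ} (h : entry (A * B) i j ≠ 0) :
    ∃ k, entry A i k ≠ 0 ∧ entry B k j ≠ 0 := by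
  by_contra! hc
  refine h ?_
  rw [entry_mul]
  refine finsum_eq_zero_of_forall_eq_zero fun k => ?_
  by_cases hA : entry A i k = 0
  · rw [hA, zero_mul]
  · rw [hc k hA, mul_zero]

theorem FinSq.mul_right {A : GlInf R} (hA : FinSq A) (B : GlInf R) : FinSq (A * B) := by
  obtain ⟨N, hN⟩ := hA
  obtain ⟨M, hM⟩ := exists_band B
  refine ⟨N + M, fun i j h => ?_⟩
  obtain ⟨k, h1, h2⟩ := exists_of_entry_mul_ne h
  have h3 := hN i k h1
  have h4 := hM k j h2
  simp only [abs_le] at *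
  push_cast
  omega

theorem FinSq.mul_left {A : GlInf R} (hA : FinSq A) (B : GlInf R) : FinSq (B * A) := by
  obtain ⟨N, hN⟩ := hA
  obtain ⟨M, hM⟩ := exists_band B
  refine ⟨N + M, fun i j h => ?_⟩
  obtain ⟨k, h1, h2⟩ := exists_of_entry_mul_ne h
  have h3 := hN k j h2
  have h4 := hM i k h1
  simp only [abs_le] at *
  push_cast
  omega

theorem FinSq.finite_diag {A : GlInf R} (hA : FinSq A) :
    (Function.support fun i => entry A i i).Finite := by
  obtain ⟨N, hN⟩ := hA
  exact (Set.finite_Icc (-(N : ℤ)) N).subset fun i hi => abs_le.1 (hN i i hi).1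

theorem tr_add {A B : GlInf R} (hA : FinSq A) (hB : FinSq B) : tr (A + B) = tr A + tr B := by
  simp only [tr, entry_add]
  exact finsum_add_distrib hA.finite_diag hB.finite_diag

theorem tr_smul (c : ℂ) (A : GlInf R) : tr (c • A) = c • tr A := by
  simp only [tr, entry_smul]
  exact (smul_finsum c _).symm

theorem tr_comm {A : GlInf R} (hA : FinSq A) (B : GlInf R) : tr (A * B) = tr (B * A) := by
  obtain ⟨N, hN⟩ := hA
  set S := Finset.Icc (-(N : ℤ)) N
  have hS : ∀ i j, entry A i j ≠ 0 → i ∈ S ∧ j ∈ S := fun i j h => by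
    simpa [S, ← abs_le] using hN i j h
  have h1 : ∀ i, entry (A * B) i i = ∑ k ∈ S, entry A i k * entry B k i := fun i => by
    rw [entry_mul]
    refine finsum_eq_sum_of_support_subset _ fun k hk => ?_
    exact (hS i k (left_ne_zero_of_mul hk)).2
  have h2 : ∀ i, entry (B * A) i i = ∑ k ∈ S, entry B i k * entry A k i := fun i => by
    rw [entry_mul]
    refine finsum_eq_sum_of_support_subset _ fun k hk => ?_
    exact (hS k i (right_ne_zero_of_mul hk)).1
  rw [tr, tr, finsum_eq_sum_of_support_subset (s := S), finsum_eq_sum_of_support_subset (s := S)]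
  · simp only [h1, h2]
    rw [Finset.sum_comm]
    exact Finset.sum_congr rfl fun i _ => Finset.sum_congr rfl fun j _ => mul_comm _ _
  · intro i hi
    rw [Function.mem_support, h2] at hi
    obtain ⟨k, _, hk⟩ := Finset.exists_ne_zero_of_sum_ne_zero hi
    exact (hS k i (right_ne_zero_of_mul hk)).2
  · intro i hi
    rw [Function.mem_support, h1] at hi
    obtain ⟨k, _, hk⟩ := Finset.exists_ne_zero_of_sum_ne_zero hi
    exact (hS i k (left_ne_zero_of_mul hk)).1

end Matrices

/-- A 2-cocycle on a complex Lie algebra `L` with values in a vector space `Z` (with the trivial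
action of `L`). -/
structure Cocycle (L Z : Type*) [LieRing L] [LieAlgebra ℂ L] [AddCommGroup Z] [Module ℂ Z] where
  /-- the underlying bilinear map -/
  toFun : L →ₗ[ℂ] L →ₗ[ℂ] Z
  self : ∀ x, toFun x x = 0
  jacobi : ∀ x y z, toFun ⁅x, y⁆ z + toFun ⁅y, z⁆ x + toFun ⁅z, x⁆ y = 0

section Extension

variable {L Z : Type*} [LieRing L] [LieAlgebra ℂ L] [AddCommGroup Z] [Module ℂ Z]

theorem Cocycle.skew (ω : Cocycle L Z) (x y : L) : ω.toFun x y = -ω.toFun y x := by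
  have h := ω.self (x + y)
  simp only [map_add, LinearMap.add_apply, ω.self, zero_add, add_zero] at h
  exact eq_neg_of_add_eq_zero_right h

/-- The restriction of a cocycle to a Lie subalgebra. -/
def Cocycle.restrict (ω : Cocycle L Z) (K : LieSubalgebra ℂ L) : Cocycle K Z where
  toFun := ω.toFun.domRestrict₁₂ K.toSubmodule K.toSubmodule
  self x := ω.self x
  jacobi x y z := ω.jacobi x y z

/-- The central extension `L ⊕ Z` of `L` defined by a cocycle. -/
def CentralExt (_ω : Cocycle L Z) : Type _ := L × Z

namespace CentralExt

variable (ω : Cocycle L Z)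

instance : AddCommGroup (CentralExt ω) := inferInstanceAs (AddCommGroup (L × Z))
instance : Module ℂ (CentralExt ω) := inferInstanceAs (Module ℂ (L × Z))

/-- The pair `x + z` with `x` in `L` and `z` central. -/
def mk (x : L) (z : Z) : CentralExt ω := (x, z)

variable {ω}

/-- The component in `L`. -/
def fst (a : CentralExt ω) : L := a.1

/-- The component in the center `Z`. -/
def snd (a : CentralExt ω) : Z := a.2

@[ext] theorem ext {a b : CentralExt ω} (h1 : a.fst = b.fst) (h2 : a.snd = b.snd) : a = b :=
  Prod.ext h1 h2

@[simp] theorem fst_mk (x : L) (z : Z) : (mk ω x z).fst = x := rfl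
@[simp] theorem snd_mk (x : L) (z : Z) : (mk ω x z).snd = z := rfl
@[simp] theorem fst_add (a b : CentralExt ω) : (a + b).fst = a.fst + b.fst := rfl
@[simp] theorem snd_add (a b : CentralExt ω) : (a + b).snd = a.snd + b.snd := rfl
@[simp] theorem fst_smul (c : ℂ) (a : CentralExt ω) : (c • a).fst = c • a.fst := rfl
@[simp] theorem snd_smul (c : ℂ) (a : CentralExt ω) : (c • a).snd = c • a.snd := rfl
@[simp] theorem fst_zero : (0 : CentralExt ω).fst = 0 := rfl
@[simp] theorem snd_zero : (0 : CentralExt ω).snd = 0 := rfl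

instance : Bracket (CentralExt ω) (CentralExt ω) :=
  ⟨fun a b => mk ω ⁅a.fst, b.fst⁆ (ω.toFun a.fst b.fst)⟩

@[simp] theorem fst_lie (a b : CentralExt ω) : ⁅a, b⁆.fst = ⁅a.fst, b.fst⁆ := rfl
@[simp] theorem snd_lie (a b : CentralExt ω) : ⁅a, b⁆.snd = ω.toFun a.fst b.fst := rfl

instance : LieRing (CentralExt ω) where
  add_lie a b c := by ext <;> simp
  lie_add a b c := by ext <;> simp
  lie_self a := by ext <;> simp [ω.self]
  leibniz_lie a b c := by
    ext
    · simp
    · have h := ω.jacobi a.fst b.fst c.fst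
      simp only [snd_lie, fst_lie, snd_add]
      rw [ω.skew a.fst, ω.skew b.fst, ← lie_skew a.fst c.fst, map_neg, LinearMap.neg_apply,
        neg_neg]
      rw [add_assoc] at h
      rw [← sub_eq_zero, ← neg_eq_zero, ← h]
      abel

instance : LieAlgebra ℂ (CentralExt ω) where
  lie_smul c a b := by ext <;> simp

variable (ω) in
/-- The gradation of a central extension of a graded Lie algebra in which the center has
degree `0`. -/
def grade (𝒢 : ℤ → Submodule ℂ L) (k : ℤ) : Submodule ℂ (CentralExt ω) where
  carrier := {a | a.fst ∈ 𝒢 k ∧ (k ≠ 0 → a.snd = 0)}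
  add_mem' := fun {a b} ha hb => ⟨(𝒢 k).add_mem ha.1 hb.1, fun h => by
    simp [ha.2 h, hb.2 h]⟩
  zero_mem' := ⟨(𝒢 k).zero_mem, fun _ => rfl⟩
  smul_mem' := fun c a ha => ⟨(𝒢 k).smul_mem c ha.1, fun h => by simp [ha.2 h]⟩

end CentralExt

end Extension

section Matrices

variable {R : Type*} [CommRing R] [Algebra ℂ R]

theorem tr_lie_skew (A B : GlInf R) : tr (⁅matJ R, A⁆ * B) + tr (⁅matJ R, B⁆ * A) = 0 := by
  rw [tr_comm (finSq_matJ_lie B) A,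
    ← tr_add ((finSq_matJ_lie A).mul_right B) ((finSq_matJ_lie B).mul_left A)]
  have h : ⁅matJ R, A⁆ * B + A * ⁅matJ R, B⁆ = ⁅matJ R, A * B⁆ := by
    simp only [Ring.lie_def]; noncomm_ring
  rw [h, tr]
  exact finsum_eq_zero_of_forall_eq_zero fun i => by rw [entry_matJ_lie, sub_self, zero_mul]

theorem tr_sub {A B : GlInf R} (hA : FinSq A) (hB : FinSq B) : tr (A - B) = tr A - tr B := by
  have hB' : FinSq (-B) := by
    obtain ⟨N, hN⟩ := hB
    exact ⟨N, fun i j h => hN i j (by simpa using h)⟩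
  rw [sub_eq_add_neg, tr_add hA hB', sub_eq_add_neg, ← neg_one_smul ℂ B, tr_smul, neg_one_smul]

theorem tr_lie_lie (A B D : GlInf R) :
    tr (⁅matJ R, ⁅A, B⁆⁆ * D) = tr (⁅matJ R, A⁆ * ⁅B, D⁆) + tr (⁅matJ R, B⁆ * ⁅D, A⁆) := by
  have fA := finSq_matJ_lie A
  have fB := finSq_matJ_lie B
  have h : ⁅matJ R, ⁅A, B⁆⁆ * D
      = (⁅matJ R, A⁆ * (B * D) - B * (⁅matJ R, A⁆ * D))
        + (A * (⁅matJ R, B⁆ * D) - ⁅matJ R, B⁆ * (A * D)) := by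
    simp only [Ring.lie_def]; noncomm_ring
  have h1 : ⁅matJ R, A⁆ * ⁅B, D⁆ = ⁅matJ R, A⁆ * (B * D) - ⁅matJ R, A⁆ * D * B := by
    simp only [Ring.lie_def]; noncomm_ring
  have h2 : ⁅matJ R, B⁆ * ⁅D, A⁆ = ⁅matJ R, B⁆ * D * A - ⁅matJ R, B⁆ * (A * D) := by
    simp only [Ring.lie_def]; noncomm_ring
  have fs {X Y : GlInf R} (hX : FinSq X) (hY : FinSq Y) : FinSq (X - Y) := by
    obtain ⟨N, hN⟩ := hY
    rw [sub_eq_add_neg]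
    exact hX.add ⟨N, fun i j h => hN i j (by simpa using h)⟩
  rw [h, h1, h2, tr_add (fs (fA.mul_right _) ((fA.mul_right _).mul_left _))
    (fs ((fB.mul_right _).mul_left _) (fB.mul_right _)),
    tr_sub (fA.mul_right _) ((fA.mul_right _).mul_left _),
    tr_sub ((fB.mul_right _).mul_left _) (fB.mul_right _),
    tr_sub (fA.mul_right _) ((fA.mul_right _).mul_right _),
    tr_sub ((fB.mul_right _).mul_right _) (fB.mul_right _),
    tr_comm (fA.mul_right D) B, tr_comm (fB.mul_right D) A]

/-- The `R`-valued cocycle `C(A, B) = tr ([J, A] B)`. -/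
noncomputable def trCocycle (R : Type*) [CommRing R] [Algebra ℂ R] : Cocycle (GlInf R) R where
  toFun := LinearMap.mk₂ ℂ (fun A B => tr (⁅matJ R, A⁆ * B))
    (fun A A' B => by
      rw [lie_add, add_mul]
      exact tr_add ((finSq_matJ_lie A).mul_right B) ((finSq_matJ_lie A').mul_right B))
    (fun c A B => by rw [lie_smul, smul_mul_assoc, tr_smul])
    (fun A B B' => by
      rw [mul_add]
      exact tr_add ((finSq_matJ_lie A).mul_right B) ((finSq_matJ_lie A).mul_right B'))
    (fun c A B => by rw [mul_smul_comm, tr_smul])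
  self A := by
    have h := tr_lie_skew A A
    rw [← two_smul ℂ] at h
    exact (smul_eq_zero_iff_right (two_ne_zero)).1 h
  jacobi A B D := by
    simp only [LinearMap.mk₂_apply]
    rw [tr_lie_lie A B D]
    have h1 := tr_lie_skew A ⁅B, D⁆
    have h2 := tr_lie_skew B ⁅D, A⁆
    linear_combination h1 + h2

end Matrices

/-! ### Operators acting by infinite matrices -/

section Phi

variable {R : Type*} [CommRing R] [Algebra ℂ R]

theorem smul_shiftDiag (c : ℂ) (k : ℤ) (d : ℤ → R) :
    c • shiftDiag k d = shiftDiag k fun j => c • d j :=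
  glInf_ext fun i j => by simp [smul_ite]

theorem shiftDiag_add (k : ℤ) (c d : ℤ → R) :
    shiftDiag k (fun j => c j + d j) = shiftDiag k c + shiftDiag k d :=
  glInf_ext fun i j => by
    by_cases h : j - k = i <;> simp [h]

/-- The linear map `t^k f(D) ↦ ∑ j, f(a - j) E_{j-k, j}`. -/
noncomputable def phiL (a : R) : DiffOp →ₗ[ℂ] GlInf R :=
  DiffOp.lift fun k =>
    { toFun := fun f => shiftDiag k fun j => Polynomial.aeval (a - (j : R)) f
      map_add' := fun f g => by simp only [map_add, shiftDiag_add]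
      map_smul' := fun c f => by simp only [map_smul, smul_shiftDiag, RingHom.id_apply] }

theorem phiL_mono (a : R) (k : ℤ) (f : ℂ[X]) :
    phiL a (DiffOp.mono k f) = shiftDiag k fun j => Polynomial.aeval (a - (j : R)) f := by
  simp [phiL]

theorem aeval_comp_add (x : R) (s : ℤ) (f : ℂ[X]) :
    Polynomial.aeval x (f.comp (Polynomial.X + Polynomial.C (s : ℂ)))
      = Polynomial.aeval (x + (s : R)) f := by
  rw [Polynomial.aeval_comp]
  simp

theorem phiL_mul (a : R) (x y : DiffOp) : phiL a (x * y) = phiL a x * phiL a y := by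
  refine DiffOp.induct (p := fun x => phiL a (x * y) = phiL a x * phiL a y) x (by simp)
    (fun x x' hx hx' => by simp [add_mul, hx, hx']) (fun r f => ?_)
  refine DiffOp.induct (p := fun y => phiL a (DiffOp.mono r f * y)
    = phiL a (DiffOp.mono r f) * phiL a y) y (by simp)
    (fun y y' hy hy' => by simp [mul_add, hy, hy']) (fun s g => ?_)
  rw [DiffOp.mono_mul_mono, phiL_mono, phiL_mono, phiL_mono, shiftDiag_mul_shiftDiag]
  congr 1
  funext j
  rw [map_mul, aeval_comp_add]
  congr 3
  push_cast
  ring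

/-- The algebra homomorphism `t^k f(D) ↦ ∑ j, f(a - j) E_{j-k, j}`. -/
noncomputable def phi (a : R) : DiffOp →ₐ[ℂ] GlInf R :=
  AlgHom.ofLinearMap (phiL a)
    (by
      rw [DiffOp.one_def, phiL_mono]
      simpa using shiftDiag_zero_one)
    (phiL_mul a)

@[simp] theorem phi_mono (a : R) (k : ℤ) (f : ℂ[X]) :
    phi a (DiffOp.mono k f) = shiftDiag k fun j => Polynomial.aeval (a - (j : R)) f :=
  phiL_mono a k f

theorem phi_lie (a : R) (x y : DiffOp) : phi a ⁅x, y⁆ = ⁅phi a x, phi a y⁆ := by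
  simp only [Ring.lie_def, map_sub, map_mul]

theorem entry_phi (a : R) (x : DiffOp) (i j : ℤ) :
    entry (phi a x) i j = Polynomial.aeval (a - (j : R)) (DiffOp.coeff (j - i) x) := by
  refine DiffOp.induct (p := fun x => entry (phi a x) i j
    = Polynomial.aeval (a - (j : R)) (DiffOp.coeff (j - i) x)) x (by simp)
    (fun x y hx hy => by simp [hx, hy]) (fun k f => ?_)
  rw [phi_mono, entry_shiftDiag, DiffOp.coeff_mono]
  by_cases h : j - k = i
  · rw [if_pos h, if_pos (by omega)]
  · rw [if_neg h, if_neg (by omega), map_zero]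

/-- `∑_{-r ≤ n ≤ -1} f(a + n) g(a + n + r)` for `r > 0`, extended antisymmetrically to `r ≤ 0`. -/
noncomputable def psiForm (a : R) (r : ℤ) (f g : ℂ[X]) : R :=
  (∑ n ∈ Finset.Ico (-r) 0,
    Polynomial.aeval (a + (n : R)) f * Polynomial.aeval (a + (n : R) + (r : R)) g)
  - ∑ n ∈ Finset.Ico r 0,
    Polynomial.aeval (a + (n : R)) g * Polynomial.aeval (a + (n : R) - (r : R)) f

/-- The bilinear form `(t^r f(D), t^{-r} g(D)) ↦ psiForm a r f g`, zero on the pairs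
`(t^r f(D), t^s g(D))` with `r + s ≠ 0`. -/
noncomputable def psiL (a : R) : DiffOp →ₗ[ℂ] DiffOp →ₗ[ℂ] R :=
  DiffOp.lift fun r => LinearMap.flip <| DiffOp.lift fun s =>
    if r + s = 0 then LinearMap.flip <| LinearMap.mk₂ ℂ (psiForm a r)
      (fun f f' g => by simp only [psiForm, map_add, add_mul, mul_add, Finset.sum_add_distrib]; ring)
      (fun c f g => by
        simp only [psiForm, map_smul, smul_mul_assoc, mul_smul_comm, ← Finset.smul_sum, smul_sub])
      (fun f g g' => by simp only [psiForm, map_add, add_mul, mul_add, Finset.sum_add_distrib]; ring)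
      (fun c f g => by
        simp only [psiForm, map_smul, smul_mul_assoc, mul_smul_comm, ← Finset.smul_sum, smul_sub])
    else 0

theorem psiL_mono (a : R) (r s : ℤ) (f g : ℂ[X]) :
    psiL a (DiffOp.mono r f) (DiffOp.mono s g) = if r + s = 0 then psiForm a r f g else 0 := by
  rw [psiL, DiffOp.lift_mono, LinearMap.flip_apply, DiffOp.lift_mono]
  split_ifs <;> simp

theorem trCocycle_apply (A B : GlInf R) :
    (trCocycle R).toFun A B = tr (⁅matJ R, A⁆ * B) := rfl

theorem trCocycle_phi (a : R) (x y : DiffOp) :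
    (trCocycle R).toFun (phi a x) (phi a y) = psiL a x y := by
  refine DiffOp.induct (p := fun x => (trCocycle R).toFun (phi a x) (phi a y) = psiL a x y) x
    (by simp) (fun x x' hx hx' => by simp [hx, hx']) (fun r f => ?_)
  refine DiffOp.induct (p := fun y => (trCocycle R).toFun (phi a (DiffOp.mono r f)) (phi a y)
    = psiL a (DiffOp.mono r f) y) y
    (by simp) (fun x x' hx hx' => by simp only [map_add, hx, hx']) (fun s g => ?_)
  rw [psiL_mono, trCocycle_apply, phi_mono, phi_mono, tr]
  simp only [entry_mul_shiftDiag, entry_matJ_lie, entry_shiftDiag]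
  split_ifs with hrs
  · obtain rfl : s = -r := by omega
    simp only [sub_neg_eq_add, add_sub_cancel_right, if_true]
    rw [psiForm]
    rcases le_total 0 r with hr | hr
    · rw [Finset.Ico_eq_empty (a := r) (by omega), Finset.sum_empty, sub_zero,
        finsum_eq_sum_of_support_subset (s := Finset.Ioc (-r) 0)]
      · refine Finset.sum_nbij' (fun i => -i - r) (fun n => -n - r) ?_ ?_ ?_ ?_ ?_
        · intro i hi; simp only [Finset.mem_Ioc, Finset.mem_Ico] at *; omega
        · intro i hi; simp only [Finset.mem_Ioc, Finset.mem_Ico] at *; omega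
        · intro i hi; omega
        · intro i hi; omega
        · intro i hi
          simp only [Finset.mem_Ioc] at hi
          rw [if_pos hi.2, if_neg (by omega), sub_zero, one_mul]
          push_cast
          congr 3 <;> ring
      · intro i hi
        rw [Function.mem_support] at hi
        have := left_ne_zero_of_mul (left_ne_zero_of_mul hi)
        simp only [Finset.coe_Ioc, Set.mem_Ioc]
        by_cases h1 : i ≤ 0 <;> by_cases h2 : i + r ≤ 0 <;> simp [h1, h2] at this <;> omega
    · rw [Finset.Ico_eq_empty (a := -r) (by omega), Finset.sum_empty, zero_sub,
        finsum_eq_sum_of_support_subset (s := Finset.Ioc 0 (-r)), ← Finset.sum_neg_distrib]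
      · refine Finset.sum_nbij' (fun i => -i) (fun n => -n) ?_ ?_ ?_ ?_ ?_
        · intro i hi; simp only [Finset.mem_Ioc, Finset.mem_Ico] at *; omega
        · intro i hi; simp only [Finset.mem_Ioc, Finset.mem_Ico] at *; omega
        · intro i hi; omega
        · intro i hi; omega
        · intro i hi
          simp only [Finset.mem_Ioc] at hi
          rw [if_neg (by omega), if_pos (by omega), zero_sub, neg_one_mul, neg_mul, mul_comm]
          push_cast
          congr 4 <;> ring
      · intro i hi
        rw [Function.mem_support] at hi
        have := left_ne_zero_of_mul (left_ne_zero_of_mul hi)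
        simp only [Finset.coe_Ioc, Set.mem_Ioc]
        by_cases h1 : i ≤ 0 <;> by_cases h2 : i + r ≤ 0 <;> simp [h1, h2] at this <;> omega
  · refine finsum_eq_zero_of_forall_eq_zero fun i => ?_
    rw [if_neg (c := i - s - r = i) (by omega), mul_zero, zero_mul]

end Phi

/-- The 2-cocycle `Ψ` on the Lie algebra of differential operators on the circle. -/
noncomputable def Psi : Cocycle DiffOp ℂ where
  toFun := psiL (0 : ℂ)
  self x := by rw [← trCocycle_phi, Cocycle.self]
  jacobi x y z := by
    simp only [← trCocycle_phi, phi_lie]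
    exact (trCocycle ℂ).jacobi _ _ _

theorem Psi_mono_of_pos {r : ℤ} (hr : 0 < r) (f g : ℂ[X]) :
    Psi.toFun (DiffOp.mono r f) (DiffOp.mono (-r) g)
      = ∑ n ∈ Finset.Icc (-r) (-1), f.eval (n : ℂ) * g.eval ((n : ℂ) + (r : ℂ)) := by
  have h : Finset.Ico (-r) 0 = Finset.Icc (-r) (-1) := by ext; simp; omega
  have h' : Finset.Ico r 0 = ∅ := Finset.Ico_eq_empty (by omega)
  simp [Psi, psiL_mono, psiForm, h, h', Polynomial.aeval_def, Polynomial.eval₂_eq_eval_map]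

theorem Psi_mono_of_ne {r s : ℤ} (h : r + s ≠ 0 ∨ (r = 0 ∧ s = 0)) (f g : ℂ[X]) :
    Psi.toFun (DiffOp.mono r f) (DiffOp.mono s g) = 0 := by
  rw [Psi, psiL_mono]
  rcases h with h | ⟨rfl, rfl⟩
  · rw [if_neg h]
  · simp [psiForm]

/-! ### The central term of the lift -/

/-- The linear map on polynomials with `(antidiff h)(x + 1) - (antidiff h)(x) = h(x)`, sending `x^n`
to `B_{n+1}(x) / (n+1)`, where `B_n` are the Bernoulli polynomials. -/
noncomputable def antidiff : ℂ[X] →ₗ[ℂ] ℂ[X] :=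
  Polynomial.lsum fun n => LinearMap.toSpanSingleton ℂ ℂ[X]
    (((n : ℂ) + 1)⁻¹ • (Polynomial.bernoulli (n + 1)).map (algebraMap ℚ ℂ))

theorem antidiff_X_pow (n : ℕ) : antidiff (Polynomial.X ^ n)
    = ((n : ℂ) + 1)⁻¹ • (Polynomial.bernoulli (n + 1)).map (algebraMap ℚ ℂ) := by
  rw [← Polynomial.monomial_one_right_eq_X_pow, antidiff, Polynomial.lsum_apply,
    Polynomial.sum_monomial_index _ _ (by simp)]
  simp

theorem antidiff_spec (h : ℂ[X]) :
    (antidiff h).comp (Polynomial.X + 1) - antidiff h = h := by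
  induction h using Polynomial.induction_on' with
  | add p q hp hq =>
    rw [map_add, Polynomial.add_comp]
    linear_combination hp + hq
  | monomial n c =>
    have hn : ((n : ℂ) + 1) ≠ 0 := by exact_mod_cast Nat.succ_ne_zero n
    have hb := congrArg (Polynomial.map (algebraMap ℚ ℂ))
      (Polynomial.bernoulli_comp_one_add_X (n + 1))
    rw [Polynomial.map_comp] at hb
    simp only [Polynomial.map_add, Polynomial.map_one, Polynomial.map_X, nsmul_eq_mul, Polynomial.map_mul,
      Polynomial.map_natCast, Polynomial.map_pow, Nat.add_sub_cancel] at hb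
    rw [← mul_one c, ← smul_eq_mul, ← Polynomial.smul_monomial,
      Polynomial.monomial_one_right_eq_X_pow, map_smul, antidiff_X_pow, Polynomial.smul_comp,
      Polynomial.smul_comp, add_comm Polynomial.X, hb, ← smul_sub, ← smul_sub, add_sub_cancel_left]
    congr 1
    rw [← nsmul_eq_mul, ← Nat.cast_smul_eq_nsmul ℂ, smul_smul]
    push_cast
    rw [inv_mul_cancel₀ hn, one_smul]

theorem eq_C_of_periodic {P : ℂ[X]} (h : P.comp (Polynomial.X + 1) = P) :
    P = Polynomial.C (P.eval 0) := by
  have h1 : ∀ n : ℕ, P.eval (n : ℂ) = P.eval 0 := by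
    intro n
    induction n with
    | zero => simp
    | succ n ih =>
      rw [← ih]
      conv_rhs => rw [← h]
      simp
  rw [← sub_eq_zero]
  refine Polynomial.eq_zero_of_infinite_isRoot _ (Set.infinite_of_injective_forall_mem
    (f := fun n : ℕ => (n : ℂ)) Nat.cast_injective fun n => ?_)
  simp [h1]

section Alpha

variable {R : Type*} [CommRing R] [Algebra ℂ R]

/-- The functional describing the central component of the lift: on `f(D)` it is
`F(0) - F(a)`, where `F(x + 1) - F(x) = f(x)`. -/
noncomputable def alpha (a : R) : ℂ[X] →ₗ[ℂ] R :=
  ((Polynomial.aeval (0 : R)).toLinearMap - (Polynomial.aeval a).toLinearMap) ∘ₗ antidiff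

theorem alpha_apply (a : R) (h : ℂ[X]) :
    alpha a h = Polynomial.aeval (0 : R) (antidiff h) - Polynomial.aeval a (antidiff h) := rfl

theorem sum_antidiff (a : R) (F : ℂ[X]) (k : ℕ) :
    ∑ n ∈ Finset.Ico (-(k : ℤ)) 0, Polynomial.aeval (a + (n : R)) F
      = Polynomial.aeval a (antidiff F) - Polynomial.aeval (a - (k : R)) (antidiff F) := by
  induction k with
  | zero => simp
  | succ k ih =>
    have h : Finset.Ico (-((k + 1 : ℕ) : ℤ)) 0
        = insert (-((k : ℤ) + 1)) (Finset.Ico (-(k : ℤ)) 0) := by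
      ext; simp only [Finset.mem_Ico, Finset.mem_insert]; push_cast; omega
    rw [h, Finset.sum_insert (by simp), ih]
    have h2 := congrArg (Polynomial.aeval (a + ((-((k : ℤ) + 1) : ℤ) : R))) (antidiff_spec F)
    rw [map_sub, Polynomial.aeval_comp] at h2
    simp only [map_add, Polynomial.aeval_X, map_one] at h2
    rw [← h2]
    push_cast
    rw [show a + -((k : R) + 1) + 1 = a - k by ring, show a + -((k : R) + 1) = a - (k + 1) by ring]
    ring

theorem psiForm_eq (a : R) (r : ℤ) (f g : ℂ[X]) :
    psiForm a r f g = Polynomial.aeval a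
      (antidiff (f * g.comp (Polynomial.X + Polynomial.C (r : ℂ)))
        - (antidiff (f * g.comp (Polynomial.X + Polynomial.C (r : ℂ)))).comp
          (Polynomial.X + Polynomial.C ((-r : ℤ) : ℂ))) := by
  set F := f * g.comp (Polynomial.X + Polynomial.C (r : ℂ)) with hF
  have hFe : ∀ x : R, Polynomial.aeval x F = Polynomial.aeval x f * Polynomial.aeval (x + r) g :=
    fun x => by rw [hF, map_mul, aeval_comp_add]
  rw [map_sub, aeval_comp_add, psiForm]
  rcases le_total 0 r with hr | hr
  · obtain ⟨k, rfl⟩ := Int.eq_ofNat_of_zero_le hr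
    rw [Finset.Ico_eq_empty (a := (k : ℤ)) (by omega), Finset.sum_empty, sub_zero]
    have := sum_antidiff a F k
    simp only [hFe] at this
    rw [this]
    push_cast
    rw [sub_eq_add_neg a]
  · obtain ⟨k, hk⟩ := Int.eq_ofNat_of_zero_le (neg_nonneg.2 hr)
    obtain rfl : r = -(k : ℤ) := by omega
    rw [Finset.Ico_eq_empty (a := - -(k : ℤ)) (by omega), Finset.sum_empty, zero_sub]
    have := sum_antidiff (a + (k : R)) F k
    simp only [hFe] at this
    rw [add_sub_cancel_right] at this
    push_cast at this ⊢
    rw [neg_neg, ← neg_sub, ← this, neg_inj]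
    refine Finset.sum_congr rfl fun n _ => ?_
    rw [mul_comm]
    congr 3 <;> ring

theorem alpha_lie (a : R) (r : ℤ) (f g : ℂ[X]) :
    alpha a (f.comp (Polynomial.X + Polynomial.C ((-r : ℤ) : ℂ)) * g
        - f * g.comp (Polynomial.X + Polynomial.C (r : ℂ)))
      = psiForm a r f g - algebraMap ℂ R (psiForm 0 r f g) := by
  rw [psiForm_eq, psiForm_eq]
  set F := f * g.comp (Polynomial.X + Polynomial.C (r : ℂ)) with hF
  set T : ℂ[X] := Polynomial.X + Polynomial.C ((-r : ℤ) : ℂ) with hT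
  have h1 : f.comp T * g = F.comp T := by
    rw [hF, Polynomial.mul_comp, Polynomial.comp_assoc]
    simp [hT]
  rw [h1]
  set P := antidiff (F.comp T - F) + (antidiff F - (antidiff F).comp T) with hP
  have hper : P.comp (Polynomial.X + 1) = P := by
    have e1 := antidiff_spec (F.comp T - F)
    have e2 := antidiff_spec F
    have e3 : ((antidiff F).comp T).comp (Polynomial.X + 1)
        = ((antidiff F).comp (Polynomial.X + 1)).comp T := by
      rw [Polynomial.comp_assoc, Polynomial.comp_assoc]
      congr 1
      simp [hT]
      ring
    have e4 : ((antidiff F).comp (Polynomial.X + 1)).comp T - (antidiff F).comp T = F.comp T := by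
      rw [← Polynomial.sub_comp, e2]
    rw [hP, Polynomial.add_comp, Polynomial.sub_comp, e3]
    linear_combination e1 + e2 - e4
  have hc := eq_C_of_periodic hper
  have h2 : antidiff (F.comp T - F)
      = Polynomial.C (P.eval 0) - (antidiff F - (antidiff F).comp T) := by
    rw [← hc, hP]; ring
  rw [alpha_apply, h2]
  have h3 : ∀ Q : ℂ[X], algebraMap ℂ R (Polynomial.aeval (0 : ℂ) Q) = Polynomial.aeval (0 : R) Q :=
    fun Q => by rw [← Polynomial.aeval_algebraMap_apply, map_zero]
  rw [h3]
  simp only [map_sub, Polynomial.aeval_C]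
  ring

theorem alpha_coeff_lie (a : R) (x y : DiffOp) :
    alpha a (DiffOp.coeff 0 ⁅x, y⁆) = psiL a x y - algebraMap ℂ R (psiL 0 x y) := by
  refine DiffOp.induct (p := fun x => alpha a (DiffOp.coeff 0 ⁅x, y⁆)
    = psiL a x y - algebraMap ℂ R (psiL 0 x y)) x
    (by simp) (fun x x' hx hx' => ?_) (fun r f => ?_)
  · simp only [add_lie, map_add, LinearMap.add_apply, hx, hx']; ring
  refine DiffOp.induct (p := fun y => alpha a (DiffOp.coeff 0 ⁅DiffOp.mono r f, y⁆)
    = psiL a (DiffOp.mono r f) y - algebraMap ℂ R (psiL 0 (DiffOp.mono r f) y)) y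
    (by simp) (fun x x' hx hx' => ?_) (fun s g => ?_)
  · simp only [lie_add, map_add, hx, hx']; ring
  rw [DiffOp.mono_lie_mono, DiffOp.coeff_mono, psiL_mono, psiL_mono]
  split_ifs with h
  · obtain rfl : s = -r := by omega
    exact alpha_lie a r f g
  · simp

end Alpha

/-! ### The Lie algebras fixed by minus the anti-involutions -/

/-- The sign `ε ^ k`, for `ε = ±1` and `k` an integer. -/
def sgn (ε : ℤˣ) (k : ℤ) : ℤ := ((ε ^ k : ℤˣ) : ℤ)

theorem sgn_add (ε : ℤˣ) (k l : ℤ) : sgn ε (k + l) = sgn ε k * sgn ε l := by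
  simp [sgn, zpow_add]

theorem sgn_mul_self (ε : ℤˣ) (k : ℤ) : sgn ε k * sgn ε k = 1 := by
  rw [sgn, ← Units.val_mul, Int.units_mul_self, Units.val_one]

theorem sgn_neg (ε : ℤˣ) (k : ℤ) : sgn ε (-k) = sgn ε k := by
  have h : sgn ε (-k) * sgn ε k = 1 := by rw [← sgn_add]; simp [sgn]
  calc sgn ε (-k) = sgn ε (-k) * (sgn ε k * sgn ε k) := by rw [sgn_mul_self, mul_one]
    _ = sgn ε k := by rw [← mul_assoc, h, one_mul]

/-- `f(-D - k)`, as a linear function of `f`. -/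
noncomputable def reflect (k : ℤ) : ℂ[X] →ₗ[ℂ] ℂ[X] :=
  (Polynomial.aeval (-Polynomial.X - Polynomial.C (k : ℂ))).toLinearMap

theorem reflect_apply (k : ℤ) (f : ℂ[X]) :
    reflect k f = f.comp (-Polynomial.X - Polynomial.C (k : ℂ)) := by
  simp [reflect, Polynomial.comp, Polynomial.aeval_def]

/-- The linear map `t^k f(D) ↦ - (ε t)^k f(-D - k)`. The anti-involution `σ_ε` of the algebra of
operators `Y D` is `Y D ↦ (sigma₀ ε Y) D`; here `ε = 1` gives `σ_+` and `ε = -1` gives `σ_-`. -/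
noncomputable def sigma₀ (ε : ℤˣ) : DiffOp →ₗ[ℂ] DiffOp :=
  DiffOp.lift fun k => (-(sgn ε k : ℂ)) • (DiffOp.mono k ∘ₗ reflect k)

theorem sigma₀_mono (ε : ℤˣ) (k : ℤ) (f : ℂ[X]) :
    sigma₀ ε (DiffOp.mono k f)
      = (-(sgn ε k : ℂ)) • DiffOp.mono k (f.comp (-Polynomial.X - Polynomial.C (k : ℂ))) := by
  simp [sigma₀, reflect_apply]

/-- The operator `D = t d/dt`. -/
noncomputable def opD : DiffOp := DiffOp.mono 0 Polynomial.X

theorem mono_mul_opD (k : ℤ) (f : ℂ[X]) :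
    DiffOp.mono k f * opD = DiffOp.mono k (f * Polynomial.X) := by
  rw [opD, DiffOp.mono_mul_mono]
  simp

theorem coeff_mul_opD (Y : DiffOp) (k : ℤ) :
    DiffOp.coeff k (Y * opD) = DiffOp.coeff k Y * Polynomial.X := by
  refine DiffOp.induct (p := fun Y => DiffOp.coeff k (Y * opD)
    = DiffOp.coeff k Y * Polynomial.X) Y (by simp)
    (fun x y hx hy => by simp [add_mul, hx, hy]) (fun l f => ?_)
  rw [mono_mul_opD, DiffOp.coeff_mono, DiffOp.coeff_mono]
  split_ifs <;> simp

theorem sigma₀_mul (ε : ℤˣ) (Y Z : DiffOp) :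
    sigma₀ ε (Y * opD * Z) = sigma₀ ε Z * opD * sigma₀ ε Y := by
  refine DiffOp.induct (p := fun Y => sigma₀ ε (Y * opD * Z) = sigma₀ ε Z * opD * sigma₀ ε Y) Y
    (by simp) (fun x y hx hy => by simp [add_mul, mul_add, hx, hy]) (fun k f => ?_)
  refine DiffOp.induct (p := fun Z => sigma₀ ε (DiffOp.mono k f * opD * Z)
    = sigma₀ ε Z * opD * sigma₀ ε (DiffOp.mono k f)) Z
    (by simp) (fun x y hx hy => by simp only [add_mul, mul_add, map_add, hx, hy]) (fun l g => ?_)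
  rw [mono_mul_opD, DiffOp.mono_mul_mono, sigma₀_mono, sigma₀_mono, sigma₀_mono,
    smul_mul_assoc, smul_mul_assoc, mul_smul_comm, smul_smul, mono_mul_opD,
    DiffOp.mono_mul_mono, add_comm l k, ← map_smul, ← map_smul]
  congr 1
  rw [sgn_add]
  simp only [Polynomial.mul_comp, Polynomial.comp_assoc, Polynomial.X_comp, Polynomial.C_comp,
    Polynomial.add_comp, Polynomial.sub_comp, Polynomial.neg_comp, Polynomial.smul_eq_C_mul]
  rw [show (-Polynomial.X - Polynomial.C ((k + l : ℤ) : ℂ) + Polynomial.C (l : ℂ) : ℂ[X])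
      = -Polynomial.X - Polynomial.C (k : ℂ) by push_cast; rw [map_add]; ring,
    show (-(Polynomial.X + Polynomial.C (k : ℂ)) - Polynomial.C (l : ℂ) : ℂ[X])
      = -Polynomial.X - Polynomial.C ((k + l : ℤ) : ℂ) by push_cast; rw [map_add]; ring]
  push_cast
  simp only [map_neg, map_mul]
  ring

/-- The Lie algebra of the operators `d = Y D` with `σ_ε(d) = -d`. -/
noncomputable def DxPM (ε : ℤˣ) : LieSubalgebra ℂ DiffOp where
  carrier := {d | ∃ Y : DiffOp, d = Y * opD ∧ sigma₀ ε Y * opD = -(Y * opD)}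
  add_mem' := by
    rintro _ _ ⟨Y, rfl, hY⟩ ⟨Z, rfl, hZ⟩
    exact ⟨Y + Z, by rw [add_mul], by rw [map_add, add_mul, hY, hZ, add_mul]; abel⟩
  zero_mem' := ⟨0, by simp, by simp⟩
  smul_mem' := by
    rintro c _ ⟨Y, rfl, hY⟩
    exact ⟨c • Y, by rw [smul_mul_assoc],
      by rw [map_smul, smul_mul_assoc, hY, smul_mul_assoc, smul_neg]⟩
  lie_mem' := by
    rintro _ _ ⟨Y, rfl, hY⟩ ⟨Z, rfl, hZ⟩
    refine ⟨Y * opD * Z - Z * opD * Y, ?_, ?_⟩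
    · rw [Ring.lie_def]; noncomm_ring
    · rw [map_sub, sigma₀_mul, sigma₀_mul, sub_mul, mul_assoc (sigma₀ ε Z * opD), hY, hZ,
        mul_assoc, hZ]
      noncomm_ring

/-- An explicit description of the elements of `DxPM ε`. -/
theorem mem_DxPM {ε : ℤˣ} {d : DiffOp} (hd : d ∈ DxPM ε) (k : ℤ) :
    ∃ f : ℂ[X], DiffOp.coeff k d = f * Polynomial.X ∧
      f = (sgn ε k : ℂ) • f.comp (-Polynomial.X - Polynomial.C (k : ℂ)) := by
  obtain ⟨Y, rfl, hY⟩ := hd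
  refine ⟨DiffOp.coeff k Y, coeff_mul_opD Y k, ?_⟩
  have h := congrArg (DiffOp.coeff k) hY
  rw [map_neg, coeff_mul_opD, coeff_mul_opD, ← neg_mul] at h
  have h := mul_right_cancel₀ Polynomial.X_ne_zero h
  have h2 : DiffOp.coeff k (sigma₀ ε Y)
      = (-(sgn ε k : ℂ)) • (DiffOp.coeff k Y).comp (-Polynomial.X - Polynomial.C (k : ℂ)) := by
    refine DiffOp.induct (p := fun Y => DiffOp.coeff k (sigma₀ ε Y)
      = (-(sgn ε k : ℂ)) • (DiffOp.coeff k Y).comp (-Polynomial.X - Polynomial.C (k : ℂ))) Y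
      (by simp) (fun x y hx hy => by simp only [map_add, hx, hy, Polynomial.add_comp, smul_add])
      (fun l f => ?_)
    rw [sigma₀_mono, map_smul, DiffOp.coeff_mono, DiffOp.coeff_mono]
    split_ifs with h
    · rw [h]
    · simp
  rw [h2, neg_smul, neg_inj] at h
  exact h.symm

theorem mono_mem_DxPM_zero (ε : ℤˣ) (l : ℕ) (hl : Even l) :
    DiffOp.mono 0 (Polynomial.X ^ l * Polynomial.X) ∈ DxPM ε := by
  refine ⟨DiffOp.mono 0 (Polynomial.X ^ l), (mono_mul_opD _ _).symm, ?_⟩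
  rw [sigma₀_mono, smul_mul_assoc, mono_mul_opD, mono_mul_opD]
  simp [sgn, hl.neg_pow]

/-- The central extension of `DxPM ε` by the restriction of the cocycle `Ψ`. -/
abbrev DHat (ε : ℤˣ) : Type := CentralExt (Psi.restrict (DxPM ε))

/-- The homogeneous components of `DxPM ε` in the principal gradation. -/
noncomputable def DxPMgrade (ε : ℤˣ) (k : ℤ) : Submodule ℂ (DxPM ε) where
  carrier := {d | ∀ l, l ≠ k → DiffOp.coeff l (d : DiffOp) = 0}
  add_mem' := fun {a b} ha hb l hl => by simp [ha l hl, hb l hl]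
  zero_mem' := fun l _ => by simp
  smul_mem' := fun c a ha l hl => by simp [ha l hl]

/-- The principal gradation of the central extension of `DxPM ε`. -/
noncomputable def DHatGrade (ε : ℤˣ) : ℤ → Submodule ℂ (DHat ε) :=
  CentralExt.grade (Psi.restrict (DxPM ε)) (DxPMgrade ε)

/-! ### The Lie algebras of types `C` and `D` -/

/-- The truncated polynomial algebra `ℂ[u]/(u^(m+1))`. -/
def Rm (m : ℕ) : Type := ℂ[X] ⧸ Ideal.span {(Polynomial.X : ℂ[X]) ^ (m + 1)}

noncomputable instance (m : ℕ) : CommRing (Rm m) :=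
  inferInstanceAs (CommRing (ℂ[X] ⧸ Ideal.span {(Polynomial.X : ℂ[X]) ^ (m + 1)}))

noncomputable instance (m : ℕ) : Algebra ℂ (Rm m) :=
  inferInstanceAs (Algebra ℂ (ℂ[X] ⧸ Ideal.span {(Polynomial.X : ℂ[X]) ^ (m + 1)}))

/-- The quotient map `ℂ[u] → ℂ[u]/(u^(m+1))`. -/
noncomputable def Rm.mk (m : ℕ) : ℂ[X] →ₐ[ℂ] Rm m :=
  Ideal.Quotient.mkₐ ℂ (Ideal.span {(Polynomial.X : ℂ[X]) ^ (m + 1)})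

theorem Rm.mk_surjective (m : ℕ) : Function.Surjective (Rm.mk m) :=
  Ideal.Quotient.mkₐ_surjective ℂ (Ideal.span {(Polynomial.X : ℂ[X]) ^ (m + 1)})

/-- The generator `u`. -/
noncomputable def uu (m : ℕ) : Rm m := Rm.mk m Polynomial.X

theorem uu_pow (m : ℕ) : uu m ^ (m + 1) = 0 := by
  rw [uu, ← map_pow]
  exact Ideal.Quotient.eq_zero_iff_mem.2 (Ideal.mem_span_singleton_self _)

/-- The automorphism `f(u) ↦ f(-u)`. -/
noncomputable def negU (m : ℕ) : Rm m →ₐ[ℂ] Rm m :=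
  Ideal.Quotient.liftₐ (Ideal.span {(Polynomial.X : ℂ[X]) ^ (m + 1)})
    (Polynomial.aeval (-uu m)) fun f hf => by
      obtain ⟨g, rfl⟩ := Ideal.mem_span_singleton.1 hf
      rw [map_mul, map_pow, Polynomial.aeval_X, neg_pow, uu_pow, mul_zero, zero_mul]

theorem negU_mk (m : ℕ) (f : ℂ[X]) : negU m (Rm.mk m f) = Polynomial.aeval (-uu m) f := rfl

@[simp] theorem negU_uu (m : ℕ) : negU m (uu m) = -uu m := by
  rw [uu, negU_mk, Polynomial.aeval_X]; rfl

/-- The Lie algebra of the matrices with `A_{ij}(u) = -(-ε)^{i+j} A_{1-j,1-i}(-u)`. For `ε = 1`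
these are the equations `A_{ij}(u) = (-1)^{i+j+1} A_{1-j,1-i}(-u)` of type `C`, for `ε = -1` the
equations `A_{ij}(u) = -A_{1-j,1-i}(-u)` of type `D`. -/
noncomputable def gBar (ε : ℤˣ) (m : ℕ) : LieSubalgebra ℂ (GlInf (Rm m)) where
  carrier := {A | ∀ i j, entry A i j
    = -((sgn (-ε) (i + j) : Rm m) * negU m (entry A (1 - j) (1 - i)))}
  add_mem' := fun {A B} hA hB i j => by rw [entry_add, entry_add, hA i j, hB i j, map_add]; ring
  zero_mem' := fun i j => by simp
  smul_mem' := fun c A hA i j => by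
    rw [entry_smul, entry_smul, hA i j, map_smul, mul_smul_comm, smul_neg]
  lie_mem' := fun {A B} hA hB i j => by
    have key : ∀ A B : GlInf (Rm m),
        (∀ i j, entry A i j = -((sgn (-ε) (i + j) : Rm m) * negU m (entry A (1 - j) (1 - i)))) →
        (∀ i j, entry B i j = -((sgn (-ε) (i + j) : Rm m) * negU m (entry B (1 - j) (1 - i)))) →
        entry (A * B) i j
          = (sgn (-ε) (i + j) : Rm m) * negU m (entry (B * A) (1 - j) (1 - i)) := by
      intro A B hA hB
      have hfin : (Function.support fun k =>
          entry B (1 - j) k * entry A k (1 - i)).Finite :=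
        (finite_col A (1 - i)).subset fun k hk => right_ne_zero_of_mul hk
      have hL := ((LinearMap.mulLeft ℂ (sgn (-ε) (i + j) : Rm m)).comp
        (negU m).toLinearMap).toAddMonoidHom.map_finsum hfin
      rw [entry_mul, entry_mul]
      refine Eq.trans ?_ hL.symm
      rw [← finsum_comp_equiv (Equiv.subLeft (1 : ℤ))]
      refine finsum_congr fun k => ?_
      have hs : (sgn (-ε) (i + j) : Rm m)
          = sgn (-ε) (i + (1 - k)) * sgn (-ε) ((1 - k) + j) := by
        rw [← Int.cast_mul, ← sgn_add,
          show i + (1 - k) + ((1 - k) + j) = (i + j) + ((1 - k) + (1 - k)) by ring,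
          sgn_add _ (i + j), sgn_add _ (1 - k) (1 - k), sgn_mul_self, mul_one]
      change entry A i (1 - k) * entry B (1 - k) j
        = (sgn (-ε) (i + j) : Rm m) * negU m (entry B (1 - j) k * entry A k (1 - i))
      rw [hA i (1 - k), hB (1 - k) j, map_mul, hs, sub_sub_cancel]
      ring
    rw [Ring.lie_def, entry_sub, entry_sub, key A B hA hB, key B A hB hA, map_sub]
    ring

/-- The central extension of `gBar ε m` by the restriction of the cocycle `C(A, B)`: this is
`c_∞^[m]` for `ε = 1` and `d_∞^[m]` for `ε = -1`. -/
abbrev GHat (ε : ℤˣ) (m : ℕ) : Type := CentralExt ((trCocycle (Rm m)).restrict (gBar ε m))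

/-- The homogeneous components of `gBar ε m`; the matrix unit `E_{ij}` has degree `j - i`. -/
noncomputable def gBarGrade (ε : ℤˣ) (m : ℕ) (k : ℤ) : Submodule ℂ (gBar ε m) where
  carrier := {A | ∀ i j, j - i ≠ k → entry (A : GlInf (Rm m)) i j = 0}
  add_mem' := fun {a b} ha hb i j h => by simp [ha i j h, hb i j h]
  zero_mem' := fun i j _ => by simp
  smul_mem' := fun c a ha i j h => by simp [ha i j h]

/-- The principal gradation of `GHat ε m`. -/
noncomputable def GHatGrade (ε : ℤˣ) (m : ℕ) : ℤ → Submodule ℂ (GHat ε m) :=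
  CentralExt.grade ((trCocycle (Rm m)).restrict (gBar ε m)) (gBarGrade ε m)

/-! ### The homomorphism between the central extensions -/

/-- The element `1/2 + u`. -/
noncomputable def hu (m : ℕ) : Rm m := uu m + algebraMap ℂ (Rm m) (1 / 2)

theorem isUnit_w (m : ℕ) (k : ℤ) : IsUnit (uu m - algebraMap ℂ (Rm m) ((k : ℂ) + 1 / 2)) := by
  have h1 : IsNilpotent (uu m) := ⟨m + 1, uu_pow m⟩
  have h2 : IsUnit (algebraMap ℂ (Rm m) ((k : ℂ) + 1 / 2)) := by
    refine (IsUnit.mk0 _ fun h => ?_).map (algebraMap ℂ (Rm m))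
    have h3 : ((2 * k + 1 : ℤ) : ℂ) = 0 := by push_cast; linear_combination 2 * h
    have h4 : 2 * k + 1 = 0 := by exact_mod_cast h3
    omega
  rw [← IsUnit.neg_iff, neg_sub, sub_eq_add_neg]
  exact h1.neg.isUnit_add_left_of_commute h2 (Commute.all _ _)

/-- The unit `u - (k + 1/2)`. -/
noncomputable def ww (m : ℕ) (k : ℤ) : (Rm m)ˣ := (isUnit_w m k).unit

theorem ww_val (m : ℕ) (k : ℤ) :
    (ww m k : Rm m) = uu m - algebraMap ℂ (Rm m) ((k : ℂ) + 1 / 2) := rfl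

theorem ww_eq (m : ℕ) (k : ℤ) : (ww m k : Rm m) = hu m - ((k : Rm m) + 1) := by
  rw [ww_val, hu, map_add, map_intCast]
  have h : algebraMap ℂ (Rm m) (1 / 2) + algebraMap ℂ (Rm m) (1 / 2) = 1 := by
    rw [← map_add, ← map_one (algebraMap ℂ (Rm m))]; norm_num
  linear_combination -h

/-- The diagonal entries of a matrix `G` with `g_i / g_{i+1} = u - (i + 1/2)`. -/
noncomputable def gg (m : ℕ) (i : ℤ) : (Rm m)ˣ :=
  (∏ k ∈ Finset.Ico i 0, ww m k) * (∏ k ∈ Finset.Ico 0 i, ww m k)⁻¹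

theorem gg_succ (m : ℕ) (i : ℤ) : gg m i = ww m i * gg m (i + 1) := by
  rcases lt_or_ge i 0 with h | h
  · have h1 : Finset.Ico i 0 = insert i (Finset.Ico (i + 1) 0) := by
      ext; simp only [Finset.mem_Ico, Finset.mem_insert]; omega
    rw [gg, gg, Finset.Ico_eq_empty (a := 0) (b := i) (by omega),
      Finset.Ico_eq_empty (a := 0) (b := i + 1) (by omega), h1, Finset.prod_insert (by simp),
      mul_assoc]
  · have h1 : Finset.Ico 0 (i + 1) = insert i (Finset.Ico 0 i) := by
      ext; simp only [Finset.mem_Ico, Finset.mem_insert]; omega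
    rw [gg, gg, Finset.Ico_eq_empty (a := i) (b := 0) (by omega),
      Finset.Ico_eq_empty (a := i + 1) (b := 0) (by omega), h1, Finset.prod_insert (by simp)]
    simp

/-- The automorphism `T`: conjugation by `G`. -/
noncomputable def TT (m : ℕ) : GlInf (Rm m) →ₐ[ℂ] GlInf (Rm m) := conjDiag (gg m)

/-- The inverse of `T`. -/
noncomputable def TTinv (m : ℕ) : GlInf (Rm m) →ₐ[ℂ] GlInf (Rm m) :=
  conjDiag fun i => (gg m i)⁻¹

theorem TT_TTinv (m : ℕ) (A : GlInf (Rm m)) : TT m (TTinv m A) = A :=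
  glInf_ext fun i j => by simp [TT, TTinv, mul_assoc]

theorem TTinv_TT (m : ℕ) (A : GlInf (Rm m)) : TTinv m (TT m A) = A :=
  glInf_ext fun i j => by simp [TT, TTinv, mul_assoc]

theorem gg_mul_inv (m : ℕ) (i : ℤ) (n : ℕ) :
    gg m i * (gg m (i + n))⁻¹ = ∏ k ∈ Finset.Ico i (i + n), ww m k := by
  induction n with
  | zero => simp
  | succ n ih =>
    have h1 : Finset.Ico i (i + (n + 1 : ℕ)) = insert (i + n) (Finset.Ico i (i + n)) := by
      ext; simp only [Finset.mem_Ico, Finset.mem_insert]; push_cast; omega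
    rw [h1, Finset.prod_insert (by simp), ← ih, gg_succ m (i + n), mul_inv]
    push_cast
    rw [add_assoc, mul_left_comm (gg m i), mul_inv_cancel_left]

/-- For `i ≤ j`, `T` multiplies the `(i, j)` entry by `∏_{k=i}^{j-1} (u - (k + 1/2))`. -/
theorem entry_TT_of_le (m : ℕ) (A : GlInf (Rm m)) {i j : ℤ} (h : i ≤ j) :
    entry (TT m A) i j = (∏ k ∈ Finset.Ico i j, (ww m k : Rm m)) * entry A i j := by
  obtain ⟨n, rfl⟩ := Int.le.dest h
  have h1 := congrArg Units.val (gg_mul_inv m i n)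
  rw [Units.val_mul, Units.coe_prod] at h1
  rw [← h1, TT, entry_conjDiag]
  ring

/-- For `j ≤ i`, `T` divides the `(i, j)` entry by `∏_{k=j}^{i-1} (u - (k + 1/2))`. -/
theorem entry_TT_of_ge (m : ℕ) (A : GlInf (Rm m)) {i j : ℤ} (h : j ≤ i) :
    (∏ k ∈ Finset.Ico j i, (ww m k : Rm m)) * entry (TT m A) i j = entry A i j := by
  obtain ⟨n, rfl⟩ := Int.le.dest h
  have h1 := congrArg Units.val (gg_mul_inv m j n)
  rw [Units.val_mul, Units.coe_prod] at h1
  rw [← h1, TT, entry_conjDiag]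
  have e1 := (gg m j).mul_inv
  have e2 := (gg m (j + n)).mul_inv
  linear_combination (entry A (j + n) j * (gg m (j + n) : Rm m) * ((gg m (j + n))⁻¹ : (Rm m)ˣ)) * e1
    + entry A (j + n) j * e2

theorem negU_hu (m : ℕ) : negU m (hu m) = 1 - hu m := by
  rw [hu, map_add, negU_uu, AlgHom.commutes]
  have h : algebraMap ℂ (Rm m) (1 / 2) + algebraMap ℂ (Rm m) (1 / 2) = 1 := by
    rw [← map_add, ← map_one (algebraMap ℂ (Rm m))]; norm_num
  linear_combination h

theorem negU_aeval (m : ℕ) (x : Rm m) (f : ℂ[X]) :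
    negU m (Polynomial.aeval x f) = Polynomial.aeval (negU m x) f :=
  (Polynomial.aeval_algHom_apply (negU m) x f).symm

/-- An expression that does not depend on `i`. -/
theorem hh_succ (m : ℕ) (i : ℤ) :
    (sgn (-1) (i + 1) : Rm m) * gg m (i + 1) * (hu m - ((i + 1 : ℤ) : Rm m))
        * negU m (gg m (1 - (i + 1)))
      = (sgn (-1) i : Rm m) * gg m i * (hu m - (i : Rm m)) * negU m (gg m (1 - i)) := by
  have h1 : (gg m i : Rm m) = ww m i * gg m (i + 1) := by
    rw [gg_succ m i, Units.val_mul]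
  have h2 : (gg m (1 - (i + 1)) : Rm m) = ww m (-i) * gg m (1 - i) := by
    rw [show 1 - (i + 1) = -i by ring, gg_succ m (-i), Units.val_mul,
      show -i + 1 = 1 - i by ring]
  have h3 : (sgn (-1) (i + 1) : Rm m) = -sgn (-1) i := by
    rw [sgn_add]; simp [sgn]
  rw [h1, h2, h3, map_mul, ww_eq, ww_eq, map_sub, negU_hu]
  simp only [map_add, map_one, map_intCast]
  push_cast
  ring

theorem hh_const (m : ℕ) (i j : ℤ) :
    (sgn (-1) i : Rm m) * gg m i * (hu m - (i : Rm m)) * negU m (gg m (1 - i))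
      = (sgn (-1) j : Rm m) * gg m j * (hu m - (j : Rm m)) * negU m (gg m (1 - j)) := by
  have key : ∀ i : ℤ,
      (sgn (-1) i : Rm m) * gg m i * (hu m - (i : Rm m)) * negU m (gg m (1 - i))
      = (sgn (-1) 0 : Rm m) * gg m 0 * (hu m - ((0 : ℤ) : Rm m)) * negU m (gg m (1 - 0)) := by
    intro i
    induction i using Int.induction_on with
    | zero => rfl
    | succ i ih => rw [hh_succ, ih]
    | pred i ih =>
      rw [← ih, ← hh_succ m (-(i : ℤ) - 1)]
      simp only [sub_add_cancel]
  rw [key i, key j]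

theorem TTinv_phi_mem (ε : ℤˣ) (m : ℕ) {d : DiffOp} (hd : d ∈ DxPM ε) :
    TTinv m (phi (hu m) d) ∈ gBar ε m := by
  intro i j
  rw [TTinv, entry_conjDiag, entry_conjDiag, entry_phi, entry_phi,
    show 1 - i - (1 - j) = j - i by ring]
  obtain ⟨f, hf1, hf2⟩ := mem_DxPM hd (j - i)
  have e1 : Polynomial.aeval (hu m - (j : Rm m)) f
      = (sgn ε (j - i) : Rm m) * Polynomial.aeval (-(hu m - (i : Rm m))) f := by
    conv_lhs => rw [hf2]
    rw [map_smul, Polynomial.aeval_comp, Algebra.smul_def, map_intCast]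
    congr 2
    simp
  rw [hf1]
  simp only [map_mul, Polynomial.aeval_X, negU_aeval, map_sub, negU_hu, map_intCast, e1, inv_inv]
  have e2 : (1 - hu m - ((1 - i : ℤ) : Rm m)) = -(hu m - (i : Rm m)) := by push_cast; ring
  rw [e2]
  have hs : (sgn (-ε) (i + j) : Rm m) = sgn (-1) i * sgn (-1) j * sgn ε (j - i) := by
    rw [← Int.cast_mul, ← Int.cast_mul, ← sgn_add, show j - i = (i + j) + (-i + -i) by ring,
      sgn_add ε, sgn_add ε (-i), sgn_mul_self, mul_one]
    congr 1
    rw [sgn, sgn, sgn, ← Units.val_mul, ← mul_zpow, neg_one_mul]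
  rw [hs]
  have hc := hh_const m i j
  have u1 := (gg m i).mul_inv
  have u2 : negU m (gg m (1 - j)) * negU m ((gg m (1 - j))⁻¹ : (Rm m)ˣ) = 1 := by
    rw [← map_mul, Units.mul_inv, map_one]
  have u3 : (sgn (-1) j : Rm m) * (sgn (-1) j : Rm m) = 1 := by
    rw [← Int.cast_mul, sgn_mul_self, Int.cast_one]
  set F := Polynomial.aeval (-(hu m - (i : Rm m))) f
  set S := (sgn ε (j - i) : Rm m)
  set gi' := (((gg m i)⁻¹ : (Rm m)ˣ) : Rm m)
  set P' := negU m ((gg m (1 - j))⁻¹ : (Rm m)ˣ)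
  linear_combination S * F * (-gi' * P' * (sgn (-1) j : Rm m) * hc
    + (sgn (-1) i : Rm m) * (sgn (-1) j : Rm m) * P' * (hu m - (i : Rm m))
      * negU m (gg m (1 - i)) * u1
    - gi' * (hu m - (j : Rm m)) * gg m j
      * (negU m (gg m (1 - j)) * P' * u3 + u2))


section Conj

variable {R : Type*} [CommRing R] [Algebra ℂ R]

theorem trCocycle_conjDiag (g : ℤ → Rˣ) (A B : GlInf R) :
    (trCocycle R).toFun (conjDiag g A) (conjDiag g B) = (trCocycle R).toFun A B := by
  have h : ⁅matJ R, conjDiag g A⁆ * conjDiag g B = conjDiag g (⁅matJ R, A⁆ * B) := by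
    rw [map_mul]
    congr 1
    refine glInf_ext fun i j => ?_
    rw [entry_matJ_lie, entry_conjDiag, entry_conjDiag, entry_matJ_lie]
    ring
  rw [trCocycle_apply, trCocycle_apply, h, tr, tr]
  refine finsum_congr fun i => ?_
  rw [entry_conjDiag, mul_right_comm, Units.mul_inv, one_mul]

end Conj

/-- The homomorphism of central extensions lifting `T⁻¹ ∘ φ`, where
`φ(t^k f(D)) = ∑ j, f(1/2 + u - j) E_{j-k, j}`: it sends the central element `C` to `1`, it is
`T⁻¹ ∘ φ` in nonzero degrees, and in degree zero the central term `alpha` is added. -/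
noncomputable def phiHat (ε : ℤˣ) (m : ℕ) : DHat ε →ₗ⁅ℂ⁆ GHat ε m where
  toFun x := CentralExt.mk _
    ⟨TTinv m (phi (hu m) (x.fst : DiffOp)), TTinv_phi_mem ε m x.fst.2⟩
    (algebraMap ℂ (Rm m) x.snd + alpha (hu m) (DiffOp.coeff 0 (x.fst : DiffOp)))
  map_add' x y := by
    refine CentralExt.ext (Subtype.ext ?_) ?_
    · simp
    · change algebraMap ℂ (Rm m) (x.snd + y.snd)
          + alpha (hu m) (DiffOp.coeff 0 ((x.fst : DiffOp) + (y.fst : DiffOp)))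
        = (algebraMap ℂ (Rm m) x.snd + alpha (hu m) (DiffOp.coeff 0 (x.fst : DiffOp)))
          + (algebraMap ℂ (Rm m) y.snd + alpha (hu m) (DiffOp.coeff 0 (y.fst : DiffOp)))
      rw [map_add, map_add, map_add]
      ring
  map_smul' c x := by
    refine CentralExt.ext (Subtype.ext ?_) ?_
    · simp
    · change algebraMap ℂ (Rm m) (c * x.snd)
          + alpha (hu m) (DiffOp.coeff 0 (c • (x.fst : DiffOp)))
        = c • (algebraMap ℂ (Rm m) x.snd + alpha (hu m) (DiffOp.coeff 0 (x.fst : DiffOp)))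
      rw [map_mul, map_smul, map_smul, smul_add, Algebra.smul_def c (algebraMap ℂ (Rm m) x.snd)]
  map_lie' := fun {x y} => by
    refine CentralExt.ext (Subtype.ext ?_) ?_
    · change TTinv m (phi (hu m) ⁅(x.fst : DiffOp), (y.fst : DiffOp)⁆)
        = ⁅TTinv m (phi (hu m) (x.fst : DiffOp)), TTinv m (phi (hu m) (y.fst : DiffOp))⁆
      rw [phi_lie, Ring.lie_def, Ring.lie_def, map_sub, map_mul, map_mul]
    · change algebraMap ℂ (Rm m) (psiL 0 (x.fst : DiffOp) (y.fst : DiffOp))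
          + alpha (hu m) (DiffOp.coeff 0 ⁅(x.fst : DiffOp), (y.fst : DiffOp)⁆)
        = (trCocycle (Rm m)).toFun (TTinv m (phi (hu m) (x.fst : DiffOp)))
            (TTinv m (phi (hu m) (y.fst : DiffOp)))
      rw [TTinv, trCocycle_conjDiag, trCocycle_phi, alpha_coeff_lie]
      ring

/-! ### Exponential series -/

section Series

variable {R : Type*} [CommRing R] [Algebra ℂ R]

/-- The power series `e^(a x)`. -/
noncomputable def expPS (a : R) : PowerSeries R :=
  PowerSeries.mk fun n => ((n.factorial : ℂ)⁻¹) • a ^ n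

/-- The power series `cosh (a x)`. -/
noncomputable def coshPS (a : R) : PowerSeries R :=
  (2⁻¹ : ℂ) • (expPS a + expPS (-a))

/-- The power series `sinh (a x)`. -/
noncomputable def sinhPS (a : R) : PowerSeries R :=
  (2⁻¹ : ℂ) • (expPS a - expPS (-a))

theorem expPS_mul (a b : R) : expPS a * expPS b = expPS (a + b) := by
  let _ : Algebra ℚ R := Algebra.compHom R (algebraMap ℚ ℂ)
  have h : ∀ a : R, expPS a = PowerSeries.rescale a (PowerSeries.exp R) := by
    intro a
    ext n
    rw [expPS, PowerSeries.coeff_mk, PowerSeries.coeff_rescale, PowerSeries.coeff_exp,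
      Algebra.smul_def, mul_comm]
    congr 1
    change _ = algebraMap ℂ R (algebraMap ℚ ℂ (1 / n.factorial))
    simp
  rw [h, h, h, PowerSeries.exp_mul_exp_eq_exp_add]

theorem expPS_zero : expPS (0 : R) = 1 := by
  ext n
  rw [expPS, PowerSeries.coeff_mk, PowerSeries.coeff_one]
  split_ifs with h
  · simp [h]
  · simp [h]

theorem rescale_expPS (a : R) : PowerSeries.rescale (-1) (expPS a) = expPS (-a) := by
  ext n
  rw [PowerSeries.coeff_rescale, expPS, expPS, PowerSeries.coeff_mk, PowerSeries.coeff_mk,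
    mul_smul_comm, neg_pow a]

theorem alpha_exp (a : R) :
    (PowerSeries.mk fun n => ((n.factorial : ℂ)⁻¹) • alpha a (Polynomial.X ^ n))
      * (expPS 1 - 1) = 1 - expPS a := by
  let _ : Algebra ℚ R := Algebra.compHom R (algebraMap ℚ ℂ)
  have hq : ∀ q : ℚ, algebraMap ℚ R q = algebraMap ℂ R (q : ℂ) := fun q => rfl
  have h : ∀ a : R, expPS a = PowerSeries.rescale a (PowerSeries.exp R) := by
    intro a
    ext n
    rw [expPS, PowerSeries.coeff_mk, PowerSeries.coeff_rescale, PowerSeries.coeff_exp,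
      Algebra.smul_def, mul_comm]
    congr 1
    rw [hq]
    simp
  have g := fun t : R => Polynomial.bernoulli_generating_function t
  set G : R → PowerSeries R := fun t => PowerSeries.mk fun n =>
    Polynomial.aeval t ((1 / n.factorial : ℚ) • Polynomial.bernoulli n) with hG
  have hae : ∀ (t : R) (P : ℚ[X]),
      Polynomial.aeval t (P.map (algebraMap ℚ ℂ)) = Polynomial.aeval t P := by
    intro t P
    rw [Polynomial.aeval_def, Polynomial.eval₂_map, Polynomial.aeval_def]
    rfl
  have hA : PowerSeries.X *
      (PowerSeries.mk fun n => ((n.factorial : ℂ)⁻¹) • alpha a (Polynomial.X ^ n))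
      = G 0 - G a := by
    ext n
    rcases n with _ | n
    · simp [hG]
    · rw [PowerSeries.coeff_succ_X_mul, PowerSeries.coeff_mk, map_sub, PowerSeries.coeff_mk,
        PowerSeries.coeff_mk, alpha_apply, antidiff_X_pow, map_smul, map_smul, hae, hae,
        map_smul, map_smul, ← smul_sub, ← smul_sub, smul_smul, Algebra.smul_def, Algebra.smul_def,
        hq]
      congr 2
      rw [Nat.factorial_succ]
      push_cast
      rw [one_div, mul_inv, mul_comm]
  have key : PowerSeries.X * ((PowerSeries.mk fun n =>
      ((n.factorial : ℂ)⁻¹) • alpha a (Polynomial.X ^ n)) * (expPS 1 - 1))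
      = PowerSeries.X * (1 - expPS a) := by
    rw [← mul_assoc, hA, h 1, PowerSeries.rescale_one, RingHom.id_apply, sub_mul, g, g, ← mul_sub,
      ← h, ← h, expPS_zero]
  ext n
  have := congrArg (PowerSeries.coeff (n + 1)) key
  rwa [PowerSeries.coeff_succ_X_mul, PowerSeries.coeff_succ_X_mul] at this

end Series

/-- The central term of `phiHat (sinh (x D))` is
`(cosh (x/2) - cosh (u x)) / (2 sinh (x/2))`, where `cosh (u x) = ∑_{i even} x^i u^i / i!`. -/
theorem alpha_sinh (m : ℕ) :
    (PowerSeries.mk fun n => if Odd n then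
        ((n.factorial : ℂ)⁻¹) • alpha (hu m) (Polynomial.X ^ n) else 0)
      * ((2 : ℂ) • sinhPS (algebraMap ℂ (Rm m) (1 / 2)))
      = coshPS (algebraMap ℂ (Rm m) (1 / 2)) - coshPS (uu m) := by
  set A : PowerSeries (Rm m) :=
    PowerSeries.mk fun n => ((n.factorial : ℂ)⁻¹) • alpha (hu m) (Polynomial.X ^ n) with hA
  set b := algebraMap ℂ (Rm m) (1 / 2) with hb
  have hbb : b + b = 1 := by
    rw [hb, ← map_add, ← map_one (algebraMap ℂ (Rm m))]; norm_num
  have h1 : A * (expPS b - expPS (-b)) = expPS (-b) - expPS (uu m) := by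
    have h := congrArg (· * expPS (-b)) (alpha_exp (hu m))
    simp only [sub_mul, mul_assoc, one_mul, expPS_mul] at h
    rw [show (1 : Rm m) + -b = b by rw [← hbb]; ring, show hu m + -b = uu m by rw [hu]; ring] at h
    exact h
  have h2 : PowerSeries.rescale (-1) A * (expPS (-b) - expPS b) = expPS b - expPS (-uu m) := by
    have h := congrArg (PowerSeries.rescale (-1)) h1
    simpa only [map_mul, map_sub, rescale_expPS, neg_neg] using h
  have h3 : (PowerSeries.mk fun n => if Odd n then
        ((n.factorial : ℂ)⁻¹) • alpha (hu m) (Polynomial.X ^ n) else 0)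
      = (2⁻¹ : ℂ) • (A - PowerSeries.rescale (-1) A) := by
    ext n
    rw [PowerSeries.coeff_mk, PowerSeries.coeff_smul, map_sub, PowerSeries.coeff_rescale, hA,
      PowerSeries.coeff_mk]
    split_ifs with hn
    · rw [hn.neg_one_pow, neg_one_mul, sub_neg_eq_add, ← two_smul ℂ, smul_smul]
      norm_num
    · rw [(Nat.not_odd_iff_even.1 hn).neg_one_pow, one_mul, sub_self, smul_zero]
  rw [h3, sinhPS, smul_smul, mul_inv_cancel₀ two_ne_zero, one_smul, coshPS, coshPS, ← smul_sub,
    smul_mul_assoc]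
  congr 1
  linear_combination h1 + h2

/-! ### Labels -/

section Labels

/-- The matrix with entry `a` at the place `(i, j)` and `0` elsewhere. -/
noncomputable def matE {R : Type*} [CommRing R] [Algebra ℂ R] (i j : ℤ) (a : R) : GlInf R :=
  shiftDiag (j - i) (Pi.single j a)

theorem entry_matE {R : Type*} [CommRing R] [Algebra ℂ R] (i j : ℤ) (a : R) (p q : ℤ) :
    entry (matE i j a) p q = if p = i ∧ q = j then a else 0 := by
  rw [matE, entry_shiftDiag]
  by_cases hq : q = j
  · subst hq
    by_cases hp : p = i
    · subst hp; simp
    · rw [if_neg (by omega), if_neg (by simp [hp])]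
  · simp [hq]

theorem cartan_mem (ε : ℤˣ) (m : ℕ) (i : ℤ) (j : ℕ) :
    matE i i (uu m ^ j) - matE (1 - i) (1 - i) ((-uu m) ^ j) ∈ gBar ε m := by
  intro p q
  simp only [entry_sub, entry_matE, map_sub]
  by_cases hpq : p = q
  · subst hpq
    rw [sgn_add, sgn_mul_self]
    by_cases h1 : p = i
    · subst h1
      have h2 : p ≠ 1 - p := by omega
      have h3 : 1 - p ≠ p := by omega
      simp [h2, h3]
    · by_cases h2 : p = 1 - i
      · subst h2
        have h3 : 1 - i ≠ i := by omega
        have h4 : ¬ (i = 1 - i) := by omega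
        simp [h3, h4]
      · have h3 : ¬ (1 - p = i) := by omega
        simp [h1, h2, h3]
  · have h1 : ¬ (p = i ∧ q = i) := by omega
    have h2 : ¬ (p = 1 - i ∧ q = 1 - i) := by omega
    have h3 : ¬ (1 - q = i ∧ 1 - p = i) := by omega
    have h4 : ¬ (1 - q = 1 - i ∧ 1 - p = 1 - i) := by omega
    rw [if_neg h1, if_neg h2, if_neg h3, if_neg h4]
    simp

/-- The element `u^j E_{ii} - (-u)^j E_{1-i,1-i}` of degree zero. -/
noncomputable def cartan (ε : ℤˣ) (m : ℕ) (i : ℤ) (j : ℕ) : GHatGrade ε m 0 :=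
  ⟨CentralExt.mk _ ⟨matE i i (uu m ^ j) - matE (1 - i) (1 - i) ((-uu m) ^ j),
      cartan_mem ε m i j⟩ 0,
    fun p q h => by
      have h1 : ¬ (p = i ∧ q = i) := by omega
      have h2 : ¬ (p = 1 - i ∧ q = 1 - i) := by omega
      simp only [CentralExt.fst_mk, entry_sub, entry_matE]
      rw [if_neg h1, if_neg h2, sub_zero],
    fun h => absurd rfl h⟩

/-- The central element `z` of `GHat ε m`, as an element of degree zero. -/
noncomputable def central (ε : ℤˣ) (m : ℕ) (z : Rm m) : GHatGrade ε m 0 :=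
  ⟨CentralExt.mk _ 0 z, (gBarGrade ε m 0).zero_mem, fun h => absurd rfl h⟩

variable {ε : ℤˣ} {m : ℕ} (lam : Module.Dual ℂ (GHatGrade ε m 0))

/-- The labels `λ_i^{(j)} = λ(u^j E_{ii} - (-u)^j E_{1-i,1-i})`. -/
noncomputable def lamLabel (i : ℤ) (j : ℕ) : ℂ := lam (cartan ε m i j)

/-- The central charges `c_j = λ(u^j)`. -/
noncomputable def cLabel (j : ℕ) : ℂ := lam (central ε m (uu m ^ j))

/-- The numbers `h_k^{(i)} = λ_k^{(i)} - λ_{k+1}^{(i)}` for `k > 0`; moreover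
`h_0^{(i)} = c_i - λ_1^{(i)}` for `i` even and `h_0^{(i)} = 0` for `i` odd. -/
noncomputable def hLabel (k i : ℕ) : ℂ :=
  if k = 0 then (if Even i then cLabel lam i - lamLabel lam 1 i else 0)
  else lamLabel lam k i - lamLabel lam (k + 1) i

/-- The polynomial `∑_{0 ≤ i ≤ m, i even} h_k^{(i)} x^i / i!`. -/
noncomputable def evenMult (k : ℕ) : ℂ[X] :=
  ∑ i ∈ (Finset.range (m + 1)).filter Even,
    Polynomial.monomial i (hLabel lam k i / (i.factorial : ℂ))

/-- The polynomial `∑_{0 ≤ i ≤ m, i odd} h_k^{(i)} x^i / i!`. -/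
noncomputable def oddMult (k : ℕ) : ℂ[X] :=
  ∑ i ∈ (Finset.range (m + 1)).filter Odd,
    Polynomial.monomial i (hLabel lam k i / (i.factorial : ℂ))

/-- The exponents `k`, `k ≥ 0`, with their multiplicities `evenMult lam k`, when nonzero. -/
def ePlus : Set (ℂ × ℂ[X]) :=
  {p | ∃ k : ℕ, p = ((k : ℂ), evenMult lam k) ∧ evenMult lam k ≠ 0}

/-- The exponents `-k`, `k ≥ 0`, with their multiplicities `oddMult lam k`, when nonzero. -/
def eMinus : Set (ℂ × ℂ[X]) :=
  {p | ∃ k : ℕ, p = (-(k : ℂ), oddMult lam k) ∧ oddMult lam k ≠ 0}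

end Labels

/-! ### Highest weight modules -/

section Modules

variable {L V : Type*} [LieRing L] [LieAlgebra ℂ L] [AddCommGroup V] [Module ℂ V]
  [LieRingModule L V] [LieModule ℂ L V]

/-- `V = ⨁ V_j` is a graded module over the graded Lie algebra `L = ⨁ 𝒢_k`, generated by a highest
weight vector of weight `lam` in `V_0`, and has no graded submodules besides `0` and `V`. -/
structure IsIrreducibleHighestWeight (𝒢 : ℤ → Submodule ℂ L) (lam : Module.Dual ℂ (𝒢 0))
    (𝒱 : ℤ → Submodule ℂ V) : Prop where
  internal : DirectSum.IsInternal 𝒱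
  lie_mem : ∀ i j : ℤ, ∀ x ∈ 𝒢 i, ∀ w ∈ 𝒱 j, ⁅x, w⁆ ∈ 𝒱 (i + j)
  exists_vector : ∃ v ∈ 𝒱 0, v ≠ 0 ∧ (∀ h : 𝒢 0, ⁅(h : L), v⁆ = lam h • v) ∧
    (∀ k : ℤ, 0 < k → ∀ x ∈ 𝒢 k, ⁅x, v⁆ = 0) ∧ LieSubmodule.lieSpan ℂ L {v} = ⊤
  irreducible : ∀ N : LieSubmodule ℂ L V,
    N.toSubmodule = ⨆ j, N.toSubmodule ⊓ 𝒱 j → N = ⊥ ∨ N = ⊤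

/-- All the homogeneous components are finite-dimensional. -/
def IsQuasifinite (𝒱 : ℤ → Submodule ℂ V) : Prop := ∀ j, Module.Finite ℂ (𝒱 j)

end Modules

/-- The space `V` regarded as a module over `L` via a homomorphism `f : L → L'`. -/
def Pullback {L L' : Type*} [LieRing L] [LieAlgebra ℂ L] [LieRing L'] [LieAlgebra ℂ L']
    (_f : L →ₗ⁅ℂ⁆ L') (V : Type*) : Type _ := V

namespace Pullback

variable {L L' V : Type*} [LieRing L] [LieAlgebra ℂ L] [LieRing L'] [LieAlgebra ℂ L']
  (f : L →ₗ⁅ℂ⁆ L') [AddCommGroup V] [Module ℂ V] [LieRingModule L' V] [LieModule ℂ L' V]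

instance : AddCommGroup (Pullback f V) := inferInstanceAs (AddCommGroup V)
instance : Module ℂ (Pullback f V) := inferInstanceAs (Module ℂ V)
instance : LieRingModule L (Pullback f V) := LieRingModule.compLieHom V f
instance : LieModule ℂ L (Pullback f V) := LieModule.compLieHom V f

/-- The gradation of `V`, on the same space regarded as a module over `L`. -/
def grading (𝒱 : ℤ → Submodule ℂ V) : ℤ → Submodule ℂ (Pullback f V) := 𝒱

end Pullback

/-! ### Exponents -/

section Exponents

/-- A quasipolynomial: a linear combination of the series `q(x) e^(a x)`, with `q` a polynomial. -/
def IsQuasipolynomial (φ : PowerSeries ℂ) : Prop :=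
  φ ∈ Submodule.span ℂ {ψ : PowerSeries ℂ | ∃ (q : ℂ[X]) (a : ℂ), ψ = (q : PowerSeries ℂ) * expPS a}

/-- The operator `D^l D`, `l` even, as an element of degree zero of `DHat ε`. -/
noncomputable def opDpow (ε : ℤˣ) (l : ℕ) (hl : Even l) : DHatGrade ε 0 :=
  ⟨CentralExt.mk _ ⟨DiffOp.mono 0 (Polynomial.X ^ l * Polynomial.X),
      mono_mem_DxPM_zero ε l hl⟩ 0,
    fun k hk => by
      simp only [CentralExt.fst_mk, DiffOp.coeff_mono]
      rw [if_neg hk.symm],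
    fun h => absurd rfl h⟩

/-- The central element `C` of `DHat ε`. -/
noncomputable def opC (ε : ℤˣ) : DHatGrade ε 0 :=
  ⟨CentralExt.mk _ 0 1, (DxPMgrade ε 0).zero_mem, fun h => absurd rfl h⟩

variable {ε : ℤˣ}

/-- The generating series `Δ(x) = ∑_{l even} x^l Δ_l / l!` of the labels `Δ_l = -Λ(D^l D)`. -/
noncomputable def deltaSeries (Lam : Module.Dual ℂ (DHatGrade ε 0)) : PowerSeries ℂ :=
  PowerSeries.mk fun l =>
    if hl : Even l then -(Lam (opDpow ε l hl)) / (l.factorial : ℂ) else 0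

/-- A finite set of exponents with nonzero multiplicities, the exponents being distinct up to
sign. -/
def IsExponentSet (e : Set (ℂ × ℂ[X])) : Prop :=
  e.Finite ∧ (∀ p ∈ e, p.2 ≠ 0) ∧
    ∀ p ∈ e, ∀ q ∈ e, (p.1 = q.1 ∨ p.1 = -q.1) → p = q

/-- `Δ(x) = d/dx (φ(x) / (2 sinh (x/2)))` with an even quasipolynomial `φ` such that `φ(0) = 0`, and
`φ(x) + c₀ cosh (x/2) = ∑ q_i(x) cosh (e_i^+ x) + ∑ r_j(x) sinh (e_j^- x)`, where `c₀` is the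
central charge, `ep` is the set of the `(e_i^+, q_i)`, `em` is the set of the `(e_j^-, r_j)`,
the `q_i` are even and the `r_j` are odd. -/
def HasExponents (Lam : Module.Dual ℂ (DHatGrade ε 0)) (ep em : Set (ℂ × ℂ[X])) : Prop :=
  IsExponentSet ep ∧ IsExponentSet em ∧
  (∀ p ∈ ep, p.2.comp (-Polynomial.X) = p.2) ∧
  (∀ p ∈ em, p.2.comp (-Polynomial.X) = -p.2 ∧ p.1 ≠ 0) ∧
  ∃ φ Γ : PowerSeries ℂ,
    IsQuasipolynomial φ ∧ PowerSeries.rescale (-1 : ℂ) φ = φ ∧ PowerSeries.constantCoeff φ = 0 ∧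
    Γ * ((2 : ℂ) • sinhPS (1 / 2 : ℂ)) = φ ∧
    deltaSeries Lam = PowerSeries.derivative ℂ Γ ∧
    φ + Lam (opC ε) • coshPS (1 / 2 : ℂ)
      = (∑ᶠ p ∈ ep, (p.2 : PowerSeries ℂ) * coshPS p.1)
        + ∑ᶠ p ∈ em, (p.2 : PowerSeries ℂ) * sinhPS p.1

/-- The graded `DHat ε`-module `V` is the irreducible quasifinite highest weight module with the
set `ep` of exponents of even type and the set `em` of exponents of odd type (with
multiplicities). -/
def IsL (ε : ℤˣ) {V : Type*} [AddCommGroup V] [Module ℂ V] [LieRingModule (DHat ε) V]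
    [LieModule ℂ (DHat ε) V] (𝒱 : ℤ → Submodule ℂ V) (ep em : Set (ℂ × ℂ[X])) : Prop :=
  ∃ Lam : Module.Dual ℂ (DHatGrade ε 0),
    IsIrreducibleHighestWeight (DHatGrade ε) Lam 𝒱 ∧ IsQuasifinite 𝒱 ∧ HasExponents Lam ep em

end Exponents

end Circle

open Circle

/-!
The restriction of an irreducible quasifinite highest weight module `V` from `GHat ε m` to
`DHat ε` along `phiHat` is governed by a density statement and by a computation with the series
`Γ` of the restricted weight.

**Irreducibility.** `phiHat` is far from surjective, but its image acts on `V` like all of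
`GHat ε m` in nonzero degrees. In degree `k ≠ 0`, bracketing with the image of `D³` multiplies the
entry at `(i - k, i)` by `(y + k)³ - y³` with `y = 1/2 + u - i`. A polynomial in this operator acts
by `0` from one finite-dimensional component to another (`exists_aeval_ad_lie_eq_zero`), and far
from the origin it multiplies the entries by units, so matrices of degree `k` supported far from
the origin act by `0` on a given component (`exists_forall_lie_eq_zero_of_far`). The remaining
finitely many entries can be prescribed by an operator `t^k f(D)`, because the points `1/2 - i` are
distinct and Hermite interpolation prescribes `f` modulo `(z - 1/2 + i)^(m+1)` at each of them; a
symmetrization puts the operator into `𝒟_x^±` (`exists_phiHat_lie_eq`). Submodules over `DHat ε` are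
graded because `D` acts on each component by a scalar that changes with the degree. A vector of
top degree in such a submodule is killed by the image of the positive part, hence by
the positive part of `GHat ε m`, hence is a multiple of the highest weight vector, which generates
everything (`pullback_isIrreducible`).

**Exponents.** The same functional vanishes on diagonal matrices supported far from the origin
(`exists_forall_weight_eq_zero_of_far`), so the restricted weight is a finite sum over `k ≥ 1` of
values on `r E_{kk} - r(-u) E_{1-k,1-k}`, plus a central term. Multiplying by
`2 sinh (x/2)` turns `sinh ((1/2 + u - k) x)` into `cosh ((u - k + 1) x) - cosh ((u - k) x)`, and
summation by parts produces the labels `h_k`; expanding `cosh ((u - k) x)` separates the exponents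
of even and odd type (`hasExponents_pullbackWeight`).

**Uniqueness.** The exponents determine the highest weight (`HasExponents.weight_eq`), and two
irreducible highest weight modules of the same weight are isomorphic: the submodule of the product
generated by the pair of highest weight vectors is the graph of an isomorphism
(`nonempty_equiv_of_highestWeight`).
-/

namespace Circle

/-! ### Modules over graded Lie algebras -/

section Graded

variable {L V : Type*} [LieRing L] [LieAlgebra ℂ L] [AddCommGroup V] [Module ℂ V]
  [LieRingModule L V] [LieModule ℂ L V]

/-- The subspaces `𝒢 k` span the Lie algebra `L` and `[𝒢 i, 𝒢 j] ⊆ 𝒢 (i + j)`. Independence of the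
`𝒢 k` is not required. -/
structure IsLieGrading (𝒢 : ℤ → Submodule ℂ L) : Prop where
  iSup_eq_top : ⨆ k, 𝒢 k = ⊤
  lie_mem : ∀ i j : ℤ, ∀ x ∈ 𝒢 i, ∀ y ∈ 𝒢 j, ⁅x, y⁆ ∈ 𝒢 (i + j)

variable {𝒢 : ℤ → Submodule ℂ L}

omit [LieModule ℂ L V] in
theorem IsLieGrading.lie_mem_of_forall (h𝒢 : IsLieGrading 𝒢) (P : Submodule ℂ V) {w : V}
    (h : ∀ k, ∀ x ∈ 𝒢 k, ⁅x, w⁆ ∈ P) (x : L) : ⁅x, w⁆ ∈ P := by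
  have hx : x ∈ ⨆ k, 𝒢 k := h𝒢.iSup_eq_top ▸ Submodule.mem_top
  induction hx using Submodule.iSup_induction' with
  | mem k x hx => exact h k x hx
  | zero => simp
  | add x y _ _ hx hy => rw [add_lie]; exact P.add_mem hx hy

/-- The submodule generated by a space `S` of highest weight vectors is obtained from `S` by
applying elements of negative degree only. -/
theorem lieSpan_le_of_neg_stable (h𝒢 : IsLieGrading 𝒢) {S P : Submodule ℂ V}
    (hzero : ∀ x ∈ 𝒢 0, ∀ w ∈ S, ⁅x, w⁆ ∈ S)
    (hpos : ∀ k : ℤ, 0 < k → ∀ x ∈ 𝒢 k, ∀ w ∈ S, ⁅x, w⁆ = 0) (hSP : S ≤ P)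
    (hneg : ∀ k : ℤ, k < 0 → ∀ x ∈ 𝒢 k, ∀ w ∈ P, ⁅x, w⁆ ∈ P) :
    (LieSubmodule.lieSpan ℂ L (S : Set V)).toSubmodule ≤ P := by
  set 𝒮 : Set (Submodule ℂ V) :=
    {P | S ≤ P ∧ ∀ k : ℤ, k < 0 → ∀ x ∈ 𝒢 k, ∀ w ∈ P, ⁅x, w⁆ ∈ P} with h𝒮
  set Q := sInf 𝒮 with hQ
  have hSQ : S ≤ Q := le_sInf fun P hP => hP.1
  have hQneg : ∀ k : ℤ, k < 0 → ∀ x ∈ 𝒢 k, ∀ w ∈ Q, ⁅x, w⁆ ∈ Q := by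
    intro k hk x hx w hw
    rw [hQ, Submodule.mem_sInf] at hw ⊢
    exact fun P hP => hP.2 k hk x hx w (hw P hP)
  -- The vectors of `Q` that elements of nonnegative degree keep in `Q`; this space has the two
  -- properties that define `Q`.
  let Q' : Submodule ℂ V :=
    { carrier := {w | w ∈ Q ∧ ∀ k : ℤ, 0 ≤ k → ∀ x ∈ 𝒢 k, ⁅x, w⁆ ∈ Q}
      add_mem' := fun {a b} ha hb => ⟨Q.add_mem ha.1 hb.1, fun k hk x hx => by
        rw [lie_add]; exact Q.add_mem (ha.2 k hk x hx) (hb.2 k hk x hx)⟩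
      zero_mem' := ⟨Q.zero_mem, fun k hk x hx => by simp⟩
      smul_mem' := fun c a ha => ⟨Q.smul_mem c ha.1, fun k hk x hx => by
        rw [lie_smul]; exact Q.smul_mem c (ha.2 k hk x hx)⟩ }
  have hQ' : Q' ∈ 𝒮 := by
    refine ⟨fun w hw => ⟨hSQ hw, fun k hk x hx => ?_⟩, fun l hl y hy w hw =>
      ⟨hQneg l hl y hy w hw.1, fun k hk x hx => ?_⟩⟩
    · rcases hk.eq_or_lt with rfl | hk
      · exact hSQ (hzero x hx w hw)
      · rw [hpos k hk x hx w hw]; exact Q.zero_mem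
    · rw [leibniz_lie]
      refine Q.add_mem ?_ (hQneg l hl y hy _ (hw.2 k hk x hx))
      have hxy := h𝒢.lie_mem k l x hx y hy
      rcases lt_or_ge (k + l) 0 with h | h
      · exact hQneg _ h _ hxy w hw.1
      · exact hw.2 _ h _ hxy
  let M : LieSubmodule ℂ L V :=
    { Q with
      lie_mem := fun {x w} hw => h𝒢.lie_mem_of_forall Q (fun k x hx => by
        rcases lt_or_ge k 0 with h | h
        · exact hQneg k h x hx w hw
        · exact (sInf_le hQ' hw).2 k h x hx) x }
  have h1 : LieSubmodule.lieSpan ℂ L (S : Set V) ≤ M := LieSubmodule.lieSpan_le.2 hSQ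
  exact fun w hw => (sInf_le (show P ∈ 𝒮 from ⟨hSP, hneg⟩) : Q ≤ P) (h1 hw)

omit [LieModule ℂ L V] in
/-- A submodule generated by homogeneous vectors is graded. -/
theorem lieSpan_graded (h𝒢 : IsLieGrading 𝒢) {𝒱 : ℤ → Submodule ℂ V}
    (hlie : ∀ i j : ℤ, ∀ x ∈ 𝒢 i, ∀ w ∈ 𝒱 j, ⁅x, w⁆ ∈ 𝒱 (i + j)) {S : Set V}
    {n : ℤ} (hS : S ⊆ 𝒱 n) :
    (LieSubmodule.lieSpan ℂ L S).toSubmodule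
      = ⨆ j, (LieSubmodule.lieSpan ℂ L S).toSubmodule ⊓ 𝒱 j := by
  set N := LieSubmodule.lieSpan ℂ L S
  refine le_antisymm ?_ (iSup_le fun j => inf_le_left)
  let M : LieSubmodule ℂ L V :=
    { (⨆ j, N.toSubmodule ⊓ 𝒱 j) with
      lie_mem := fun {x w} hw => by
        refine h𝒢.lie_mem_of_forall _ (fun k x hx => ?_) x
        change w ∈ ⨆ j, N.toSubmodule ⊓ 𝒱 j at hw
        induction hw using Submodule.iSup_induction' with
        | mem j w hw =>
          exact Submodule.mem_iSup_of_mem (k + j) ⟨N.lie_mem hw.1, hlie k j x hx w hw.2⟩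
        | zero => simp
        | add a b _ _ ha hb => rw [lie_add]; exact Submodule.add_mem _ ha hb }
  have : N ≤ M := LieSubmodule.lieSpan_le.2 fun w hw =>
    Submodule.mem_iSup_of_mem n ⟨LieSubmodule.subset_lieSpan hw, hS hw⟩
  exact this

theorem eq_of_le_of_iSup_eq_top {A B : ℤ → Submodule ℂ V} (hB : iSupIndep B)
    (hle : ∀ j, A j ≤ B j) (hA : ⨆ j, A j = ⊤) : A = B := by
  funext j
  refine le_antisymm (hle j) fun w hw => ?_
  have hw' : w ∈ A j ⊔ ⨆ i ≠ j, A i := by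
    have h : ⨆ i, A i ≤ A j ⊔ ⨆ i ≠ j, A i := iSup_le fun i => by
      by_cases h : i = j
      · subst h; exact le_sup_left
      · exact le_sup_of_le_right (le_iSup₂ (f := fun i (_ : i ≠ j) => A i) i h)
    exact h (hA ▸ Submodule.mem_top)
  obtain ⟨a, ha, b, hb, rfl⟩ := Submodule.mem_sup.1 hw'
  have hb0 : b = 0 := by
    refine (Submodule.disjoint_def.1 (hB j)) b ?_ ((iSup₂_mono fun i _ => hle i) hb)
    simpa using (B j).sub_mem hw (hle j ha)
  simpa [hb0] using ha

/-- A subspace stable under an operator that acts on the `𝒱 j` with distinct eigenvalues is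
graded. -/
theorem eq_iSup_inf_of_eigen {𝒱 : ℤ → Submodule ℂ V} (htop : ⨆ j, 𝒱 j = ⊤) (T : V →ₗ[ℂ] V)
    (c : ℂ) (hT : ∀ j, ∀ w ∈ 𝒱 j, T w = (c + j) • w) (N : Submodule ℂ V)
    (hN : ∀ w ∈ N, T w ∈ N) : N = ⨆ j, N ⊓ 𝒱 j := by
  refine le_antisymm (fun w hw => ?_) (iSup_le fun j => inf_le_left)
  have key : ∀ (s : Finset ℤ) (f : ℤ → V), (∀ j, f j ∈ 𝒱 j) → ∑ j ∈ s, f j ∈ N →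
      ∀ j ∈ s, f j ∈ N := by
    intro s
    induction s using Finset.induction_on with
    | empty => simp
    | insert a s ha ih =>
      intro f hf hsum
      have h1 : ∑ j ∈ s, ((j : ℂ) - a) • f j ∈ N := by
        have h2 := N.sub_mem (hN _ hsum) (N.smul_mem (c + a) hsum)
        rw [map_sum, Finset.smul_sum, ← Finset.sum_sub_distrib, Finset.sum_insert ha] at h2
        simp only [hT _ _ (hf _), sub_self, zero_add, ← sub_smul, add_sub_add_left_eq_sub] at h2
        exact h2
      have h3 : ∀ j ∈ s, f j ∈ N := fun j hj => by
        have h4 := ih (fun j => ((j : ℂ) - a) • f j) (fun j => (𝒱 j).smul_mem _ (hf j)) h1 j hj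
        refine (N.smul_mem_iff (sub_ne_zero.2 fun h => ha ?_)).1 h4
        rwa [← Int.cast_injective h]
      intro j hj
      rcases Finset.mem_insert.1 hj with rfl | hj
      · rw [Finset.sum_insert ha] at hsum
        simpa using N.sub_mem hsum (N.sum_mem h3)
      · exact h3 j hj
  obtain ⟨f, hf, rfl⟩ := (Submodule.mem_iSup_iff_exists_finsupp _ _).1
    (show w ∈ ⨆ j, 𝒱 j from htop ▸ Submodule.mem_top)
  refine Submodule.sum_mem _ fun j hj => Submodule.mem_iSup_of_mem j ⟨?_, hf j⟩
  exact key f.support f hf hw j hj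

omit [LieModule ℂ L V] in
/-- The sum of the components of degree at most `n` is stable under the elements of negative
degree. -/
theorem lie_mem_biSup_Iic {𝒱 : ℤ → Submodule ℂ V}
    (hlie : ∀ i j : ℤ, ∀ x ∈ 𝒢 i, ∀ w ∈ 𝒱 j, ⁅x, w⁆ ∈ 𝒱 (i + j)) {k n : ℤ} (hk : k < 0) {x : L}
    (hx : x ∈ 𝒢 k) {w : V} (hw : w ∈ ⨆ i ∈ Set.Iic n, 𝒱 i) : ⁅x, w⁆ ∈ ⨆ i ∈ Set.Iic n, 𝒱 i := by
  induction hw using Submodule.iSup_induction' with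
  | zero => simp
  | add a b _ _ ha hb => rw [lie_add]; exact Submodule.add_mem _ ha hb
  | mem i w hw =>
    by_cases hi : i ∈ Set.Iic n
    · rw [iSup_pos hi] at hw
      refine Submodule.mem_iSup_of_mem (k + i) (Submodule.mem_iSup_of_mem ?_ (hlie k i x hx w hw))
      simp only [Set.mem_Iic] at *
      omega
    · rw [iSup_neg hi, Submodule.mem_bot] at hw
      simp [hw]

namespace IsIrreducibleHighestWeight

variable {lam : Module.Dual ℂ (𝒢 0)} {𝒱 : ℤ → Submodule ℂ V}

/-- A subspace that contains the highest weight vector and is stable under the elements of negative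
degree is the whole space. -/
theorem eq_top_of_neg_stable (h𝒢 : IsLieGrading 𝒢) {v : V}
    (hv : ∀ h : 𝒢 0, ⁅(h : L), v⁆ = lam h • v)
    (hpos : ∀ k : ℤ, 0 < k → ∀ x ∈ 𝒢 k, ⁅x, v⁆ = 0)
    (hspan : LieSubmodule.lieSpan ℂ L {v} = ⊤) {P : Submodule ℂ V} (hvP : v ∈ P)
    (hneg : ∀ k : ℤ, k < 0 → ∀ x ∈ 𝒢 k, ∀ w ∈ P, ⁅x, w⁆ ∈ P) : P = ⊤ := by
  have h := lieSpan_le_of_neg_stable h𝒢 (S := Submodule.span ℂ {v}) (P := P) ?_ ?_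
    (by simpa using hvP) hneg
  · rw [eq_top_iff]
    refine le_trans ?_ h
    intro w _
    have : w ∈ LieSubmodule.lieSpan ℂ L {v} := hspan ▸ LieSubmodule.mem_top w
    exact LieSubmodule.lieSpan_mono (by simp) this
  · intro x hx w hw
    obtain ⟨c, rfl⟩ := Submodule.mem_span_singleton.1 hw
    rw [lie_smul, hv ⟨x, hx⟩]
    exact Submodule.smul_mem _ _ (Submodule.smul_mem _ _ (Submodule.mem_span_singleton_self v))
  · intro k hk x hx w hw
    obtain ⟨c, rfl⟩ := Submodule.mem_span_singleton.1 hw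
    rw [lie_smul, hpos k hk x hx, smul_zero]

/-- The module has no component of positive degree. -/
theorem eq_bot_of_pos (h𝒢 : IsLieGrading 𝒢) (hV : IsIrreducibleHighestWeight 𝒢 lam 𝒱) {j : ℤ}
    (hj : 0 < j) : 𝒱 j = ⊥ := by
  obtain ⟨v, hv0, -, hv, hpos, hspan⟩ := hV.exists_vector
  have htop : ⨆ i ∈ Set.Iic (0 : ℤ), 𝒱 i = ⊤ := by
    refine eq_top_of_neg_stable h𝒢 hv hpos hspan
      (Submodule.mem_iSup_of_mem 0 (Submodule.mem_iSup_of_mem (Set.mem_Iic.2 le_rfl) hv0))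
      fun k hk x hx w hw => lie_mem_biSup_Iic hV.lie_mem hk hx hw
  have hd := hV.internal.submodule_iSupIndep.disjoint_biSup
    (x := j) (y := Set.Iic (0 : ℤ)) (by simpa using hj)
  rwa [htop, disjoint_top] at hd

/-- The component of degree zero is spanned by the highest weight vector. -/
theorem mem_span_of_mem_zero (h𝒢 : IsLieGrading 𝒢) (hV : IsIrreducibleHighestWeight 𝒢 lam 𝒱)
    {v : V} (hv0 : v ∈ 𝒱 0) (hv : ∀ h : 𝒢 0, ⁅(h : L), v⁆ = lam h • v)
    (hpos : ∀ k : ℤ, 0 < k → ∀ x ∈ 𝒢 k, ⁅x, v⁆ = 0)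
    (hspan : LieSubmodule.lieSpan ℂ L {v} = ⊤) {w : V} (hw : w ∈ 𝒱 0) : ∃ c : ℂ, w = c • v := by
  have htop : Submodule.span ℂ {v} ⊔ ⨆ i ∈ Set.Iic (-1 : ℤ), 𝒱 i = ⊤ := by
    refine eq_top_of_neg_stable h𝒢 hv hpos hspan
      (Submodule.mem_sup_left (Submodule.mem_span_singleton_self v)) ?_
    intro k hk x hx w hw
    obtain ⟨a, ha, b, hb, rfl⟩ := Submodule.mem_sup.1 hw
    refine Submodule.mem_sup_right ?_
    rw [lie_add]
    refine Submodule.add_mem _ ?_ ?_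
    · obtain ⟨c, rfl⟩ := Submodule.mem_span_singleton.1 ha
      rw [lie_smul]
      refine Submodule.smul_mem _ _ (Submodule.mem_iSup_of_mem (k + 0)
        (Submodule.mem_iSup_of_mem ?_ (hV.lie_mem k 0 x hx v hv0)))
      simp only [Set.mem_Iic]
      omega
    · exact lie_mem_biSup_Iic hV.lie_mem hk hx hb
  obtain ⟨a, ha, b, hb, rfl⟩ := Submodule.mem_sup.1
    (show w ∈ Submodule.span ℂ {v} ⊔ ⨆ i ∈ Set.Iic (-1 : ℤ), 𝒱 i from htop ▸ Submodule.mem_top)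
  obtain ⟨c, rfl⟩ := Submodule.mem_span_singleton.1 ha
  have hb0 : b = 0 := by
    refine Submodule.disjoint_def.1 (hV.internal.submodule_iSupIndep.disjoint_biSup
      (x := 0) (y := Set.Iic (-1 : ℤ)) (by simp)) b ?_ hb
    simpa using (𝒱 0).sub_mem hw ((𝒱 0).smul_mem c hv0)
  exact ⟨c, by rw [hb0, add_zero]⟩

/-- There are no singular vectors of negative degree: such a vector generates a graded submodule
that does not contain the highest weight vector. -/
theorem eq_zero_of_singular (h𝒢 : IsLieGrading 𝒢) (hV : IsIrreducibleHighestWeight 𝒢 lam 𝒱)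
    {n : ℤ} (hn : n < 0) {w : V} (hw : w ∈ 𝒱 n)
    (hsing : ∀ k : ℤ, 0 < k → ∀ x ∈ 𝒢 k, ⁅x, w⁆ = 0) : w = 0 := by
  let S : Submodule ℂ V :=
    { carrier := {w | w ∈ 𝒱 n ∧ ∀ k : ℤ, 0 < k → ∀ x ∈ 𝒢 k, ⁅x, w⁆ = 0}
      add_mem' := fun {a b} ha hb => ⟨(𝒱 n).add_mem ha.1 hb.1, fun k hk x hx => by
        rw [lie_add, ha.2 k hk x hx, hb.2 k hk x hx, add_zero]⟩
      zero_mem' := ⟨(𝒱 n).zero_mem, fun k hk x hx => by simp⟩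
      smul_mem' := fun c a ha => ⟨(𝒱 n).smul_mem c ha.1, fun k hk x hx => by
        rw [lie_smul, ha.2 k hk x hx, smul_zero]⟩ }
  obtain ⟨v, hv0, hvne, -⟩ := hV.exists_vector
  have hle : (LieSubmodule.lieSpan ℂ L (S : Set V)).toSubmodule ≤ ⨆ i ∈ Set.Iic n, 𝒱 i := by
    refine lieSpan_le_of_neg_stable h𝒢 ?_ ?_ ?_ ?_
    · intro x hx w hw
      refine ⟨by simpa using hV.lie_mem 0 n x hx w hw.1, fun k hk y hy => ?_⟩
      have h1 : ⁅⁅y, x⁆, w⁆ = 0 :=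
        hw.2 k hk _ (by simpa using h𝒢.lie_mem k 0 y hy x hx)
      rw [leibniz_lie, h1, hw.2 k hk y hy, lie_zero, add_zero]
    · exact fun k hk x hx w hw => hw.2 k hk x hx
    · exact fun w hw => Submodule.mem_iSup_of_mem n
        (Submodule.mem_iSup_of_mem (Set.mem_Iic.2 le_rfl) hw.1)
    · exact fun k hk x hx w hw => lie_mem_biSup_Iic hV.lie_mem hk hx hw
  rcases hV.irreducible _ (lieSpan_graded h𝒢 hV.lie_mem (S := (S : Set V)) fun w hw => hw.1)
    with h | h
  · have : w ∈ LieSubmodule.lieSpan ℂ L (S : Set V) :=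
      LieSubmodule.subset_lieSpan (show w ∈ S from ⟨hw, hsing⟩)
    rwa [h, LieSubmodule.mem_bot] at this
  · refine absurd (Submodule.disjoint_def.1 (hV.internal.submodule_iSupIndep.disjoint_biSup
      (x := 0) (y := Set.Iic n) (by simpa using hn)) v hv0 (hle ?_)) hvne
    rw [h]
    exact LieSubmodule.mem_top v

/-- An element `δ` of degree zero with `[δ, x] = k x` for `x` of degree `k` acts on the component of
degree `j` by `lam δ + j`. -/
theorem lie_degree (h𝒢 : IsLieGrading 𝒢) (hV : IsIrreducibleHighestWeight 𝒢 lam 𝒱) (δ : 𝒢 0)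
    (hδ : ∀ k, ∀ x ∈ 𝒢 k, ⁅(δ : L), x⁆ = (k : ℂ) • x) (j : ℤ) {w : V} (hw : w ∈ 𝒱 j) :
    ⁅(δ : L), w⁆ = (lam δ + j) • w := by
  obtain ⟨v, hv0, -, hv, hpos, hspan⟩ := hV.exists_vector
  let A : ℤ → Submodule ℂ V := fun j => 𝒱 j ⊓
    LinearMap.ker (LieModule.toEnd ℂ L V δ - (lam δ + j) • LinearMap.id)
  have hmem : ∀ j w, w ∈ A j ↔ w ∈ 𝒱 j ∧ ⁅(δ : L), w⁆ = (lam δ + j) • w := fun j w => by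
    simp [A, sub_eq_zero]
  have htop : ⨆ j, A j = ⊤ := by
    refine eq_top_of_neg_stable h𝒢 hv hpos hspan
      (Submodule.mem_iSup_of_mem 0 ((hmem _ _).2 ⟨hv0, by simp [hv]⟩)) ?_
    intro k _ x hx w hw
    induction hw using Submodule.iSup_induction' with
    | zero => simp
    | add a b _ _ ha hb => rw [lie_add]; exact Submodule.add_mem _ ha hb
    | mem i w hw =>
      rw [hmem] at hw
      refine Submodule.mem_iSup_of_mem (k + i) ((hmem _ _).2 ⟨hV.lie_mem k i x hx w hw.1, ?_⟩)
      rw [leibniz_lie, hδ k x hx, hw.2, smul_lie, lie_smul, ← add_smul]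
      congr 1
      push_cast
      ring
  have hA := eq_of_le_of_iSup_eq_top hV.internal.submodule_iSupIndep (A := A)
    (fun j => inf_le_left) htop
  exact ((hmem j w).1 (hA ▸ hw)).2

/-- In the presence of an element `δ` of degree zero with `[δ, x] = k x` for `x` of degree `k`, all
submodules are graded. -/
theorem eq_iSup_inf (h𝒢 : IsLieGrading 𝒢) (hV : IsIrreducibleHighestWeight 𝒢 lam 𝒱) (δ : 𝒢 0)
    (hδ : ∀ k, ∀ x ∈ 𝒢 k, ⁅(δ : L), x⁆ = (k : ℂ) • x) (N : LieSubmodule ℂ L V) :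
    N.toSubmodule = ⨆ j, N.toSubmodule ⊓ 𝒱 j :=
  eq_iSup_inf_of_eigen hV.internal.submodule_iSup_eq_top (LieModule.toEnd ℂ L V δ) (lam δ)
    (fun j _ hw => lie_degree h𝒢 hV δ hδ j hw) _ fun _ hw => N.lie_mem hw

end IsIrreducibleHighestWeight

/-! ### Uniqueness of the irreducible highest weight module -/

section Uniqueness

variable {W : Type*} [AddCommGroup W] [Module ℂ W] [LieRingModule L W] [LieModule ℂ L W]

/-- The diagonal action of a Lie algebra on the product of two modules. -/
instance prodLieRingModule : LieRingModule L (V × W) where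
  bracket x p := (⁅x, p.1⁆, ⁅x, p.2⁆)
  add_lie x y p := Prod.ext (add_lie x y p.1) (add_lie x y p.2)
  lie_add x p q := Prod.ext (lie_add x p.1 q.1) (lie_add x p.2 q.2)
  leibniz_lie x y p := Prod.ext (leibniz_lie x y p.1) (leibniz_lie x y p.2)

omit [LieAlgebra ℂ L] [Module ℂ V] [LieModule ℂ L V] [Module ℂ W] [LieModule ℂ L W] in
theorem lie_prod (x : L) (p : V × W) : ⁅x, p⁆ = (⁅x, p.1⁆, ⁅x, p.2⁆) := rfl

instance prodLieModule : LieModule ℂ L (V × W) where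
  smul_lie c x p := Prod.ext (smul_lie c x p.1) (smul_lie c x p.2)
  lie_smul c x p := Prod.ext (lie_smul c x p.1) (lie_smul c x p.2)

/-- Two irreducible highest weight modules with the same highest weight are isomorphic: the
submodule of `V × W` generated by the pair of the highest weight vectors is the graph of an
isomorphism. -/
theorem nonempty_equiv_of_highestWeight (h𝒢 : IsLieGrading 𝒢) {lam : Module.Dual ℂ (𝒢 0)}
    {𝒱 : ℤ → Submodule ℂ V} {𝒲 : ℤ → Submodule ℂ W} (δ : 𝒢 0)
    (hδ : ∀ k, ∀ x ∈ 𝒢 k, ⁅(δ : L), x⁆ = (k : ℂ) • x)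
    (hV : IsIrreducibleHighestWeight 𝒢 lam 𝒱) (hW : IsIrreducibleHighestWeight 𝒢 lam 𝒲) :
    Nonempty (V ≃ₗ⁅ℂ, L⁆ W) := by
  obtain ⟨v, hv0, hvne, hv, hvpos, hvspan⟩ := hV.exists_vector
  obtain ⟨w, hw0, hwne, hw, hwpos, hwspan⟩ := hW.exists_vector
  set M := LieSubmodule.lieSpan ℂ L {(v, w)} with hM
  let p1 : (V × W) →ₗ⁅ℂ, L⁆ V := { LinearMap.fst ℂ V W with map_lie' := fun {x m} => rfl }
  let p2 : (V × W) →ₗ⁅ℂ, L⁆ W := { LinearMap.snd ℂ V W with map_lie' := fun {x m} => rfl }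
  have hmem : (v, w) ∈ M := LieSubmodule.subset_lieSpan rfl
  -- the component of degree zero of `M` is spanned by `(v, w)`
  have hzero : ∀ p ∈ M, p.1 ∈ 𝒱 0 → p.2 ∈ 𝒲 0 → ∃ c : ℂ, p = c • (v, w) := by
    intro p hp hp1 hp2
    set P : Submodule ℂ (V × W) := Submodule.span ℂ {(v, w)} ⊔
      (⨆ i ∈ Set.Iic (-1 : ℤ), 𝒱 i).prod (⨆ i ∈ Set.Iic (-1 : ℤ), 𝒲 i) with hP
    have hle : (LieSubmodule.lieSpan ℂ L
        ((Submodule.span ℂ {(v, w)} : Submodule ℂ (V × W)) : Set (V × W))).toSubmodule ≤ P := by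
      refine lieSpan_le_of_neg_stable h𝒢 ?_ ?_ le_sup_left ?_
      · intro x hx p hp
        obtain ⟨c, rfl⟩ := Submodule.mem_span_singleton.1 hp
        rw [lie_smul, lie_prod, hv ⟨x, hx⟩, hw ⟨x, hx⟩, ← Prod.smul_mk]
        exact Submodule.smul_mem _ _
          (Submodule.smul_mem _ _ (Submodule.mem_span_singleton_self _))
      · intro k hk x hx p hp
        obtain ⟨c, rfl⟩ := Submodule.mem_span_singleton.1 hp
        rw [lie_smul, lie_prod, hvpos k hk x hx, hwpos k hk x hx, Prod.mk_zero_zero, smul_zero]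
      · intro k hk x hx p hp
        obtain ⟨a, ha, b, hb, rfl⟩ := Submodule.mem_sup.1 hp
        refine Submodule.mem_sup_right ?_
        rw [lie_add]
        refine Submodule.add_mem _ ?_ ⟨lie_mem_biSup_Iic hV.lie_mem hk hx hb.1,
          lie_mem_biSup_Iic hW.lie_mem hk hx hb.2⟩
        obtain ⟨c, rfl⟩ := Submodule.mem_span_singleton.1 ha
        rw [lie_smul]
        have hk' : k + 0 ∈ Set.Iic (-1 : ℤ) := by simp only [Set.mem_Iic]; omega
        exact Submodule.smul_mem _ _
          ⟨Submodule.mem_iSup_of_mem (k + 0) (Submodule.mem_iSup_of_mem hk'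
            (hV.lie_mem k 0 x hx v hv0)),
          Submodule.mem_iSup_of_mem (k + 0) (Submodule.mem_iSup_of_mem hk'
            (hW.lie_mem k 0 x hx w hw0))⟩
    have hpP : p ∈ P := hle (LieSubmodule.lieSpan_mono (by simp) hp)
    obtain ⟨a, ha, b, hb, rfl⟩ := Submodule.mem_sup.1 hpP
    obtain ⟨c, rfl⟩ := Submodule.mem_span_singleton.1 ha
    have hb1 : b.1 = 0 := by
      refine Submodule.disjoint_def.1 (hV.internal.submodule_iSupIndep.disjoint_biSup
        (x := 0) (y := Set.Iic (-1 : ℤ)) (by simp)) _ ?_ hb.1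
      simpa using (𝒱 0).sub_mem hp1 ((𝒱 0).smul_mem c hv0)
    have hb2 : b.2 = 0 := by
      refine Submodule.disjoint_def.1 (hW.internal.submodule_iSupIndep.disjoint_biSup
        (x := 0) (y := Set.Iic (-1 : ℤ)) (by simp)) _ ?_ hb.2
      simpa using (𝒲 0).sub_mem hp2 ((𝒲 0).smul_mem c hw0)
    exact ⟨c, by rw [show b = 0 from Prod.ext hb1 hb2, add_zero]⟩
  have hsurj1 : ∀ a : V, ∃ p ∈ M, p.1 = a := by
    intro a
    have h1 : LieSubmodule.lieSpan ℂ L {v} ≤ M.map p1 :=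
      LieSubmodule.lieSpan_le.2 (Set.singleton_subset_iff.2 ⟨(v, w), hmem, rfl⟩)
    obtain ⟨p, hp, rfl⟩ := (LieSubmodule.mem_map _).1
      (h1 (hvspan ▸ LieSubmodule.mem_top a))
    exact ⟨p, hp, rfl⟩
  have hsurj2 : ∀ b : W, ∃ p ∈ M, p.2 = b := by
    intro b
    have h1 : LieSubmodule.lieSpan ℂ L {w} ≤ M.map p2 :=
      LieSubmodule.lieSpan_le.2 (Set.singleton_subset_iff.2 ⟨(v, w), hmem, rfl⟩)
    obtain ⟨p, hp, rfl⟩ := (LieSubmodule.mem_map _).1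
      (h1 (hwspan ▸ LieSubmodule.mem_top b))
    exact ⟨p, hp, rfl⟩
  let i1 : V →ₗ⁅ℂ, L⁆ V × W := { LinearMap.inl ℂ V W with
    map_lie' := fun {x m} => Prod.ext rfl (lie_zero x).symm }
  let i2 : W →ₗ⁅ℂ, L⁆ V × W := { LinearMap.inr ℂ V W with
    map_lie' := fun {x m} => Prod.ext (lie_zero x).symm rfl }
  -- the kernels of the projections of `M` are proper graded submodules of `W` and of `V`
  have hinj1 : ∀ b : W, ((0 : V), b) ∈ M → b = 0 := by
    intro b hb
    have hb' : b ∈ M.comap i2 := hb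
    rcases hW.irreducible (M.comap i2)
      (IsIrreducibleHighestWeight.eq_iSup_inf h𝒢 hW δ hδ _) with h | h
    · rwa [h, LieSubmodule.mem_bot] at hb'
    · have h1 : w ∈ M.comap i2 := by rw [h]; exact LieSubmodule.mem_top w
      obtain ⟨c, hc⟩ := hzero (0, w) h1 (𝒱 0).zero_mem hw0
      simp only [Prod.smul_mk, Prod.mk.injEq] at hc
      have hc0 : c = 0 := (smul_eq_zero.1 hc.1.symm).resolve_right hvne
      exact absurd (by rw [hc.2, hc0, zero_smul]) hwne
  have hinj2 : ∀ a : V, (a, (0 : W)) ∈ M → a = 0 := by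
    intro a ha
    have ha' : a ∈ M.comap i1 := ha
    rcases hV.irreducible (M.comap i1)
      (IsIrreducibleHighestWeight.eq_iSup_inf h𝒢 hV δ hδ _) with h | h
    · rwa [h, LieSubmodule.mem_bot] at ha'
    · have h1 : v ∈ M.comap i1 := by rw [h]; exact LieSubmodule.mem_top v
      obtain ⟨c, hc⟩ := hzero (v, 0) h1 hv0 (𝒲 0).zero_mem
      simp only [Prod.smul_mk, Prod.mk.injEq] at hc
      have hc0 : c = 0 := (smul_eq_zero.1 hc.2.symm).resolve_right hwne
      exact absurd (by rw [hc.1, hc0, zero_smul]) hvne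
  let q1 : M →ₗ⁅ℂ, L⁆ V := p1.comp M.incl
  let q2 : M →ₗ⁅ℂ, L⁆ W := p2.comp M.incl
  have hq1 : Function.Bijective q1 := by
    refine ⟨(injective_iff_map_eq_zero q1).2 fun p hp => ?_, fun a => ?_⟩
    · obtain ⟨⟨a, b⟩, hab⟩ := p
      obtain rfl : a = 0 := hp
      simp [hinj1 b hab]
    · obtain ⟨p, hp, rfl⟩ := hsurj1 a
      exact ⟨⟨p, hp⟩, rfl⟩
  have hq2 : Function.Bijective q2 := by
    refine ⟨(injective_iff_map_eq_zero q2).2 fun p hp => ?_, fun b => ?_⟩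
    · obtain ⟨⟨a, b⟩, hab⟩ := p
      obtain rfl : b = 0 := hp
      simp [hinj2 a hab]
    · obtain ⟨p, hp, rfl⟩ := hsurj2 b
      exact ⟨⟨p, hp⟩, rfl⟩
  let e1 : M ≃ₗ⁅ℂ, L⁆ V :=
    { q1, Equiv.ofBijective q1 hq1 with }
  let e2 : M ≃ₗ⁅ℂ, L⁆ W :=
    { q2, Equiv.ofBijective q2 hq2 with }
  exact ⟨e1.symm.trans e2⟩

end Uniqueness

/-! ### Finite-dimensional components -/

/-- For `h` of degree zero, some nonzero polynomial in `ad h` sends every element of degree `k` to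
one that acts trivially on the component `𝒱 j`. Indeed `ad h` becomes an operator on the
finite-dimensional space `Hom (𝒱 j, 𝒱 (k + j))`. -/
theorem exists_aeval_ad_lie_eq_zero {𝒱 : ℤ → Submodule ℂ V}
    (hlie : ∀ i j : ℤ, ∀ x ∈ 𝒢 i, ∀ w ∈ 𝒱 j, ⁅x, w⁆ ∈ 𝒱 (i + j))
    (hfin : IsQuasifinite 𝒱) {h : L} (hh : h ∈ 𝒢 0) (k j : ℤ) :
    ∃ p : ℂ[X], p ≠ 0 ∧ ∀ x ∈ 𝒢 k, ∀ w ∈ 𝒱 j,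
      ⁅Polynomial.aeval (LieAlgebra.ad ℂ L h) p x, w⁆ = 0 := by
  have := hfin j
  have := hfin (k + j)
  have h0 : ∀ i, ∀ w ∈ 𝒱 i, LieModule.toEnd ℂ L V h w ∈ 𝒱 i := fun i w hw => by
    simpa using hlie 0 i h hh w hw
  let H1 : Module.End ℂ (𝒱 j) := (LieModule.toEnd ℂ L V h).restrict (h0 j)
  let H2 : Module.End ℂ (𝒱 (k + j)) := (LieModule.toEnd ℂ L V h).restrict (h0 (k + j))
  let Ψ : Module.End ℂ (𝒱 j →ₗ[ℂ] 𝒱 (k + j)) :=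
    { toFun := fun f => H2 ∘ₗ f - f ∘ₗ H1
      map_add' := fun f g => by ext; simp; abel
      map_smul' := fun c f => by ext; simp [smul_sub] }
  have hΨ : ∀ (p : ℂ[X]) (x : L) (f : 𝒱 j →ₗ[ℂ] 𝒱 (k + j)), (∀ w, (f w : V) = ⁅x, (w : V)⁆) →
      ∀ w, (Polynomial.aeval Ψ p f w : V)
        = ⁅Polynomial.aeval (LieAlgebra.ad ℂ L h) p x, (w : V)⁆ := by
    intro p
    induction p using Polynomial.induction_on' with
    | add p q hp hq =>
      intro x f hf w
      simp only [map_add, LinearMap.add_apply, Submodule.coe_add, hp x f hf, hq x f hf, add_lie]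
    | monomial n c =>
      intro x f hf
      have key : ∀ n : ℕ, ∀ w, ((Ψ ^ n) f w : V) = ⁅((LieAlgebra.ad ℂ L h) ^ n) x, (w : V)⁆ := by
        intro n
        induction n with
        | zero => simpa using hf
        | succ n ih =>
          intro w
          have e : ∀ g, (Ψ g w : V) = ⁅h, (g w : V)⁆ - (g (H1 w) : V) := fun g => rfl
          have e1 : (H1 w : V) = ⁅h, (w : V)⁆ := rfl
          rw [pow_succ', pow_succ', Module.End.mul_apply, Module.End.mul_apply, e, ih, ih, e1,
            LieAlgebra.ad_apply, lie_lie]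
      intro w
      rw [Polynomial.aeval_monomial, Polynomial.aeval_monomial, Module.End.mul_apply,
        Module.End.mul_apply, Module.algebraMap_end_apply, Module.algebraMap_end_apply,
        LinearMap.smul_apply, Submodule.coe_smul, key, smul_lie]
  have h1 : IsIntegral ℂ Ψ := Algebra.IsIntegral.isIntegral Ψ
  have h2 : Polynomial.aeval Ψ (minpoly ℂ Ψ) = 0 := minpoly.aeval ℂ Ψ
  refine ⟨minpoly ℂ Ψ, minpoly.ne_zero h1, fun x hx w hw => ?_⟩
  have h3 := hΨ (minpoly ℂ Ψ) x ((LieModule.toEnd ℂ L V x).restrict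
    (fun w hw => hlie k j x hx w hw)) (fun w => rfl) ⟨w, hw⟩
  rw [h2, LinearMap.zero_apply] at h3
  exact h3.symm

end Graded

/-! ### The principal gradations -/

section Gradations

theorem CentralExt.mk_zero_add {L Z : Type*} [LieRing L] [LieAlgebra ℂ L] [AddCommGroup Z]
    [Module ℂ Z] {ω : Cocycle L Z} (x y : L) :
    CentralExt.mk ω (x + y) 0 = CentralExt.mk ω x 0 + CentralExt.mk ω y 0 :=
  CentralExt.ext rfl (add_zero (0 : Z)).symm

/-- A gradation of a Lie algebra extends to a central extension when the cocycle has degree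
zero. -/
theorem IsLieGrading.centralExt {L Z : Type*} [LieRing L] [LieAlgebra ℂ L] [AddCommGroup Z]
    [Module ℂ Z] (ω : Cocycle L Z) {𝒢 : ℤ → Submodule ℂ L} (h : IsLieGrading 𝒢)
    (hω : ∀ i j : ℤ, i + j ≠ 0 → ∀ x ∈ 𝒢 i, ∀ y ∈ 𝒢 j, ω.toFun x y = 0) :
    IsLieGrading (CentralExt.grade ω 𝒢) where
  iSup_eq_top := by
    rw [eq_top_iff]
    intro a _
    have h1 : ∀ x : L, CentralExt.mk ω x 0 ∈ ⨆ k, CentralExt.grade ω 𝒢 k := by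
      intro x
      have hx : x ∈ ⨆ k, 𝒢 k := h.iSup_eq_top ▸ Submodule.mem_top
      induction hx using Submodule.iSup_induction' with
      | mem k x hx => exact Submodule.mem_iSup_of_mem k ⟨hx, fun _ => rfl⟩
      | zero => exact Submodule.zero_mem _
      | add x y _ _ hx hy => rw [CentralExt.mk_zero_add]; exact Submodule.add_mem _ hx hy
    have h2 : CentralExt.mk ω 0 a.snd ∈ ⨆ k, CentralExt.grade ω 𝒢 k :=
      Submodule.mem_iSup_of_mem 0 ⟨(𝒢 0).zero_mem, fun h => absurd rfl h⟩
    have h3 : a = CentralExt.mk ω a.fst 0 + CentralExt.mk ω 0 a.snd :=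
      CentralExt.ext (add_zero a.fst).symm (zero_add a.snd).symm
    rw [h3]
    exact Submodule.add_mem _ (h1 _) h2
  lie_mem i j x hx y hy :=
    ⟨h.lie_mem i j _ hx.1 _ hy.1, fun hij => hω i j hij _ hx.1 _ hy.1⟩

variable {ε : ℤˣ} {m : ℕ}

theorem eq_mono_of_mem_DxPMgrade {k : ℤ} {x : DxPM ε} (hx : x ∈ DxPMgrade ε k) :
    (x : DiffOp) = DiffOp.mono k (DiffOp.coeff k (x : DiffOp)) :=
  DiffOp.ext_coeff fun l => by
    rw [DiffOp.coeff_mono]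
    split_ifs with h
    · rw [h]
    · exact hx l (Ne.symm h)

theorem mono_mem_DxPM {k : ℤ} {f : ℂ[X]}
    (hf : f = (sgn ε k : ℂ) • f.comp (-Polynomial.X - Polynomial.C (k : ℂ))) :
    DiffOp.mono k (f * Polynomial.X) ∈ DxPM ε := by
  refine ⟨DiffOp.mono k f, (mono_mul_opD k f).symm, ?_⟩
  rw [sigma₀_mono, smul_mul_assoc, mono_mul_opD, mono_mul_opD, ← map_smul, ← map_neg,
    neg_smul, ← smul_mul_assoc, ← hf]

theorem mono_coeff_mem_DxPM {d : DiffOp} (hd : d ∈ DxPM ε) (k : ℤ) :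
    DiffOp.mono k (DiffOp.coeff k d) ∈ DxPM ε := by
  obtain ⟨f, hf, hf2⟩ := mem_DxPM hd k
  rw [hf]
  exact mono_mem_DxPM hf2

theorem isLieGrading_DxPM (ε : ℤˣ) : IsLieGrading (DxPMgrade ε) where
  iSup_eq_top := by
    rw [eq_top_iff]
    intro x _
    let s : Finset ℤ := Finsupp.support (x : DiffOp)
    have h : x = ∑ k ∈ s, (⟨_, mono_coeff_mem_DxPM x.2 k⟩ : DxPM ε) := by
      refine Subtype.ext (DiffOp.ext_coeff fun l => ?_)
      rw [AddSubmonoidClass.coe_finsetSum, map_sum]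
      simp only [DiffOp.coeff_mono, Finset.sum_ite_eq']
      split_ifs with hl
      · rfl
      · exact Finsupp.notMem_support_iff.1 hl
    rw [h]
    refine Submodule.sum_mem _ fun k _ => Submodule.mem_iSup_of_mem k fun l hl => ?_
    rw [DiffOp.coeff_mono, if_neg hl.symm]
  lie_mem i j x hx y hy l hl := by
    rw [LieSubalgebra.coe_bracket, eq_mono_of_mem_DxPMgrade hx, eq_mono_of_mem_DxPMgrade hy,
      DiffOp.mono_lie_mono, DiffOp.coeff_mono, if_neg hl.symm]

theorem isLieGrading_DHat (ε : ℤˣ) : IsLieGrading (DHatGrade ε) :=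
  (isLieGrading_DxPM ε).centralExt _ fun i j hij x hx y hy => by
    change Psi.toFun (x : DiffOp) (y : DiffOp) = 0
    rw [eq_mono_of_mem_DxPMgrade hx, eq_mono_of_mem_DxPMgrade hy, Psi_mono_of_ne (Or.inl hij)]

/-- The operator `D` measures the degree. -/
theorem opDpow_zero_lie (ε : ℤˣ) (k : ℤ) (x : DHat ε) (hx : x ∈ DHatGrade ε k) :
    ⁅(opDpow ε 0 Even.zero : DHat ε), x⁆ = (k : ℂ) • x := by
  have hx1 := eq_mono_of_mem_DxPMgrade hx.1
  refine CentralExt.ext (Subtype.ext ?_) ?_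
  · change ⁅DiffOp.mono 0 (Polynomial.X ^ 0 * Polynomial.X), (x.fst : DiffOp)⁆
      = (k : ℂ) • (x.fst : DiffOp)
    rw [hx1, DiffOp.mono_lie_mono, zero_add, ← map_smul]
    congr 1
    simp [Polynomial.smul_eq_C_mul]
    ring
  · change Psi.toFun (DiffOp.mono 0 (Polynomial.X ^ 0 * Polynomial.X)) (x.fst : DiffOp)
      = (k : ℂ) • x.snd
    rw [hx1, Psi_mono_of_ne]
    · by_cases hk : k = 0
      · simp [hk]
      · rw [hx.2 hk, smul_zero]
    · by_cases hk : k = 0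
      · exact Or.inr ⟨rfl, hk⟩
      · exact Or.inl (by simpa using hk)

/-- The `k`-th diagonal of a matrix. -/
noncomputable def diagPart {R : Type*} [CommRing R] [Algebra ℂ R] (k : ℤ) (A : GlInf R) : GlInf R :=
  shiftDiag k fun j => entry A (j - k) j

theorem entry_diagPart {R : Type*} [CommRing R] [Algebra ℂ R] (k : ℤ) (A : GlInf R) (i j : ℤ) :
    entry (diagPart k A) i j = if j - i = k then entry A i j else 0 := by
  rw [diagPart, entry_shiftDiag]
  by_cases h : j - i = k
  · rw [if_pos (by omega), if_pos h, show j - k = i by omega]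
  · rw [if_neg (by omega), if_neg h]

theorem entry_sum {R ι : Type*} [CommRing R] [Algebra ℂ R] (s : Finset ι) (A : ι → GlInf R)
    (i j : ℤ) : entry (∑ k ∈ s, A k) i j = ∑ k ∈ s, entry (A k) i j := by
  classical
  induction s using Finset.induction_on with
  | empty => simp
  | insert a s ha ih => rw [Finset.sum_insert ha, Finset.sum_insert ha, entry_add, ih]

theorem diagPart_mem {A : GlInf (Rm m)} (hA : A ∈ gBar ε m) (k : ℤ) : diagPart k A ∈ gBar ε m := by
  intro i j
  rw [entry_diagPart, entry_diagPart, show 1 - i - (1 - j) = j - i by ring]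
  split_ifs
  · exact hA i j
  · simp

theorem isLieGrading_gBar (ε : ℤˣ) (m : ℕ) : IsLieGrading (gBarGrade ε m) where
  iSup_eq_top := by
    rw [eq_top_iff]
    intro A _
    obtain ⟨N, hN⟩ := exists_band (A : GlInf (Rm m))
    have h : A = ∑ k ∈ Finset.Icc (-(N : ℤ)) N, (⟨_, diagPart_mem A.2 k⟩ : gBar ε m) := by
      refine Subtype.ext (glInf_ext fun i j => ?_)
      rw [AddSubmonoidClass.coe_finsetSum, entry_sum]
      simp only [entry_diagPart, Finset.sum_ite_eq]
      split_ifs with hl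
      · rfl
      · by_contra hne
        have := abs_le.1 (hN i j hne)
        exact hl (Finset.mem_Icc.2 (by omega))
    rw [h]
    refine Submodule.sum_mem _ fun k _ => Submodule.mem_iSup_of_mem k fun i j hij => ?_
    rw [entry_diagPart, if_neg hij]
  lie_mem k l A hA B hB i j hij := by
    have key : ∀ {k l : ℤ} {A B : GlInf (Rm m)}, (∀ i j, j - i ≠ k → entry A i j = 0) →
        (∀ i j, j - i ≠ l → entry B i j = 0) → j - i ≠ k + l → entry (A * B) i j = 0 := by
      intro k l A B hA hB hij
      by_contra h
      obtain ⟨n, h1, h2⟩ := exists_of_entry_mul_ne h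
      have h3 := not_imp_comm.1 (hA i n) h1
      have h4 := not_imp_comm.1 (hB n j) h2
      omega
    rw [LieSubalgebra.coe_bracket, Ring.lie_def, entry_sub, key hA hB hij,
      key hB hA (by rwa [add_comm]), sub_zero]

theorem trCocycle_eq_zero {R : Type*} [CommRing R] [Algebra ℂ R] {k l : ℤ} (hkl : k + l ≠ 0)
    {A B : GlInf R} (hA : ∀ i j, j - i ≠ k → entry A i j = 0)
    (hB : ∀ i j, j - i ≠ l → entry B i j = 0) : (trCocycle R).toFun A B = 0 := by
  rw [trCocycle_apply, tr]
  refine finsum_eq_zero_of_forall_eq_zero fun i => ?_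
  by_contra h
  obtain ⟨n, h1, h2⟩ := exists_of_entry_mul_ne h
  rw [entry_matJ_lie] at h1
  have h3 := not_imp_comm.1 (hA i n) (right_ne_zero_of_mul h1)
  have h4 := not_imp_comm.1 (hB n i) h2
  omega

theorem isLieGrading_GHat (ε : ℤˣ) (m : ℕ) : IsLieGrading (GHatGrade ε m) :=
  (isLieGrading_gBar ε m).centralExt _ fun _ _ hkl _ hA _ hB => trCocycle_eq_zero hkl hA hB

/-- The entries of `T⁻¹ φ(d)`. -/
theorem entry_TTinv_phi (m : ℕ) (d : DiffOp) (i j : ℤ) :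
    entry (TTinv m (phi (hu m) d)) i j = ((gg m i)⁻¹ : (Rm m)ˣ)
      * Polynomial.aeval (hu m - (j : Rm m)) (DiffOp.coeff (j - i) d) * gg m j := by
  rw [TTinv, entry_conjDiag, entry_phi, inv_inv]

theorem phiHat_fst (x : DHat ε) :
    ((phiHat ε m x).fst : GlInf (Rm m)) = TTinv m (phi (hu m) (x.fst : DiffOp)) := rfl

theorem phiHat_snd (x : DHat ε) : (phiHat ε m x).snd
    = algebraMap ℂ (Rm m) x.snd + alpha (hu m) (DiffOp.coeff 0 (x.fst : DiffOp)) := rfl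

theorem phiHat_mem {k : ℤ} {x : DHat ε} (hx : x ∈ DHatGrade ε k) :
    phiHat ε m x ∈ GHatGrade ε m k := by
  refine ⟨fun i j hij => ?_, fun hk => ?_⟩
  · rw [phiHat_fst, entry_TTinv_phi, hx.1 (j - i) hij, map_zero, mul_zero, zero_mul]
  · rw [phiHat_snd, hx.2 hk, hx.1 0 (Ne.symm hk), map_zero, map_zero, add_zero]

end Gradations

/-! ### Values of polynomials at the points `1/2 + u - i` -/

section Values

variable {m : ℕ}

theorem hu_sub_eq (m : ℕ) (i : ℤ) :
    hu m - (i : Rm m) = uu m + algebraMap ℂ (Rm m) (1 / 2 - i) := by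
  rw [hu, map_sub, map_intCast]; ring

/-- A polynomial takes an invertible value at `1/2 + u - i` if it does not vanish at `1/2 - i`. -/
theorem isUnit_aeval_hu_sub (m : ℕ) (i : ℤ) {f : ℂ[X]} (hf : f.eval (1 / 2 - i : ℂ) ≠ 0) :
    IsUnit (Polynomial.aeval (hu m - (i : Rm m)) f) := by
  obtain ⟨g, hg⟩ := Polynomial.X_sub_C_dvd_sub_C_eval (a := (1 / 2 - i : ℂ)) (p := f)
  rw [sub_eq_iff_eq_add'.1 hg, map_add, map_mul, Polynomial.aeval_C, map_sub, Polynomial.aeval_X,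
    Polynomial.aeval_C, hu_sub_eq, add_sub_cancel_right]
  have h1 : IsNilpotent (uu m * Polynomial.aeval (uu m + algebraMap ℂ (Rm m) (1 / 2 - i)) g) :=
    (Commute.all _ _).isNilpotent_mul_right ⟨m + 1, uu_pow m⟩
  exact h1.isUnit_add_left_of_commute ((IsUnit.mk0 _ hf).map (algebraMap ℂ (Rm m)))
    (Commute.all _ _)

theorem half_sub_ne_zero (i : ℤ) : (1 / 2 - i : ℂ) ≠ 0 := by
  intro h
  have h3 : ((1 - 2 * i : ℤ) : ℂ) = 0 := by push_cast; linear_combination 2 * h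
  have h4 : 1 - 2 * i = 0 := by exact_mod_cast h3
  omega

theorem isUnit_hu_sub (m : ℕ) (i : ℤ) : IsUnit (hu m - (i : Rm m)) := by
  simpa using isUnit_aeval_hu_sub m i (f := Polynomial.X) (by simpa using half_sub_ne_zero i)

theorem aeval_uu (f : ℂ[X]) : Polynomial.aeval (uu m) f = Rm.mk m f := by
  rw [uu, Polynomial.aeval_algHom_apply, Polynomial.aeval_X_left_apply]

theorem exists_aeval_hu_sub (i : ℤ) (r : Rm m) :
    ∃ f : ℂ[X], Polynomial.aeval (hu m - (i : Rm m)) f = r := by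
  obtain ⟨f, rfl⟩ := Rm.mk_surjective m r
  refine ⟨f.comp (Polynomial.X - Polynomial.C (1 / 2 - i : ℂ)), ?_⟩
  rw [Polynomial.aeval_comp, map_sub, Polynomial.aeval_X, Polynomial.aeval_C, hu_sub_eq,
    add_sub_cancel_right, aeval_uu]

/-- Hermite interpolation: a polynomial can take prescribed values in `ℂ[u]/(u^(m+1))` at finitely
many of the points `1/2 + u - i`. -/
theorem exists_interpolation (s : Finset ℤ) (r : ℤ → Rm m) :
    ∃ f : ℂ[X], ∀ i ∈ s, Polynomial.aeval (hu m - (i : Rm m)) f = r i := by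
  induction s using Finset.induction_on with
  | empty => exact ⟨0, by simp⟩
  | insert a s ha ih =>
    obtain ⟨f, hf⟩ := ih
    let P : ℂ[X] := ∏ j ∈ s, (Polynomial.X - Polynomial.C (1 / 2 - j : ℂ)) ^ (m + 1)
    have hP0 : ∀ i ∈ s, Polynomial.aeval (hu m - (i : Rm m)) P = 0 := by
      intro i hi
      rw [map_prod]
      refine Finset.prod_eq_zero hi ?_
      rw [map_pow, map_sub, Polynomial.aeval_X, Polynomial.aeval_C, hu_sub_eq,
        add_sub_cancel_right, uu_pow]
    have hPa : IsUnit (Polynomial.aeval (hu m - (a : Rm m)) P) := by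
      refine isUnit_aeval_hu_sub m a ?_
      rw [Polynomial.eval_prod]
      refine Finset.prod_ne_zero_iff.2 fun j hj => ?_
      rw [Polynomial.eval_pow, Polynomial.eval_sub, Polynomial.eval_X, Polynomial.eval_C]
      refine pow_ne_zero _ fun h => ha ?_
      have : (a : ℂ) = j := by linear_combination -h
      rwa [Int.cast_injective this]
    obtain ⟨c, hc⟩ := hPa
    obtain ⟨g, hg⟩ := exists_aeval_hu_sub a
      (((c⁻¹ : (Rm m)ˣ) : Rm m) * (r a - Polynomial.aeval (hu m - (a : Rm m)) f))
    refine ⟨f + P * g, fun i hi => ?_⟩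
    rw [map_add, map_mul]
    rcases Finset.mem_insert.1 hi with rfl | hi
    · rw [hg, ← hc, Units.mul_inv_cancel_left]; ring
    · rw [hP0 i hi, hf i hi]; ring

theorem negU_negU (r : Rm m) : negU m (negU m r) = r := by
  obtain ⟨f, rfl⟩ := Rm.mk_surjective m r
  rw [negU_mk, negU_aeval, map_neg, negU_uu, neg_neg, aeval_uu]

theorem negU_inverse (r : Rm m) : negU m (Ring.inverse r) = Ring.inverse (negU m r) := by
  by_cases h : IsUnit r
  · obtain ⟨c, rfl⟩ := h
    have h1 : negU m c = (Units.map (negU m : Rm m →* Rm m) c : Rm m) := rfl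
    rw [Ring.inverse_unit, h1, Ring.inverse_unit]
    rfl
  · have h' : ¬ IsUnit (negU m r) := fun h' => h (by
      have := h'.map (negU m)
      rwa [negU_negU] at this)
    rw [Ring.inverse_non_unit _ h, Ring.inverse_non_unit _ h', map_zero]

theorem negU_hu_sub (m : ℕ) (i : ℤ) :
    negU m (hu m - (i : Rm m)) = -(hu m - ((1 - i : ℤ) : Rm m)) := by
  rw [map_sub, negU_hu, map_intCast]; push_cast; ring

end Values

/-! ### Density of the operators -/

section Density

variable {ε : ℤˣ} {m : ℕ}

/-- Multiplying the columns of a matrix of degree `k` by scalars with a suitable symmetry preserves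
the Lie algebra `gBar`. -/
theorem mul_shiftDiag_zero_mem {k : ℤ} {A : gBar ε m} (hA : A ∈ gBarGrade ε m k) {c : ℤ → Rm m}
    (hc : ∀ i, c (1 + k - i) = negU m (c i)) :
    (A : GlInf (Rm m)) * shiftDiag 0 c ∈ gBar ε m := by
  intro i j
  rw [entry_mul_shiftDiag, entry_mul_shiftDiag, sub_zero, sub_zero, map_mul]
  by_cases h : j - i = k
  · rw [A.2 i j, show 1 - i = 1 + k - j by omega, hc, negU_negU]
    ring
  · rw [hA i j h, hA (1 - j) (1 - i) (by omega)]
    simp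

/-- The matrix of `D ^ 3` is diagonal with entries `(1/2 + u - j) ^ 3`. -/
theorem phiHat_cube (ε : ℤˣ) (m : ℕ) :
    ((phiHat ε m (opDpow ε 2 even_two)).fst : GlInf (Rm m))
      = shiftDiag 0 fun j => (hu m - (j : Rm m)) ^ 3 := by
  refine glInf_ext fun i j => ?_
  rw [phiHat_fst, entry_TTinv_phi, entry_shiftDiag]
  change _ * Polynomial.aeval _ (DiffOp.coeff (j - i)
    (DiffOp.mono 0 (Polynomial.X ^ 2 * Polynomial.X))) * _ = _
  rw [DiffOp.coeff_mono, sub_zero]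
  by_cases h : j = i
  · subst h
    rw [if_pos (sub_self j).symm, if_pos rfl, mul_right_comm, Units.inv_mul]
    simp [pow_succ]
  · rw [if_neg (fun h' => h (by omega)), if_neg h, map_zero, mul_zero, zero_mul]

/-- The polynomial `(X + k) ^ 3 - X ^ 3`, that gives the eigenvalues of `ad (D ^ 3)` in degree
`k`. -/
noncomputable def cubeDiff (k : ℤ) : ℂ[X] :=
  (Polynomial.X + Polynomial.C (k : ℂ)) ^ 3 - Polynomial.X ^ 3

theorem cubeDiff_eq (k : ℤ) : cubeDiff k = Polynomial.C (3 * (k : ℂ)) * Polynomial.X ^ 2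
    + Polynomial.C (3 * (k : ℂ) ^ 2) * Polynomial.X + Polynomial.C ((k : ℂ) ^ 3) := by
  simp only [cubeDiff, map_mul, map_pow]
  rw [show (Polynomial.C (3 : ℂ)) = 3 from rfl]
  ring

/-- `cubeDiff k` is invariant under `X ↦ -X - k`, which makes its values compatible with the
symmetry of `gBar`. -/
theorem cubeDiff_comp (k : ℤ) :
    (cubeDiff k).comp (-Polynomial.X - Polynomial.C (k : ℂ)) = cubeDiff k := by
  simp only [cubeDiff, Polynomial.sub_comp, Polynomial.pow_comp, Polynomial.add_comp,
    Polynomial.X_comp, Polynomial.C_comp]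
  ring

theorem comp_cubeDiff_ne_zero {k : ℤ} (hk : k ≠ 0) {p : ℂ[X]} (hp : p ≠ 0) :
    p.comp (cubeDiff k) ≠ 0 := by
  have hk' : (3 * (k : ℂ)) ≠ 0 := mul_ne_zero three_ne_zero (Int.cast_ne_zero.2 hk)
  have hdeg : (cubeDiff k).natDegree = 2 := by
    rw [cubeDiff_eq, Polynomial.natDegree_quadratic hk']
  intro h
  rcases Polynomial.comp_eq_zero_iff.1 h with h | ⟨-, h⟩
  · exact hp h
  · have := congrArg Polynomial.natDegree h
    rw [hdeg, Polynomial.natDegree_C] at this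
    omega

theorem GHat_ext_of_mem {k : ℤ} (hk : k ≠ 0) {x y : GHat ε m} (hx : x ∈ GHatGrade ε m k)
    (hy : y ∈ GHatGrade ε m k) (h : (x.fst : GlInf (Rm m)) = y.fst) : x = y :=
  CentralExt.ext (Subtype.ext h) ((hx.2 hk).trans (hy.2 hk).symm)

/-- On matrices of degree `k`, a polynomial `p` in `ad (D ^ 3)` multiplies the `j`-th column by the
value of `p (cubeDiff k)` at `1/2 + u - j`. -/
theorem aeval_ad_cube {k : ℤ} (p : ℂ[X]) {x : GHat ε m} (hx : x ∈ GHatGrade ε m k) :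
    Polynomial.aeval (LieAlgebra.ad ℂ (GHat ε m) (phiHat ε m (opDpow ε 2 even_two))) p x
        ∈ GHatGrade ε m k ∧
    ((Polynomial.aeval (LieAlgebra.ad ℂ (GHat ε m) (phiHat ε m (opDpow ε 2 even_two))) p x).fst
        : GlInf (Rm m))
      = x.fst * shiftDiag 0 fun j =>
        Polynomial.aeval (hu m - (j : Rm m)) (p.comp (cubeDiff k)) := by
  induction p using Polynomial.induction_on' with
  | add p q hp hq =>
    simp only [map_add, LinearMap.add_apply, Polynomial.add_comp]
    refine ⟨Submodule.add_mem _ hp.1 hq.1, ?_⟩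
    rw [shiftDiag_add, mul_add, ← hp.2, ← hq.2]
    rfl
  | monomial n c =>
    set h := phiHat ε m (opDpow ε 2 even_two)
    have hh : h ∈ GHatGrade ε m 0 := phiHat_mem (opDpow ε 2 even_two).2
    have key : ∀ n : ℕ, ((LieAlgebra.ad ℂ (GHat ε m) h) ^ n) x ∈ GHatGrade ε m k ∧
        ((((LieAlgebra.ad ℂ (GHat ε m) h) ^ n) x).fst : GlInf (Rm m))
        = x.fst * shiftDiag 0 fun j =>
          Polynomial.aeval (hu m - (j : Rm m)) (cubeDiff k) ^ n := by
      intro n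
      induction n with
      | zero => exact ⟨by simpa using hx, by simp [shiftDiag_zero_one]⟩
      | succ n ih =>
        rw [pow_succ', Module.End.mul_apply, LieAlgebra.ad_apply]
        refine ⟨by simpa using (isLieGrading_GHat ε m).lie_mem 0 k h hh _ ih.1, ?_⟩
        set y := ((LieAlgebra.ad ℂ (GHat ε m) h) ^ n) x
        change ⁅(h.fst : GlInf (Rm m)), (y.fst : GlInf (Rm m))⁆ = _
        rw [ih.2, phiHat_cube]
        refine glInf_ext fun i j => ?_
        rw [Ring.lie_def, entry_sub, entry_shiftDiag_mul]
        simp only [entry_mul_shiftDiag, add_zero, sub_zero]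
        by_cases hij : j - i = k
        · have hi : (i : Rm m) = (j : Rm m) - (k : Rm m) := by
            rw [← Int.cast_sub]; congr 1; omega
          have hv : Polynomial.aeval (hu m - (j : Rm m)) (cubeDiff k)
              = (hu m - (i : Rm m)) ^ 3 - (hu m - (j : Rm m)) ^ 3 := by
            simp [cubeDiff, hi]
            ring
          rw [pow_succ, hv]
          ring
        · rw [hx.1 i j hij]
          ring
    rw [Polynomial.aeval_monomial, Module.End.mul_apply, Module.algebraMap_end_apply]
    refine ⟨Submodule.smul_mem _ _ (key n).1, ?_⟩
    rw [Polynomial.monomial_comp]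
    simp only [map_mul, map_pow, Polynomial.aeval_C, ← Algebra.smul_def]
    rw [← smul_shiftDiag, mul_smul_comm, ← (key n).2]
    rfl

variable {V : Type*} [AddCommGroup V] [Module ℂ V] [LieRingModule (GHat ε m) V]
  [LieModule ℂ (GHat ε m) V] {𝒱 : ℤ → Submodule ℂ V}

/-- The matrices of nonzero degree `k` that are supported far from the origin act trivially on a
given component of a quasifinite module: such a matrix is a multiple of one that a polynomial in
`ad (D ^ 3)` maps to an element acting trivially. -/
theorem exists_forall_lie_eq_zero_of_far
    (hlie : ∀ i j : ℤ, ∀ x ∈ GHatGrade ε m i, ∀ w ∈ 𝒱 j, ⁅x, w⁆ ∈ 𝒱 (i + j))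
    (hfin : IsQuasifinite 𝒱) {k : ℤ} (hk : k ≠ 0) (j : ℤ) :
    ∃ N : ℕ, ∀ x ∈ GHatGrade ε m k,
      (∀ i : ℤ, |i| ≤ N → entry (x.fst : GlInf (Rm m)) (i - k) i = 0) →
      ∀ w ∈ 𝒱 j, ⁅x, w⁆ = 0 := by
  set h := phiHat ε m (opDpow ε 2 even_two) with hdef
  have hh : h ∈ GHatGrade ε m 0 := phiHat_mem (opDpow ε 2 even_two).2
  obtain ⟨p, hp0, hp⟩ := exists_aeval_ad_lie_eq_zero hlie hfin hh k j
  set F := p.comp (cubeDiff k) with hF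
  have hF0 : F ≠ 0 := comp_cubeDiff_ne_zero hk hp0
  have hFsymm : F.comp (-Polynomial.X - Polynomial.C (k : ℂ)) = F := by
    rw [hF, Polynomial.comp_assoc, cubeDiff_comp]
  have hfinite : {i : ℤ | F.eval (1 / 2 - i : ℂ) = 0}.Finite := by
    refine Set.Finite.of_finite_image (f := fun i : ℤ => (1 / 2 - i : ℂ))
      ((F.roots.toFinset.finite_toSet).subset ?_) fun a _ b _ hab => ?_
    · rintro _ ⟨i, hi, rfl⟩
      simpa [hF0] using hi
    · exact Int.cast_injective (sub_right_injective hab)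
  obtain ⟨N, hN⟩ : ∃ N : ℕ, ∀ i : ℤ, F.eval (1 / 2 - i : ℂ) = 0 → |i| ≤ N := by
    refine ⟨∑ i ∈ hfinite.toFinset, i.natAbs, fun i hi => ?_⟩
    rw [← Int.natCast_natAbs]
    exact_mod_cast Finset.single_le_sum (f := Int.natAbs) (fun _ _ => Nat.zero_le _)
      (hfinite.mem_toFinset.2 hi)
  refine ⟨N, fun x hx hfar w hw => ?_⟩
  -- `Ring.inverse` is zero at the finitely many nonunits, where the entries of `x` vanish
  set c : ℤ → Rm m := fun i => Ring.inverse (Polynomial.aeval (hu m - (i : Rm m)) F) with hc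
  have hcsymm : ∀ i, c (1 + k - i) = negU m (c i) := by
    intro i
    simp only [hc]
    rw [negU_inverse, negU_aeval, negU_hu_sub]
    congr 1
    conv_lhs => rw [← hFsymm]
    have hpt : Polynomial.aeval (hu m - ((1 + k - i : ℤ) : Rm m))
        (-Polynomial.X - Polynomial.C (k : ℂ)) = -(hu m - ((1 - i : ℤ) : Rm m)) := by
      simp
      ring
    rw [Polynomial.aeval_comp, hpt]
  have hB := mul_shiftDiag_zero_mem hx.1 hcsymm
  set y : GHat ε m := CentralExt.mk _ ⟨_, hB⟩ 0
  have hy : y ∈ GHatGrade ε m k := ⟨fun i j hij => by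
    change entry ((x.fst : GlInf (Rm m)) * shiftDiag 0 c) i j = 0
    rw [entry_mul_shiftDiag, sub_zero, hx.1 i j hij, zero_mul], fun _ => rfl⟩
  have hxy : x = Polynomial.aeval (LieAlgebra.ad ℂ (GHat ε m) h) p y := by
    refine GHat_ext_of_mem hk hx (aeval_ad_cube p hy).1 ?_
    rw [(aeval_ad_cube p hy).2]
    change _ = (x.fst : GlInf (Rm m)) * shiftDiag 0 c * _
    refine glInf_ext fun i l => ?_
    rw [entry_mul_shiftDiag, entry_mul_shiftDiag]
    simp only [sub_zero, hc]
    by_cases hl : F.eval (1 / 2 - l : ℂ) = 0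
    · have h0 : entry (x.fst : GlInf (Rm m)) i l = 0 := by
        by_cases hil : l - i = k
        · rw [show i = l - k by omega]
          exact hfar l (hN l hl)
        · exact hx.1 i l hil
      rw [h0, zero_mul, zero_mul]
    · rw [mul_assoc, Ring.inverse_mul_cancel _ (isUnit_aeval_hu_sub m l hl), mul_one]
  rw [hxy]
  exact hp y hy w hw

/-- Finitely many entries of a matrix of degree `k` are those of the image of an operator. -/
theorem exists_entry_phiHat_eq {A : GlInf (Rm m)} (hA : A ∈ gBar ε m) (k : ℤ) (N : ℕ) :
    ∃ x ∈ DHatGrade ε k, ∀ i : ℤ, |i| ≤ N →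
      entry ((phiHat ε m x).fst : GlInf (Rm m)) (i - k) i = entry A (i - k) i := by
  obtain ⟨f, hf⟩ := exists_interpolation (Finset.Icc (-(N + |k| + 1)) (N + |k| + 1))
    fun i => (gg m (i - k) : Rm m) * entry A (i - k) i * (((gg m i)⁻¹ : (Rm m)ˣ) : Rm m)
      * Ring.inverse (hu m - (i : Rm m))
  have hf' : ∀ i : ℤ, |i| ≤ N + |k| + 1 →
      Polynomial.aeval (hu m - (i : Rm m)) f * (hu m - (i : Rm m)) * gg m i
        = (gg m (i - k) : Rm m) * entry A (i - k) i := by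
    intro i hi
    rw [hf i (Finset.mem_Icc.2 (abs_le.1 hi)), mul_assoc _ (Ring.inverse _),
      Ring.inverse_mul_cancel _ (isUnit_hu_sub m i), mul_one, mul_assoc _ _ (gg m i : Rm m),
      Units.inv_mul, mul_one]
  -- the symmetrization of the interpolating polynomial
  set f₁ : ℂ[X] := (2⁻¹ : ℂ) •
    (f + (sgn ε k : ℂ) • f.comp (-Polynomial.X - Polynomial.C (k : ℂ))) with hf₁
  have hsgn : (sgn ε k : ℂ) * (sgn ε k : ℂ) = 1 := by
    rw [← Int.cast_mul, sgn_mul_self, Int.cast_one]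
  have hsymm : f₁ = (sgn ε k : ℂ) • f₁.comp (-Polynomial.X - Polynomial.C (k : ℂ)) := by
    have h2 : (f.comp (-Polynomial.X - Polynomial.C (k : ℂ))).comp
        (-Polynomial.X - Polynomial.C (k : ℂ)) = f := by
      rw [Polynomial.comp_assoc]
      simp
    rw [hf₁, Polynomial.smul_comp, Polynomial.add_comp, Polynomial.smul_comp, h2, smul_comm,
      smul_add (sgn ε k : ℂ), smul_smul (sgn ε k : ℂ), hsgn, one_smul, add_comm]
  refine ⟨CentralExt.mk _ ⟨_, mono_mem_DxPM hsymm⟩ 0, ⟨fun l hl => ?_, fun _ => rfl⟩,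
    fun i hi => ?_⟩
  · rw [CentralExt.fst_mk, DiffOp.coeff_mono, if_neg hl.symm]
  rw [phiHat_fst, entry_TTinv_phi, CentralExt.fst_mk, DiffOp.coeff_mono, if_pos (by omega),
    map_mul, Polynomial.aeval_X, hf₁]
  have e0 := hf' i (by have := abs_nonneg k; omega)
  have e1 := congrArg (negU m)
    (hf' (1 - (i - k)) (by rw [abs_le] at *; cases abs_cases k <;> omega))
  have e2 := hA (i - k) i
  have e3 := hh_const m (i - k) i
  set p := i - k with hp
  rw [show 1 - p - k = 1 - i by omega] at e1
  simp only [map_mul, negU_aeval, negU_hu_sub, sub_sub_cancel] at e1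
  have hik : (i : Rm m) = (p : Rm m) + (k : Rm m) := by
    rw [← Int.cast_add]; congr 1; omega
  have e4 : Polynomial.aeval (hu m - (i : Rm m))
      (f.comp (-Polynomial.X - Polynomial.C (k : ℂ)))
      = Polynomial.aeval (-(hu m - (p : Rm m))) f := by
    have : Polynomial.aeval (hu m - (i : Rm m)) (-Polynomial.X - Polynomial.C (k : ℂ))
        = -(hu m - (p : Rm m)) := by
      simp [hik]
      ring
    rw [Polynomial.aeval_comp, this]
  rw [map_smul, map_add, map_smul, e4]
  have hs : (sgn (-ε) (p + i) : Rm m) = sgn (-1) p * sgn (-1) i * sgn ε k := by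
    rw [← Int.cast_mul, ← Int.cast_mul, ← sgn_add, show k = (p + i) + (-p + -p) by omega,
      sgn_add ε, sgn_add ε (-p), sgn_mul_self, mul_one]
    congr 1
    rw [sgn, sgn, sgn, ← Units.val_mul, ← mul_zpow, neg_one_mul]
  have u3 : (sgn (-1) i : Rm m) * (sgn (-1) i : Rm m) = 1 := by
    rw [← Int.cast_mul, sgn_mul_self, Int.cast_one]
  have hsm : ∀ r : Rm m, (sgn ε k : ℂ) • r = (sgn ε k : Rm m) * r := fun r => by
    rw [Algebra.smul_def, map_intCast]
  rw [hsm]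
  rw [hs] at e2
  -- the reflected polynomial takes the prescribed values as well
  have e5 : (sgn ε k : Rm m) * Polynomial.aeval (-(hu m - (p : Rm m))) f * (hu m - (i : Rm m))
      * gg m i = (gg m p : Rm m) * entry A p i := by
    have hu1 := isUnit_hu_sub m p
    have hu2 : IsUnit (negU m (gg m (1 - p))) := (gg m (1 - p)).isUnit.map (negU m)
    refine (hu1.mul hu2).mul_right_cancel ?_
    rw [e2]
    set S := (sgn ε k : Rm m)
    set si := (sgn (-1) i : Rm m)
    set sp := (sgn (-1) p : Rm m)
    set nA := negU m (entry A (1 - i) (1 - p))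
    linear_combination (-S * (hu m - (i : Rm m)) * gg m i) * e1 + S * si * nA * e3
      + S * nA * (hu m - (i : Rm m)) * gg m i * negU m (gg m (1 - i)) * u3
  have h2 : (2⁻¹ : ℂ) • ((2 : ℂ) • ((gg m p : Rm m) * entry A p i))
      = (gg m p : Rm m) * entry A p i := by
    rw [smul_smul, inv_mul_cancel₀ two_ne_zero, one_smul]
  rw [two_smul] at h2
  rw [mul_assoc, mul_assoc, smul_mul_assoc, add_mul, ← mul_assoc _ _ (gg m i : Rm m), e0,
    ← mul_assoc _ _ (gg m i : Rm m), e5, h2, ← mul_assoc, Units.inv_mul, one_mul]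

/-- On a component of a quasifinite module, every matrix of nonzero degree acts like the image of
some operator. -/
theorem exists_phiHat_lie_eq
    (hlie : ∀ i j : ℤ, ∀ x ∈ GHatGrade ε m i, ∀ w ∈ 𝒱 j, ⁅x, w⁆ ∈ 𝒱 (i + j))
    (hfin : IsQuasifinite 𝒱) {k : ℤ} (hk : k ≠ 0) (j : ℤ) {x : GHat ε m}
    (hx : x ∈ GHatGrade ε m k) :
    ∃ d ∈ DHatGrade ε k, ∀ w ∈ 𝒱 j, ⁅phiHat ε m d, w⁆ = ⁅x, w⁆ := by
  obtain ⟨N, hN⟩ := exists_forall_lie_eq_zero_of_far hlie hfin hk j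
  obtain ⟨d, hd, hentry⟩ := exists_entry_phiHat_eq x.fst.2 k N
  refine ⟨d, hd, fun w hw => ?_⟩
  rw [← sub_eq_zero, ← sub_lie]
  refine hN _ (Submodule.sub_mem _ (phiHat_mem hd) hx) (fun i hi => ?_) w hw
  change entry (((phiHat ε m d).fst : GlInf (Rm m)) - (x.fst : GlInf (Rm m))) (i - k) i = 0
  rw [entry_sub, hentry i hi, sub_self]

end Density

/-! ### Irreducibility of the restriction -/

section Restriction

variable {ε : ℤˣ} {m : ℕ}

theorem trCocycle_eq_zero_of_lie_matJ {R : Type*} [CommRing R] [Algebra ℂ R] {A : GlInf R}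
    (hA : ∀ i j, (i ≤ 0 ∧ 0 < j ∨ j ≤ 0 ∧ 0 < i) → entry A i j = 0) (B : GlInf R) :
    (trCocycle R).toFun A B = 0 := by
  have h : ⁅matJ R, A⁆ = 0 := glInf_ext fun i j => by
    rw [entry_matJ_lie, entry_zero]
    by_cases hi : i ≤ 0 <;> by_cases hj : j ≤ 0
    · simp [hi, hj]
    · rw [hA i j (Or.inl ⟨hi, by omega⟩), mul_zero]
    · rw [hA i j (Or.inr ⟨hj, by omega⟩), mul_zero]
    · simp [hi, hj]
  rw [trCocycle_apply, h, zero_mul, tr]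
  exact finsum_eq_zero_of_forall_eq_zero fun i => rfl

/-- The image of the operator `D` measures the degree. -/
theorem phiHat_opDpow_zero_lie (ε : ℤˣ) (m : ℕ) (k : ℤ) (x : GHat ε m) (hx : x ∈ GHatGrade ε m k) :
    ⁅phiHat ε m (opDpow ε 0 Even.zero), x⁆ = (k : ℂ) • x := by
  have hD : ((phiHat ε m (opDpow ε 0 Even.zero)).fst : GlInf (Rm m))
      = shiftDiag 0 fun j => hu m - (j : Rm m) := by
    refine glInf_ext fun i j => ?_
    rw [phiHat_fst, entry_TTinv_phi, entry_shiftDiag]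
    change _ * Polynomial.aeval _ (DiffOp.coeff (j - i)
      (DiffOp.mono 0 (Polynomial.X ^ 0 * Polynomial.X))) * _ = _
    rw [DiffOp.coeff_mono, sub_zero]
    by_cases h : j = i
    · subst h
      rw [if_pos (sub_self j).symm, if_pos rfl, mul_right_comm, Units.inv_mul]
      simp
    · rw [if_neg (fun h' => h (by omega)), if_neg h, map_zero, mul_zero, zero_mul]
  refine CentralExt.ext (Subtype.ext (glInf_ext fun i j => ?_)) ?_
  · change entry ⁅((phiHat ε m (opDpow ε 0 Even.zero)).fst : GlInf (Rm m)),
      (x.fst : GlInf (Rm m))⁆ i j = entry ((k : ℂ) • (x.fst : GlInf (Rm m))) i j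
    rw [hD, Ring.lie_def, entry_sub, entry_shiftDiag_mul, entry_mul_shiftDiag, entry_smul]
    simp only [add_zero, sub_zero]
    by_cases hij : j - i = k
    · rw [Algebra.smul_def, map_intCast, ← hij]
      push_cast
      ring
    · rw [hx.1 i j hij]
      simp
  · change (trCocycle (Rm m)).toFun
      ((phiHat ε m (opDpow ε 0 Even.zero)).fst : GlInf (Rm m)) (x.fst : GlInf (Rm m))
        = (k : ℂ) • x.snd
    rw [trCocycle_eq_zero_of_lie_matJ]
    · by_cases hk : k = 0
      · simp [hk]
      · rw [hx.2 hk, smul_zero]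
    · intro i j hij
      rw [hD, entry_shiftDiag, if_neg (by omega)]

variable {lam : Module.Dual ℂ (GHatGrade ε m 0)} {V : Type*} [AddCommGroup V] [Module ℂ V]
  [LieRingModule (GHat ε m) V] [LieModule ℂ (GHat ε m) V] {𝒱 : ℤ → Submodule ℂ V}

/-- A nonzero subspace stable under the operators is everything: it is graded, and a nonzero vector
of the highest possible degree in it is singular for the whole Lie algebra of matrices. -/
theorem eq_top_of_phiHat_stable (hV : IsIrreducibleHighestWeight (GHatGrade ε m) lam 𝒱)
    (hfin : IsQuasifinite 𝒱) {N : Submodule ℂ V}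
    (hN : ∀ (x : DHat ε), ∀ w ∈ N, ⁅phiHat ε m x, w⁆ ∈ N) (hne : N ≠ ⊥) : N = ⊤ := by
  have hL := isLieGrading_GHat ε m
  let δ : GHatGrade ε m 0 := ⟨_, phiHat_mem (opDpow ε 0 Even.zero).2⟩
  have hgr : N = ⨆ j, N ⊓ 𝒱 j :=
    eq_iSup_inf_of_eigen hV.internal.submodule_iSup_eq_top
      (LieModule.toEnd ℂ (GHat ε m) V δ) (lam δ)
      (fun j w hw => IsIrreducibleHighestWeight.lie_degree hL hV δ
        (phiHat_opDpow_zero_lie ε m) j hw) N fun w hw => hN _ w hw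
  have hstable : ∀ k : ℤ, k ≠ 0 → ∀ x ∈ GHatGrade ε m k, ∀ w ∈ N, ⁅x, w⁆ ∈ N := by
    intro k hk x hx w hw
    rw [hgr] at hw
    induction hw using Submodule.iSup_induction' with
    | zero => simp
    | add a b _ _ ha hb => rw [lie_add]; exact N.add_mem ha hb
    | mem j w hw =>
      obtain ⟨d, -, hd⟩ := exists_phiHat_lie_eq hV.lie_mem hfin hk j hx
      rw [← hd w hw.2]
      exact hN d w hw.1
  have hex : ∃ n : ℕ, N ⊓ 𝒱 (-n) ≠ ⊥ := by
    by_contra! hall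
    refine hne (hgr.trans (iSup_eq_bot.2 fun j => ?_))
    rcases lt_or_ge 0 j with hj | hj
    · rw [IsIrreducibleHighestWeight.eq_bot_of_pos hL hV hj, inf_bot_eq]
    · have := hall j.natAbs
      rwa [Int.ofNat_natAbs_of_nonpos hj, neg_neg] at this
  classical
  obtain ⟨w, hw, hwne⟩ := Submodule.exists_mem_ne_zero_of_ne_bot (Nat.find_spec hex)
  have hmin : ∀ k : ℤ, 0 < k → N ⊓ 𝒱 (k + -(Nat.find hex : ℤ)) = ⊥ := by
    intro k hk
    rcases lt_or_ge 0 (k + -(Nat.find hex : ℤ)) with h | h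
    · rw [IsIrreducibleHighestWeight.eq_bot_of_pos hL hV h, inf_bot_eq]
    · have h1 := Nat.find_min hex (m := (k + -(Nat.find hex : ℤ)).natAbs) (by omega)
      rwa [Int.ofNat_natAbs_of_nonpos h, neg_neg, not_not] at h1
  obtain ⟨v, hv0, -, hv, hpos, hspan⟩ := hV.exists_vector
  have hzero : Nat.find hex = 0 := by
    by_contra hn
    refine hwne (IsIrreducibleHighestWeight.eq_zero_of_singular hL hV
      (n := -(Nat.find hex : ℤ)) (by omega) hw.2 fun k hk x hx => ?_)
    have h1 : ⁅x, w⁆ ∈ N ⊓ 𝒱 (k + -(Nat.find hex : ℤ)) :=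
      ⟨hstable k hk.ne' x hx w hw.1, hV.lie_mem k _ x hx w hw.2⟩
    rwa [hmin k hk, Submodule.mem_bot] at h1
  rw [hzero] at hw
  obtain ⟨c, rfl⟩ := IsIrreducibleHighestWeight.mem_span_of_mem_zero hL hV hv0 hv hpos hspan
    (by simpa using hw.2)
  have hc : c ≠ 0 := fun hc => hwne (by rw [hc, zero_smul])
  exact IsIrreducibleHighestWeight.eq_top_of_neg_stable hL hv hpos hspan
    ((N.smul_mem_iff hc).1 hw.1) fun k hk x hx w hw => hstable k hk.ne x hx w hw

theorem pullback_isIrreducible (hV : IsIrreducibleHighestWeight (GHatGrade ε m) lam 𝒱)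
    (hfin : IsQuasifinite 𝒱) :
    LieModule.IsIrreducible ℂ (DHat ε) (Pullback (phiHat ε m) V) := by
  obtain ⟨v, -, hvne, -⟩ := hV.exists_vector
  have : Nontrivial (Pullback (phiHat ε m) V) := ⟨⟨v, 0, hvne⟩⟩
  refine LieModule.IsIrreducible.mk fun N hN => ?_
  have h := eq_top_of_phiHat_stable hV hfin (N := N.toSubmodule)
    (fun x w hw => N.lie_mem (x := x) hw)
    (fun h => hN ((LieSubmodule.toSubmodule_eq_bot N).1 h))
  exact (LieSubmodule.toSubmodule_eq_top N).1 h

/-- The highest weight of the restriction of the module of highest weight `lam`. -/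
noncomputable def pullbackWeight (lam : Module.Dual ℂ (GHatGrade ε m 0)) :
    Module.Dual ℂ (DHatGrade ε 0) :=
  lam ∘ₗ (phiHat ε m : DHat ε →ₗ[ℂ] GHat ε m).restrict fun _ hx => phiHat_mem hx

theorem pullbackWeight_apply (lam : Module.Dual ℂ (GHatGrade ε m 0)) (h : DHatGrade ε 0) :
    pullbackWeight lam h = lam ⟨phiHat ε m h, phiHat_mem h.2⟩ := rfl

theorem pullback_isIrreducibleHighestWeight
    (hV : IsIrreducibleHighestWeight (GHatGrade ε m) lam 𝒱) (hfin : IsQuasifinite 𝒱) :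
    IsIrreducibleHighestWeight (DHatGrade ε) (pullbackWeight lam)
      (Pullback.grading (phiHat ε m) 𝒱) := by
  have hirr := pullback_isIrreducible hV hfin
  obtain ⟨v, hv0, hvne, hv, hpos, -⟩ := hV.exists_vector
  refine ⟨hV.internal, fun i j x hx w hw => hV.lie_mem i j _ (phiHat_mem hx) w hw,
    ⟨v, hv0, hvne, fun h => hv ⟨_, phiHat_mem h.2⟩, fun k hk x hx => hpos k hk _ (phiHat_mem hx),
      ?_⟩, fun N _ => eq_bot_or_eq_top N⟩
  refine (eq_bot_or_eq_top _).resolve_left fun h => hvne ?_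
  exact (LieSubmodule.lieSpan_eq_bot_iff (R := ℂ) (L := DHat ε)
    (M := Pullback (phiHat ε m) V) (s := {v})).1 h v rfl

end Restriction

/-! ### The highest weight vanishes far from the origin -/

section Far

variable {ε : ℤˣ} {m : ℕ} {lam : Module.Dual ℂ (GHatGrade ε m 0)} {V : Type*} [AddCommGroup V]
  [Module ℂ V] [LieRingModule (GHat ε m) V] [LieModule ℂ (GHat ε m) V] {𝒱 : ℤ → Submodule ℂ V}

theorem sgn_neg_two_mul_add_one (ε : ℤˣ) (j : ℤ) : sgn (-ε) (2 * j + 1) = -(ε : ℤ) := by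
  rw [sgn_add, two_mul, sgn_add, sgn_mul_self, one_mul, sgn, zpow_one, Units.val_neg]

theorem cast_sign_mul_self (R : Type*) [CommRing R] (ε : ℤˣ) :
    (((ε : ℤ) : R)) * ((ε : ℤ) : R) = 1 := by
  rw [← Int.cast_mul, ← Units.val_mul, Int.units_mul_self, Units.val_one, Int.cast_one]

/-- The condition that defines `gBar`, on a single diagonal of odd degree, where the sign does not
depend on the position. -/
theorem shiftDiag_mem {k : ℤ} {c : ℤ → Rm m} (hk : Odd k)
    (hc : ∀ j, c j = ((ε : ℤ) : Rm m) * negU m (c (1 + k - j))) : shiftDiag k c ∈ gBar ε m := by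
  intro i j
  rw [entry_shiftDiag, entry_shiftDiag]
  by_cases h : j - k = i
  · obtain ⟨l, rfl⟩ := hk
    rw [if_pos h, if_pos (by omega), show i + j = 2 * (j - l - 1) + 1 by omega,
      sgn_neg_two_mul_add_one, hc, show 1 + (2 * l + 1) - j = 1 - i by omega]
    push_cast
    ring
  · rw [if_neg h, if_neg (by omega)]
    simp

/-- A diagonal matrix is the commutator of a matrix of degree `1` and a matrix of degree `-1`, the
latter being supported as far from the origin as the diagonal matrix. -/
theorem exists_lie_eq_of_mem_zero {h : GHat ε m} (hh : h ∈ GHatGrade ε m 0) (hsnd : h.snd = 0)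
    (N : ℕ) (hfar : ∀ i : ℤ, |i| ≤ N → entry (h.fst : GlInf (Rm m)) i i = 0) :
    ∃ a ∈ GHatGrade ε m 1, ∃ b ∈ GHatGrade ε m (-1), ⁅a, b⁆ = h ∧
      ∀ i : ℤ, |i| ≤ N → entry (b.fst : GlInf (Rm m)) (i - (-1)) i = 0 := by
  -- the superdiagonal has no entry in the column `1`, where the central term would arise
  let α : ℤ → Rm m := fun j => if j = 1 then 0 else if 1 < j then 1 else ((ε : ℤ) : Rm m)
  let B : ℤ → Rm m := fun j => ∑ l ∈ Finset.Icc 1 j, entry (h.fst : GlInf (Rm m)) l l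
  let β : ℤ → Rm m := fun j => if 0 ≤ j then B j else ((ε : ℤ) : Rm m) * negU m (B (-j))
  have hB0 : B 0 = 0 := by simp [B]
  have hBsucc : ∀ j : ℤ, 1 ≤ j → B j = B (j - 1) + entry (h.fst : GlInf (Rm m)) j j := by
    intro j hj
    have : Finset.Icc 1 j = insert j (Finset.Icc 1 (j - 1)) := by
      ext; simp only [Finset.mem_Icc, Finset.mem_insert]; omega
    simp only [B]
    rw [this, Finset.sum_insert (by simp), add_comm]
  have hBfar : ∀ j : ℤ, j ≤ N → B j = 0 := by
    intro j hj
    refine Finset.sum_eq_zero fun l hl => hfar l ?_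
    rw [Finset.mem_Icc] at hl
    rw [abs_of_nonneg (by omega)]
    omega
  have hα : shiftDiag 1 α ∈ gBar ε m := by
    refine shiftDiag_mem odd_one fun j => ?_
    simp only [α]
    by_cases h1 : j = 1
    · simp [h1]
    · by_cases h2 : 1 < j
      · rw [if_neg h1, if_pos h2, if_neg (by omega), if_neg (by omega), map_intCast,
          cast_sign_mul_self]
      · rw [if_neg h1, if_neg h2, if_neg (by omega), if_pos (by omega), map_one, mul_one]
  have hβ : shiftDiag (-1) β ∈ gBar ε m := by
    refine shiftDiag_mem (by decide) fun j => ?_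
    simp only [β]
    rw [show 1 + -1 - j = -j by ring]
    rcases lt_trichotomy j 0 with h | rfl | h
    · rw [if_neg (by omega), if_pos (by omega)]
    · simp [hB0]
    · rw [if_pos (by omega), if_neg (by omega), map_mul, map_intCast, negU_negU, neg_neg,
        ← mul_assoc, cast_sign_mul_self, one_mul]
  refine ⟨CentralExt.mk _ ⟨_, hα⟩ 0, ⟨fun i j hij => ?_, fun _ => rfl⟩,
    CentralExt.mk _ ⟨_, hβ⟩ 0, ⟨fun i j hij => ?_, fun _ => rfl⟩, ?_, fun i hi => ?_⟩
  · rw [CentralExt.fst_mk, entry_shiftDiag, if_neg (by omega)]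
  · rw [CentralExt.fst_mk, entry_shiftDiag, if_neg (by omega)]
  · refine CentralExt.ext (Subtype.ext (glInf_ext fun i j => ?_)) ?_
    · let Z : gBar ε m := ⁅(⟨_, hα⟩ : gBar ε m), (⟨_, hβ⟩ : gBar ε m)⁆
      have hZ : ∀ i j, entry (Z : GlInf (Rm m)) i j
          = if j = i then α (j + 1) * β j - β (j - 1) * α j else 0 := by
        intro i j
        change entry ⁅shiftDiag 1 α, shiftDiag (-1) β⁆ i j = _
        rw [Ring.lie_def, entry_sub, shiftDiag_mul_shiftDiag, shiftDiag_mul_shiftDiag,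
          entry_shiftDiag, entry_shiftDiag]
        by_cases hij : j = i
        · rw [if_pos (by omega), if_pos (by omega), if_pos hij, sub_neg_eq_add]
        · rw [if_neg (by omega), if_neg (by omega), if_neg hij, sub_zero]
      change entry (Z : GlInf (Rm m)) i j = entry (h.fst : GlInf (Rm m)) i j
      have hpos : ∀ j : ℤ, 1 ≤ j →
          entry (Z : GlInf (Rm m)) j j = entry (h.fst : GlInf (Rm m)) j j := by
        intro j hj
        rw [hZ, if_pos rfl]
        simp only [α, β]
        rw [if_neg (by omega), if_pos (by omega), if_pos (by omega), if_pos (by omega),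
          hBsucc j hj]
        by_cases h1 : j = 1
        · subst h1
          simp [hB0]
        · rw [if_neg h1, if_pos (by omega)]
          ring
      by_cases hij : j = i
      · subst hij
        rcases le_or_gt 1 j with hj | hj
        · exact hpos j hj
        · rw [Z.2 j j, h.fst.2 j j, hpos (1 - j) (by omega)]
      · rw [hZ, if_neg hij, hh.1 i j (by omega)]
    · change (trCocycle (Rm m)).toFun (shiftDiag 1 α) (shiftDiag (-1) β) = h.snd
      rw [hsnd]
      refine trCocycle_eq_zero_of_lie_matJ (fun i j hij => ?_) _
      rw [entry_shiftDiag]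
      split_ifs with h1
      · obtain rfl : j = 1 := by omega
        simp [α]
      · rfl
  · rw [CentralExt.fst_mk, entry_shiftDiag, if_pos rfl]
    rw [abs_le] at hi
    simp only [β]
    rw [hBfar i hi.2, hBfar (-i) (by omega)]
    simp

/-- The highest weight of a quasifinite module vanishes on the diagonal matrices supported far from
the origin. -/
theorem exists_forall_weight_eq_zero_of_far
    (hV : IsIrreducibleHighestWeight (GHatGrade ε m) lam 𝒱) (hfin : IsQuasifinite 𝒱) :
    ∃ N : ℕ, ∀ h : GHatGrade ε m 0, (h : GHat ε m).snd = 0 →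
      (∀ i : ℤ, |i| ≤ N → entry ((h : GHat ε m).fst : GlInf (Rm m)) i i = 0) → lam h = 0 := by
  obtain ⟨N, hN⟩ := exists_forall_lie_eq_zero_of_far hV.lie_mem hfin (k := -1) (by decide) 0
  refine ⟨N, fun h hsnd hfar => ?_⟩
  obtain ⟨v, hv0, hvne, hv, hpos, -⟩ := hV.exists_vector
  obtain ⟨a, ha, b, hb, hab, hbfar⟩ := exists_lie_eq_of_mem_zero h.2 hsnd N hfar
  have h1 := hv h
  rw [← hab, lie_lie, hN b hb hbfar v hv0, hpos 1 one_pos a ha, lie_zero, lie_zero, sub_zero] at h1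
  exact (smul_eq_zero.1 h1.symm).resolve_right hvne

end Far

/-! ### Exponential series and functionals on their coefficients -/

section SeriesLemmas

variable {R : Type*} [CommRing R] [Algebra ℂ R]

theorem coeff_coshPS (a : R) (n : ℕ) : PowerSeries.coeff n (coshPS a)
    = if Even n then ((n.factorial : ℂ)⁻¹) • a ^ n else 0 := by
  rw [coshPS, PowerSeries.coeff_smul, map_add, expPS, expPS, PowerSeries.coeff_mk,
    PowerSeries.coeff_mk]
  split_ifs with h
  · rw [h.neg_pow, ← two_smul ℂ, smul_smul, inv_mul_cancel₀ two_ne_zero, one_smul]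
  · rw [(Nat.not_even_iff_odd.1 h).neg_pow, smul_neg, add_neg_cancel, smul_zero]

theorem coeff_sinhPS (a : R) (n : ℕ) : PowerSeries.coeff n (sinhPS a)
    = if Odd n then ((n.factorial : ℂ)⁻¹) • a ^ n else 0 := by
  rw [sinhPS, PowerSeries.coeff_smul, map_sub, expPS, expPS, PowerSeries.coeff_mk,
    PowerSeries.coeff_mk]
  split_ifs with h
  · rw [h.neg_pow, smul_neg, sub_neg_eq_add, ← two_smul ℂ, smul_smul,
      inv_mul_cancel₀ two_ne_zero, one_smul]
  · rw [(Nat.not_odd_iff_even.1 h).neg_pow, sub_self, smul_zero]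

theorem sinhPS_mul_two_sinhPS (y b : R) :
    sinhPS y * ((2 : ℂ) • sinhPS b) = coshPS (y + b) - coshPS (y - b) := by
  have h1 : -y + -b = -(y + b) := by ring
  have h2 : -y + b = -(y - b) := by ring
  simp only [sinhPS, coshPS]
  rw [smul_smul, mul_inv_cancel₀ two_ne_zero, one_smul, smul_mul_assoc, ← smul_sub, sub_mul,
    mul_sub, mul_sub, expPS_mul, expPS_mul, expPS_mul, expPS_mul, h1, h2, ← sub_eq_add_neg]
  congr 1
  ring

theorem coshPS_sub (a b : R) :
    coshPS (a - b) = coshPS a * coshPS b - sinhPS a * sinhPS b := by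
  have h : coshPS a * coshPS b = (2⁻¹ : ℂ) • (coshPS (a + b) + coshPS (a - b)) := by
    have h1 : -a + -b = -(a + b) := by ring
    have h2 : -a + b = -(a - b) := by ring
    simp only [coshPS]
    rw [smul_mul_assoc, mul_smul_comm, ← smul_add, add_mul, mul_add, mul_add, expPS_mul, expPS_mul,
      expPS_mul, expPS_mul, h1, h2, ← sub_eq_add_neg]
    congr 2
    ring
  have h' : sinhPS a * sinhPS b = (2⁻¹ : ℂ) • (coshPS (a + b) - coshPS (a - b)) := by
    rw [← sinhPS_mul_two_sinhPS, mul_smul_comm, smul_smul, inv_mul_cancel₀ two_ne_zero, one_smul]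
  rw [h, h', ← smul_sub, add_sub_sub_cancel, ← two_smul ℂ, smul_smul, inv_mul_cancel₀ two_ne_zero,
    one_smul]

/-- Application of a linear functional to the coefficients of a power series. -/
noncomputable def mapCoeff (ℓ : R →ₗ[ℂ] ℂ) : PowerSeries R →ₗ[ℂ] PowerSeries ℂ where
  toFun F := PowerSeries.mk fun n => ℓ (PowerSeries.coeff n F)
  map_add' F G := by ext n; simp
  map_smul' c F := by ext n; simp

@[simp] theorem coeff_mapCoeff (ℓ : R →ₗ[ℂ] ℂ) (F : PowerSeries R) (n : ℕ) :
    PowerSeries.coeff n (mapCoeff ℓ F) = ℓ (PowerSeries.coeff n F) := by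
  simp [mapCoeff]

theorem mapCoeff_mul_map (ℓ : R →ₗ[ℂ] ℂ) (F : PowerSeries R) (G : PowerSeries ℂ) :
    mapCoeff ℓ (F * PowerSeries.map (algebraMap ℂ R) G) = mapCoeff ℓ F * G := by
  ext n
  rw [coeff_mapCoeff, PowerSeries.coeff_mul, PowerSeries.coeff_mul, map_sum]
  refine Finset.sum_congr rfl fun p _ => ?_
  rw [PowerSeries.coeff_map, coeff_mapCoeff, mul_comm, ← Algebra.smul_def, map_smul, smul_eq_mul,
    mul_comm]

theorem mapCoeff_sub (ℓ ℓ' : R →ₗ[ℂ] ℂ) (F : PowerSeries R) :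
    mapCoeff (ℓ - ℓ') F = mapCoeff ℓ F - mapCoeff ℓ' F := by
  ext n; simp

theorem map_coshPS (a : ℂ) :
    PowerSeries.map (algebraMap ℂ R) (coshPS a) = coshPS (algebraMap ℂ R a) := by
  ext n
  rw [PowerSeries.coeff_map, coeff_coshPS, coeff_coshPS]
  split_ifs
  · rw [smul_eq_mul, map_mul, map_pow, Algebra.smul_def]
  · rw [map_zero]

theorem map_sinhPS (a : ℂ) :
    PowerSeries.map (algebraMap ℂ R) (sinhPS a) = sinhPS (algebraMap ℂ R a) := by
  ext n
  rw [PowerSeries.coeff_map, coeff_sinhPS, coeff_sinhPS]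
  split_ifs
  · rw [smul_eq_mul, map_mul, map_pow, Algebra.smul_def]
  · rw [map_zero]

theorem map_two_sinhPS (a : ℂ) :
    PowerSeries.map (algebraMap ℂ R) ((2 : ℂ) • sinhPS a)
      = (2 : ℂ) • sinhPS (algebraMap ℂ R a) := by
  rw [two_smul, two_smul, map_add, map_sinhPS]

theorem two_sinhPS_half_ne_zero : (2 : ℂ) • sinhPS (1 / 2 : ℂ) ≠ 0 := by
  intro h
  have := congrArg (PowerSeries.coeff 1) h
  rw [PowerSeries.coeff_smul, coeff_sinhPS, if_pos odd_one] at this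
  norm_num at this

theorem isQuasipolynomial_mul_coshPS (q : ℂ[X]) (a : ℂ) :
    IsQuasipolynomial ((q : PowerSeries ℂ) * coshPS a) := by
  rw [coshPS, mul_smul_comm, mul_add]
  exact Submodule.smul_mem _ _ (Submodule.add_mem _ (Submodule.subset_span ⟨q, a, rfl⟩)
    (Submodule.subset_span ⟨q, -a, rfl⟩))

theorem isQuasipolynomial_mul_sinhPS (q : ℂ[X]) (a : ℂ) :
    IsQuasipolynomial ((q : PowerSeries ℂ) * sinhPS a) := by
  rw [sinhPS, mul_smul_comm, mul_sub]
  exact Submodule.smul_mem _ _ (Submodule.sub_mem _ (Submodule.subset_span ⟨q, a, rfl⟩)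
    (Submodule.subset_span ⟨q, -a, rfl⟩))

end SeriesLemmas

/-! ### The exponents determine the highest weight -/

section Determine

variable {ε : ℤˣ}

/-- The degree zero part of `DHat ε` is spanned by the odd powers of `D` and by `C`: the invariance
under `σ` in degree zero says that `f` is even in `f(D) D`. -/
theorem dual_DHatGrade_ext {Lam Lam' : Module.Dual ℂ (DHatGrade ε 0)}
    (hD : ∀ l (hl : Even l), Lam (opDpow ε l hl) = Lam' (opDpow ε l hl))
    (hC : Lam (opC ε) = Lam' (opC ε)) : Lam = Lam' := by
  refine LinearMap.ext fun h => ?_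
  obtain ⟨f, hf, hf2⟩ := mem_DxPM (h : DHat ε).fst.2 0
  have hodd : ∀ l, ¬ Even l → f.coeff l = 0 := by
    intro l hl
    have h1 := congrArg (Polynomial.coeff · l) hf2
    simp only [Int.cast_zero, map_zero, sub_zero, sgn, zpow_zero, Units.val_one, Int.cast_one,
      one_smul] at h1
    rw [← neg_one_mul, ← Polynomial.C_1, ← Polynomial.C_neg, Polynomial.comp_C_mul_X_coeff,
      (Nat.not_even_iff_odd.1 hl).neg_one_pow] at h1
    linear_combination h1 / 2
  let F : DHatGrade ε 0 →ₗ[ℂ] DiffOp :=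
    { toFun := fun x => ((x : DHat ε).fst : DiffOp)
      map_add' := fun x y => rfl
      map_smul' := fun c x => rfl }
  let G : DHatGrade ε 0 →ₗ[ℂ] ℂ :=
    { toFun := fun x => (x : DHat ε).snd
      map_add' := fun x y => rfl
      map_smul' := fun c x => rfl }
  have hFG : ∀ x y, F x = F y → G x = G y → x = y := fun x y h1 h2 =>
    Subtype.ext (CentralExt.ext (Subtype.ext h1) h2)
  have key : h = (∑ l ∈ f.support.attach, if hl : Even l.1 then f.coeff l.1 • opDpow ε l.1 hl
      else 0) + (h : DHat ε).snd • opC ε := by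
    refine hFG _ _ ?_ ?_
    · have hFD : ∀ l hl, F (opDpow ε l hl) = DiffOp.mono 0 (Polynomial.X ^ l * Polynomial.X) :=
        fun l hl => rfl
      have hFC : F (opC ε) = 0 := rfl
      rw [map_add, map_sum, map_smul, hFC, smul_zero, add_zero]
      have h2 : F h = DiffOp.mono 0 (f * Polynomial.X) := by
        rw [← hf]; exact eq_mono_of_mem_DxPMgrade h.2.1
      rw [h2]
      conv_lhs => rw [f.as_sum_support_C_mul_X_pow]
      rw [Finset.sum_mul, map_sum, ← Finset.sum_attach]
      refine Finset.sum_congr rfl fun l _ => ?_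
      by_cases hl : Even l.1
      · rw [dif_pos hl, map_smul, hFD, ← map_smul, Polynomial.smul_eq_C_mul, mul_assoc]
      · rw [dif_neg hl, map_zero, hodd _ hl]
        simp
    · have hGD : ∀ l hl, G (opDpow ε l hl) = 0 := fun l hl => rfl
      have hGC : G (opC ε) = 1 := rfl
      rw [map_add, map_sum, map_smul, hGC, Finset.sum_eq_zero, zero_add, smul_eq_mul, mul_one]
      · rfl
      · intro l _
        split_ifs with hl
        · rw [map_smul, hGD, smul_zero]
        · exact map_zero G
  rw [key, map_add, map_add, map_smul, map_smul, map_sum, map_sum, hC]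
  congr 1
  refine Finset.sum_congr rfl fun l _ => ?_
  split_ifs with hl
  · rw [map_smul, map_smul, hD]
  · rw [map_zero, map_zero]

/-- The highest weight is determined by the exponents: the value at `0` gives the central charge,
and `Γ` is obtained from `φ` because `2 sinh (x/2)` is not a zero divisor. -/
theorem HasExponents.weight_eq {Lam Lam' : Module.Dual ℂ (DHatGrade ε 0)} {ep em : Set (ℂ × ℂ[X])}
    (h : HasExponents Lam ep em) (h' : HasExponents Lam' ep em) : Lam = Lam' := by
  obtain ⟨-, -, -, -, φ, Γ, -, -, hφ0, hφΓ, hΔ, hsum⟩ := h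
  obtain ⟨-, -, -, -, φ', Γ', -, -, hφ0', hφΓ', hΔ', hsum'⟩ := h'
  have hcosh : PowerSeries.constantCoeff (coshPS (1 / 2 : ℂ)) = 1 := by
    rw [← PowerSeries.coeff_zero_eq_constantCoeff_apply, coeff_coshPS, if_pos Even.zero]
    simp
  have hC : Lam (opC ε) = Lam' (opC ε) := by
    have h1 := congrArg PowerSeries.constantCoeff (hsum.trans hsum'.symm)
    rw [map_add, map_add, hφ0, hφ0', PowerSeries.smul_eq_C_mul, PowerSeries.smul_eq_C_mul, map_mul,
      map_mul, hcosh] at h1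
    simpa using h1
  have hφ : φ = φ' := by
    have h1 := hsum.trans hsum'.symm
    rw [hC] at h1
    exact add_right_cancel h1
  have hΓ : Γ = Γ' :=
    mul_right_cancel₀ two_sinhPS_half_ne_zero (hφΓ.trans (hφ.trans hφΓ'.symm))
  refine dual_DHatGrade_ext (fun l hl => ?_) hC
  have h1 := congrArg (PowerSeries.coeff l) (hΔ.trans ((congrArg _ hΓ).trans hΔ'.symm))
  rw [deltaSeries, deltaSeries, PowerSeries.coeff_mk, PowerSeries.coeff_mk, dif_pos hl,
    dif_pos hl] at h1
  have h2 : (l.factorial : ℂ) ≠ 0 := Nat.cast_ne_zero.2 l.factorial_ne_zero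
  rw [div_left_inj' h2, neg_inj] at h1
  exact h1

end Determine

/-! ### The exponents of the restriction -/

section Exponents

/-- A family of multiplicities, almost all zero, at points that are distinct up to sign. -/
theorem exponentSet_of_family {pt : ℕ → ℂ} {mult : ℕ → ℂ[X]} {M : ℕ}
    (hpt : ∀ k l, pt k = pt l ∨ pt k = -pt l → k = l) (hM : ∀ k, M ≤ k → mult k = 0)
    (F : ℂ → PowerSeries ℂ) :
    IsExponentSet {p : ℂ × ℂ[X] | ∃ k : ℕ, p = (pt k, mult k) ∧ mult k ≠ 0} ∧
    ∑ᶠ p ∈ {p : ℂ × ℂ[X] | ∃ k : ℕ, p = (pt k, mult k) ∧ mult k ≠ 0},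
        (p.2 : PowerSeries ℂ) * F p.1
      = ∑ k ∈ Finset.range M, (mult k : PowerSeries ℂ) * F (pt k) := by
  classical
  have hset : {p : ℂ × ℂ[X] | ∃ k : ℕ, p = (pt k, mult k) ∧ mult k ≠ 0}
      = ↑(((Finset.range M).filter fun k => mult k ≠ 0).image fun k => (pt k, mult k)) := by
    ext p
    simp only [Set.mem_ofPred_eq, Finset.coe_image, Set.mem_image, Finset.coe_filter,
      Finset.mem_range]
    constructor
    · rintro ⟨k, rfl, hk⟩
      exact ⟨k, ⟨not_le.1 fun h => hk (hM k h), hk⟩, rfl⟩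
    · rintro ⟨k, ⟨-, hk⟩, rfl⟩
      exact ⟨k, rfl, hk⟩
  refine ⟨⟨?_, ?_, ?_⟩, ?_⟩
  · rw [hset]; exact Finset.finite_toSet _
  · rintro _ ⟨k, rfl, hk⟩; exact hk
  · rintro _ ⟨k, rfl, hk⟩ _ ⟨l, rfl, hl⟩ h
    rw [hpt k l h]
  · rw [hset, finsum_mem_coe_finset, Finset.sum_image, Finset.sum_filter_of_ne]
    · intro k _ hk hk0
      rw [hk0] at hk
      simp at hk
    · intro k _ l _ hkl
      exact hpt k l (Or.inl (Prod.ext_iff.1 hkl).1)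

variable {ε : ℤˣ} {m : ℕ}

/-- The element `r E_{kk} - r(-u) E_{1-k,1-k}` of degree zero, as a linear function of `r`. -/
noncomputable def cartanLin (ε : ℤˣ) (m : ℕ) (k : ℤ) : Rm m →ₗ[ℂ] GHatGrade ε m 0 where
  toFun r := ⟨CentralExt.mk _ ⟨matE k k r - matE (1 - k) (1 - k) (negU m r), by
      intro p q
      simp only [entry_sub, entry_matE, map_sub]
      by_cases hpq : p = q
      · subst hpq
        rw [sgn_add, sgn_mul_self]
        rcases eq_or_ne p k with rfl | h1
        · rw [if_pos ⟨rfl, rfl⟩, if_neg (by omega), if_neg (by omega), if_pos ⟨rfl, rfl⟩]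
          simp [negU_negU]
        · rcases eq_or_ne p (1 - k) with rfl | h2
          · rw [if_neg (by omega), if_pos ⟨rfl, rfl⟩, if_pos (by omega), if_neg (by omega)]
            simp
          · rw [if_neg (by omega), if_neg (by omega), if_neg (by omega), if_neg (by omega)]
            simp
      · rw [if_neg (by omega), if_neg (by omega), if_neg (by omega), if_neg (by omega)]
        simp⟩ 0,
    fun p q h => by
      rw [CentralExt.fst_mk, entry_sub, entry_matE, entry_matE, if_neg (by omega),
        if_neg (by omega), sub_zero],
    fun h => absurd rfl h⟩
  map_add' r s := by
    refine Subtype.ext (CentralExt.ext (Subtype.ext (glInf_ext fun p q => ?_))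
      (add_zero (0 : Rm m)).symm)
    change entry (matE k k (r + s) - matE (1 - k) (1 - k) (negU m (r + s))) p q
      = entry (matE k k r - matE (1 - k) (1 - k) (negU m r)) p q
        + entry (matE k k s - matE (1 - k) (1 - k) (negU m s)) p q
    simp only [entry_sub, entry_matE, map_add]
    split_ifs <;> ring
  map_smul' c r := by
    refine Subtype.ext (CentralExt.ext (Subtype.ext (glInf_ext fun p q => ?_))
      (smul_zero c).symm)
    change entry (matE k k (c • r) - matE (1 - k) (1 - k) (negU m (c • r))) p q
      = c • entry (matE k k r - matE (1 - k) (1 - k) (negU m r)) p q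
    simp only [entry_sub, entry_matE, map_smul]
    split_ifs <;> simp [smul_sub]

theorem entry_cartanLin (k : ℤ) (r : Rm m) (p q : ℤ) :
    entry ((cartanLin ε m k r : GHat ε m).fst : GlInf (Rm m)) p q
      = (if p = k ∧ q = k then r else 0) - if p = 1 - k ∧ q = 1 - k then negU m r else 0 := by
  change entry (matE k k r - matE (1 - k) (1 - k) (negU m r)) p q = _
  rw [entry_sub, entry_matE, entry_matE]

/-- The central elements, as a linear function of the element of `ℂ[u]/(u^(m+1))`. -/
noncomputable def centralLin (ε : ℤˣ) (m : ℕ) : Rm m →ₗ[ℂ] GHatGrade ε m 0 where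
  toFun := central ε m
  map_add' _ _ := Subtype.ext (CentralExt.ext (add_zero (0 : gBar ε m)).symm rfl)
  map_smul' _ _ := Subtype.ext (CentralExt.ext (smul_zero _).symm rfl)

theorem cartanLin_uu_pow (k : ℤ) (j : ℕ) : cartanLin ε m k (uu m ^ j) = cartan ε m k j := by
  have h1 : ((cartanLin ε m k (uu m ^ j) : GHat ε m)).snd = 0 := rfl
  have h2 : ((cartan ε m k j : GHat ε m)).snd = 0 := rfl
  have h3 : ((cartan ε m k j : GHat ε m).fst : GlInf (Rm m))
      = matE k k (uu m ^ j) - matE (1 - k) (1 - k) ((-uu m) ^ j) := rfl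
  refine Subtype.ext (CentralExt.ext (Subtype.ext (glInf_ext fun p q => ?_)) (h1.trans h2.symm))
  rw [entry_cartanLin, map_pow, negU_uu, h3, entry_sub, entry_matE, entry_matE]

variable (lam : Module.Dual ℂ (GHatGrade ε m 0))

/-- The label `h_k` as a functional: the linear form on `ℂ[u]/(u^(m+1))` whose values at the powers
`u^i` are the numbers `h_k^{(i)}`, for `i` even or `k` nonzero. -/
noncomputable def hFun (k : ℕ) : Rm m →ₗ[ℂ] ℂ :=
  if k = 0 then lam ∘ₗ centralLin ε m - lam ∘ₗ cartanLin ε m 1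
  else lam ∘ₗ cartanLin ε m k - lam ∘ₗ cartanLin ε m (k + 1)

theorem hFun_uu_pow (k i : ℕ) (h : Even i ∨ k ≠ 0) : hFun lam k (uu m ^ i) = hLabel lam k i := by
  rw [hFun, hLabel]
  split_ifs with h1 h2
  · rw [LinearMap.sub_apply, LinearMap.comp_apply, LinearMap.comp_apply, cartanLin_uu_pow]
    rfl
  · exact absurd h (by simp [h1, h2])
  · rw [LinearMap.sub_apply, LinearMap.comp_apply, LinearMap.comp_apply, cartanLin_uu_pow,
      cartanLin_uu_pow]
    rfl

theorem coeff_sum_monomial (s : Finset ℕ) (f : ℕ → ℂ) (n : ℕ) :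
    (∑ i ∈ s, Polynomial.monomial i (f i)).coeff n = if n ∈ s then f n else 0 := by
  rw [Polynomial.finsetSum_coeff]
  simp only [Polynomial.coeff_monomial, Finset.sum_ite_eq']

theorem uu_pow_eq_zero {n : ℕ} (hn : ¬ n < m + 1) : uu m ^ n = 0 :=
  pow_eq_zero_of_le (not_lt.1 hn) (uu_pow m)

theorem mapCoeff_hFun_coshPS (k : ℕ) :
    mapCoeff (hFun lam k) (coshPS (uu m)) = (evenMult lam k : PowerSeries ℂ) := by
  ext n
  rw [coeff_mapCoeff, coeff_coshPS, Polynomial.coeff_coe, evenMult, coeff_sum_monomial]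
  simp only [Finset.mem_filter, Finset.mem_range]
  by_cases hn : Even n
  · rw [if_pos hn, map_smul, smul_eq_mul]
    by_cases hm : n < m + 1
    · rw [if_pos ⟨hm, hn⟩, hFun_uu_pow lam k n (Or.inl hn), div_eq_inv_mul]
    · rw [if_neg (fun h => hm h.1), uu_pow_eq_zero hm, map_zero, mul_zero]
  · rw [if_neg hn, if_neg (fun h => hn h.2), map_zero]

theorem mapCoeff_hFun_sinhPS {k : ℕ} (hk : k ≠ 0) :
    mapCoeff (hFun lam k) (sinhPS (uu m)) = (oddMult lam k : PowerSeries ℂ) := by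
  ext n
  rw [coeff_mapCoeff, coeff_sinhPS, Polynomial.coeff_coe, oddMult, coeff_sum_monomial]
  simp only [Finset.mem_filter, Finset.mem_range]
  by_cases hn : Odd n
  · rw [if_pos hn, map_smul, smul_eq_mul]
    by_cases hm : n < m + 1
    · rw [if_pos ⟨hm, hn⟩, hFun_uu_pow lam k n (Or.inr hk), div_eq_inv_mul]
    · rw [if_neg (fun h => hm h.1), uu_pow_eq_zero hm, map_zero, mul_zero]
  · rw [if_neg hn, if_neg (fun h => hn h.2), map_zero]

theorem oddMult_zero : oddMult lam 0 = 0 := by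
  refine Finset.sum_eq_zero fun i hi => ?_
  have h : ¬ Even i := Nat.not_even_iff_odd.2 (Finset.mem_filter.1 hi).2
  rw [hLabel, if_pos rfl, if_neg h, zero_div, map_zero]

theorem evenMult_comp (k : ℕ) : (evenMult lam k).comp (-Polynomial.X) = evenMult lam k := by
  ext n
  rw [← neg_one_mul, ← Polynomial.C_1, ← Polynomial.C_neg, Polynomial.comp_C_mul_X_coeff, evenMult,
    coeff_sum_monomial]
  split_ifs with h
  · rw [(Finset.mem_filter.1 h).2.neg_one_pow, mul_one]
  · rw [zero_mul]

theorem oddMult_comp (k : ℕ) : (oddMult lam k).comp (-Polynomial.X) = -oddMult lam k := by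
  ext n
  rw [← neg_one_mul (Polynomial.X : ℂ[X]), ← Polynomial.C_1, ← Polynomial.C_neg,
    Polynomial.comp_C_mul_X_coeff, Polynomial.coeff_neg, oddMult, coeff_sum_monomial]
  split_ifs with h
  · rw [(Finset.mem_filter.1 h).2.neg_one_pow, mul_neg_one]
  · rw [zero_mul, neg_zero]

/-- `cosh ((u - k) x) = cosh (u x) cosh (k x) - sinh (u x) sinh (k x)` produces the two
multiplicities at `k`. -/
theorem mapCoeff_hFun_coshPS_sub (k : ℕ) :
    mapCoeff (hFun lam k) (coshPS (uu m - (k : Rm m)))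
      = (evenMult lam k : PowerSeries ℂ) * coshPS (k : ℂ)
        + (oddMult lam k : PowerSeries ℂ) * sinhPS (-(k : ℂ)) := by
  have h1 : (k : Rm m) = algebraMap ℂ (Rm m) (k : ℂ) := (map_natCast _ k).symm
  have h2 : sinhPS (-(k : ℂ)) = -sinhPS (k : ℂ) := by
    rw [sinhPS, sinhPS, neg_neg, ← smul_neg, neg_sub]
  rw [h1, coshPS_sub, ← map_coshPS, ← map_sinhPS, map_sub, mapCoeff_mul_map, mapCoeff_mul_map,
    mapCoeff_hFun_coshPS, h2, mul_neg, ← sub_eq_add_neg]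
  congr 1
  by_cases hk : k = 0
  · subst hk
    have h0 : sinhPS ((0 : ℕ) : ℂ) = 0 := by rw [sinhPS]; simp
    rw [h0, mul_zero, mul_zero]
  · rw [mapCoeff_hFun_sinhPS lam hk]

/-- The weight of `D ^ (l + 1)` in terms of the functionals `r ↦ lam (r E_{kk} - r(-u) E_{1-k,1-k})`
with `k` bounded. -/
theorem pullbackWeight_opDpow {N : ℕ}
    (hN : ∀ h : GHatGrade ε m 0, (h : GHat ε m).snd = 0 →
      (∀ i : ℤ, |i| ≤ N → entry ((h : GHat ε m).fst : GlInf (Rm m)) i i = 0) → lam h = 0)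
    (l : ℕ) (hl : Even l) :
    pullbackWeight lam (opDpow ε l hl)
      = ∑ n ∈ Finset.range (N + 1),
          lam (cartanLin ε m (n + 1 : ℤ) ((hu m - ((n + 1 : ℤ) : Rm m)) ^ (l + 1)))
        + lam (centralLin ε m (alpha (hu m) (Polynomial.X ^ (l + 1)))) := by
  set g : GHatGrade ε m 0 := ⟨phiHat ε m (opDpow ε l hl), phiHat_mem (opDpow ε l hl).2⟩ with hg
  set s : GHatGrade ε m 0 := ∑ n ∈ Finset.range (N + 1),
    cartanLin ε m (n + 1 : ℤ) ((hu m - ((n + 1 : ℤ) : Rm m)) ^ (l + 1)) with hs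
  set z : GHatGrade ε m 0 := centralLin ε m (alpha (hu m) (Polynomial.X ^ (l + 1))) with hz
  have hgentry : ∀ i : ℤ, entry ((g : GHat ε m).fst : GlInf (Rm m)) i i
      = (hu m - (i : Rm m)) ^ (l + 1) := by
    intro i
    rw [hg, phiHat_fst, entry_TTinv_phi]
    change _ * Polynomial.aeval _ (DiffOp.coeff (i - i)
      (DiffOp.mono 0 (Polynomial.X ^ l * Polynomial.X))) * _ = _
    rw [DiffOp.coeff_mono, if_pos (sub_self i).symm, mul_right_comm, Units.inv_mul]
    simp [pow_succ]
  let F : ℤ → GHatGrade ε m 0 →ₗ[ℂ] Rm m := fun i =>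
    { toFun := fun x => entry ((x : GHat ε m).fst : GlInf (Rm m)) i i
      map_add' := fun x y => rfl
      map_smul' := fun c x => rfl }
  have hsentry : ∀ i : ℤ, 1 ≤ i → i ≤ N + 1 → entry ((s : GHat ε m).fst : GlInf (Rm m)) i i
      = (hu m - (i : Rm m)) ^ (l + 1) := by
    intro i h1 h2
    change F i s = _
    rw [hs, map_sum, Finset.sum_eq_single_of_mem (i - 1).natAbs (by simp; omega)]
    · change entry ((cartanLin ε m _ _ : GHat ε m).fst : GlInf (Rm m)) i i = _
      rw [Int.natAbs_of_nonneg (by omega), sub_add_cancel, entry_cartanLin, if_pos ⟨rfl, rfl⟩,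
        if_neg (by omega), sub_zero]
    · intro n _ hn
      change entry ((cartanLin ε m _ _ : GHat ε m).fst : GlInf (Rm m)) i i = _
      rw [entry_cartanLin, if_neg (by omega), if_neg (by omega), sub_zero]
  have hzero : lam (g - s - z) = 0 := by
    refine hN _ ?_ ?_
    · let Fs : GHatGrade ε m 0 →ₗ[ℂ] Rm m :=
        { toFun := fun x => (x : GHat ε m).snd
          map_add' := fun x y => rfl
          map_smul' := fun c x => rfl }
      change Fs (g - s - z) = 0
      have h1 : Fs s = 0 := by
        rw [hs, map_sum]
        exact Finset.sum_eq_zero fun n _ => rfl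
      have h2 : Fs g = Fs z := by
        change (phiHat ε m (opDpow ε l hl)).snd = alpha (hu m) (Polynomial.X ^ (l + 1))
        rw [phiHat_snd]
        change algebraMap ℂ (Rm m) 0 + alpha (hu m) (DiffOp.coeff 0
          (DiffOp.mono 0 (Polynomial.X ^ l * Polynomial.X))) = _
        rw [map_zero, zero_add, DiffOp.coeff_mono, if_pos rfl, pow_succ]
      rw [map_sub, map_sub, h1, h2, sub_zero, sub_self]
    · have hpos : ∀ i : ℤ, 1 ≤ i → i ≤ N + 1 → F i (g - s - z) = 0 := by
        intro i h1 h2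
        have h3 : F i z = 0 := rfl
        have h4 : F i g = F i s := (hgentry i).trans (hsentry i h1 h2).symm
        rw [map_sub, map_sub, h3, h4, sub_self, sub_zero]
      intro i hi
      rw [abs_le] at hi
      rcases le_or_gt 1 i with h | h
      · exact hpos i h (by omega)
      · have h1 : entry (((g - s - z : GHatGrade ε m 0) : GHat ε m).fst : GlInf (Rm m))
            (1 - i) (1 - i) = 0 := hpos (1 - i) (by omega) (by omega)
        rw [((g - s - z : GHatGrade ε m 0) : GHat ε m).fst.2 i i, h1, map_zero, mul_zero, neg_zero]
  rw [map_sub, map_sub, sub_sub, sub_eq_zero] at hzero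
  rw [pullbackWeight_apply, ← hg, hzero, hs, map_sum]

theorem lam_cartanLin_eq_zero {N : ℕ}
    (hN : ∀ h : GHatGrade ε m 0, (h : GHat ε m).snd = 0 →
      (∀ i : ℤ, |i| ≤ N → entry ((h : GHat ε m).fst : GlInf (Rm m)) i i = 0) → lam h = 0)
    {k : ℤ} (hk : N + 2 ≤ k) (r : Rm m) : lam (cartanLin ε m k r) = 0 := by
  refine hN _ rfl fun i hi => ?_
  rw [abs_le] at hi
  rw [entry_cartanLin, if_neg (by omega), if_neg (by omega), sub_zero]

/-- The central element `C` acts as the central element `1` of the Lie algebra of matrices. -/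
theorem pullbackWeight_opC : pullbackWeight lam (opC ε) = lam (centralLin ε m 1) := by
  rw [pullbackWeight_apply]
  congr 1
  refine Subtype.ext (CentralExt.ext (Subtype.ext ?_) ?_)
  · change TTinv m (phi (hu m) 0) = 0
    rw [map_zero, map_zero]
  · change algebraMap ℂ (Rm m) 1 + alpha (hu m) (DiffOp.coeff 0 0) = 1
    rw [map_one, map_zero, map_zero, add_zero]

/-- The exponents of the restriction. With
`Γ = -lam (sinh (x D))`, which is a finite sum of terms `-λ_k (sinh ((1/2 + u - k) x))` and a
central term, the product formula
`2 sinh (x/2) sinh ((1/2 + u - k) x) = cosh ((u - k + 1) x) - cosh ((u - k) x)` and summation by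
parts give the series of the exponents. -/
theorem hasExponents_pullbackWeight {N : ℕ}
    (hN : ∀ h : GHatGrade ε m 0, (h : GHat ε m).snd = 0 →
      (∀ i : ℤ, |i| ≤ N → entry ((h : GHat ε m).fst : GlInf (Rm m)) i i = 0) → lam h = 0) :
    HasExponents (pullbackWeight lam) (ePlus lam) (eMinus lam) := by
  have hvan : ∀ k, N + 2 ≤ k → hFun lam k = 0 := by
    intro k hk
    refine LinearMap.ext fun r => ?_
    rw [hFun, if_neg (by omega), LinearMap.sub_apply, LinearMap.comp_apply, LinearMap.comp_apply,
      lam_cartanLin_eq_zero lam hN (by omega), lam_cartanLin_eq_zero lam hN (by omega), sub_zero]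
    rfl
  have hlabel : ∀ k, N + 2 ≤ k → ∀ i, hLabel lam k i = 0 := by
    intro k hk i
    rw [← hFun_uu_pow lam k i (Or.inr (by omega)), hvan k hk]
    rfl
  have hev : ∀ k, N + 2 ≤ k → evenMult lam k = 0 := fun k hk =>
    Finset.sum_eq_zero fun i _ => by rw [hlabel k hk, zero_div, map_zero]
  have hod : ∀ k, N + 2 ≤ k → oddMult lam k = 0 := fun k hk =>
    Finset.sum_eq_zero fun i _ => by rw [hlabel k hk, zero_div, map_zero]
  have hcast : ∀ k l : ℕ, (k : ℂ) = l ∨ (k : ℂ) = -l → k = l := by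
    rintro k l (h | h)
    · exact_mod_cast h
    · have h1 : ((k + l : ℕ) : ℂ) = 0 := by push_cast; rw [h]; ring
      have h2 : k + l = 0 := by exact_mod_cast h1
      omega
  obtain ⟨hep, hepsum⟩ := exponentSet_of_family (pt := fun k : ℕ => (k : ℂ)) hcast hev coshPS
  obtain ⟨hem, hemsum⟩ := exponentSet_of_family (pt := fun k : ℕ => -(k : ℂ))
    (fun k l h => hcast k l (by simpa only [neg_inj] using h)) hod sinhPS
  let lk : ℕ → Rm m →ₗ[ℂ] ℂ := fun n => lam ∘ₗ cartanLin ε m (n + 1 : ℤ)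
  let ck : Rm m →ₗ[ℂ] ℂ := lam ∘ₗ centralLin ε m
  let A : PowerSeries (Rm m) := PowerSeries.mk fun n => if Odd n then
    ((n.factorial : ℂ)⁻¹) • alpha (hu m) (Polynomial.X ^ n) else 0
  let Γ : PowerSeries ℂ := -(∑ n ∈ Finset.range (N + 1),
    mapCoeff (lk n) (sinhPS (hu m - ((n + 1 : ℤ) : Rm m))) + mapCoeff ck A)
  have hΓ : ∀ n, PowerSeries.coeff n Γ = -(∑ i ∈ Finset.range (N + 1),
      lk i (PowerSeries.coeff n (sinhPS (hu m - ((i + 1 : ℤ) : Rm m))))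
        + ck (PowerSeries.coeff n A)) := by
    intro n
    simp only [Γ, map_neg, map_add, map_sum, coeff_mapCoeff]
  have hΓodd : ∀ n, ¬ Odd n → PowerSeries.coeff n Γ = 0 := by
    intro n hn
    rw [hΓ]
    simp only [A, coeff_sinhPS, PowerSeries.coeff_mk, if_neg hn, map_zero, Finset.sum_const_zero,
      add_zero, neg_zero]
  have hΓsucc : ∀ n (hn : Even n), PowerSeries.coeff (n + 1) Γ
      = -((((n + 1).factorial : ℂ)⁻¹) * pullbackWeight lam (opDpow ε n hn)) := by
    intro n hn
    rw [hΓ, pullbackWeight_opDpow lam hN n hn]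
    simp only [A, coeff_sinhPS, PowerSeries.coeff_mk, if_pos hn.add_one, map_smul, smul_eq_mul]
    rw [← Finset.mul_sum, ← mul_add]
    rfl
  set φ := Γ * ((2 : ℂ) • sinhPS (1 / 2 : ℂ)) with hφ
  have hb : hu m = uu m + algebraMap ℂ (Rm m) (1 / 2) := rfl
  have hbb : algebraMap ℂ (Rm m) (1 / 2) + algebraMap ℂ (Rm m) (1 / 2) = 1 := by
    rw [← map_add, ← map_one (algebraMap ℂ (Rm m))]; norm_num
  -- multiplication by `2 sinh (x/2)` and summation by parts
  have hφeq : φ + pullbackWeight lam (opC ε) • coshPS (1 / 2 : ℂ)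
      = ∑ k ∈ Finset.range (N + 2), mapCoeff (hFun lam k) (coshPS (uu m - (k : Rm m))) := by
    have h1 : ∀ n : ℕ, mapCoeff (lk n) (sinhPS (hu m - ((n + 1 : ℤ) : Rm m)))
        * ((2 : ℂ) • sinhPS (1 / 2 : ℂ))
        = mapCoeff (lk n) (coshPS (uu m - (n : Rm m)))
          - mapCoeff (lk n) (coshPS (uu m - ((n + 1 : ℕ) : Rm m))) := by
      intro n
      rw [← mapCoeff_mul_map, map_two_sinhPS, sinhPS_mul_two_sinhPS, map_sub]
      congr 3
      · rw [hb]; push_cast; linear_combination hbb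
      · rw [hb]; push_cast; ring
    have h2 : mapCoeff ck A * ((2 : ℂ) • sinhPS (1 / 2 : ℂ))
        = pullbackWeight lam (opC ε) • coshPS (1 / 2 : ℂ) - mapCoeff ck (coshPS (uu m)) := by
      rw [← mapCoeff_mul_map, map_two_sinhPS, alpha_sinh, map_sub, pullbackWeight_opC]
      congr 1
      have h3 := mapCoeff_mul_map ck 1 (coshPS (1 / 2 : ℂ))
      rw [one_mul, map_coshPS] at h3
      rw [h3, PowerSeries.smul_eq_C_mul]
      congr 1
      ext n
      rw [coeff_mapCoeff, PowerSeries.coeff_one, PowerSeries.coeff_C]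
      split_ifs
      · rfl
      · rw [map_zero]
    have h4 : ∑ n ∈ Finset.range (N + 1), (mapCoeff (lk n) (coshPS (uu m - (n : Rm m)))
        - mapCoeff (lk (n + 1)) (coshPS (uu m - ((n + 1 : ℕ) : Rm m))))
        = mapCoeff (lk 0) (coshPS (uu m - ((0 : ℕ) : Rm m))) := by
      rw [Finset.sum_range_sub' fun n => mapCoeff (lk n) (coshPS (uu m - (n : Rm m)))]
      have h5 : lk (N + 1) = 0 := LinearMap.ext fun r =>
        lam_cartanLin_eq_zero lam hN (by push_cast; omega) r
      rw [h5, sub_eq_self]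
      ext n
      rw [coeff_mapCoeff]
      rfl
    have h6 : ∀ n, mapCoeff (hFun lam (n + 1)) (coshPS (uu m - ((n + 1 : ℕ) : Rm m)))
        = mapCoeff (lk n) (coshPS (uu m - ((n + 1 : ℕ) : Rm m)))
          - mapCoeff (lk (n + 1)) (coshPS (uu m - ((n + 1 : ℕ) : Rm m))) := by
      intro n
      rw [← mapCoeff_sub, hFun, if_neg n.succ_ne_zero]
      simp only [lk]
      push_cast
      rfl
    have h7 : mapCoeff (hFun lam 0) (coshPS (uu m - ((0 : ℕ) : Rm m)))
        = mapCoeff ck (coshPS (uu m)) - mapCoeff (lk 0) (coshPS (uu m - ((0 : ℕ) : Rm m))) := by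
      rw [Nat.cast_zero, sub_zero, ← mapCoeff_sub, hFun, if_pos rfl]
      simp only [lk, ck]
      push_cast
      rfl
    rw [Finset.sum_range_succ', h7, Finset.sum_congr rfl fun n _ => h6 n, ← h4, hφ]
    simp only [Γ]
    rw [neg_mul, add_mul, Finset.sum_mul, h2, Finset.sum_congr rfl fun n _ => h1 n]
    simp only [Finset.sum_sub_distrib]
    ring
  have hφsum : φ + pullbackWeight lam (opC ε) • coshPS (1 / 2 : ℂ)
      = ∑ k ∈ Finset.range (N + 2), (evenMult lam k : PowerSeries ℂ) * coshPS (k : ℂ)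
        + ∑ k ∈ Finset.range (N + 2), (oddMult lam k : PowerSeries ℂ) * sinhPS (-(k : ℂ)) := by
    rw [hφeq, ← Finset.sum_add_distrib]
    exact Finset.sum_congr rfl fun k _ => mapCoeff_hFun_coshPS_sub lam k
  refine ⟨hep, hem, ?_, ?_, φ, Γ, ?_, ?_, ?_, rfl, ?_, ?_⟩
  · rintro _ ⟨k, rfl, -⟩
    exact evenMult_comp lam k
  · rintro _ ⟨k, rfl, hk⟩
    refine ⟨oddMult_comp lam k, neg_ne_zero.2 (Nat.cast_ne_zero.2 ?_)⟩
    rintro rfl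
    exact hk (oddMult_zero lam)
  · rw [eq_sub_of_add_eq hφsum]
    refine Submodule.sub_mem _ (Submodule.add_mem _
      (Submodule.sum_mem _ fun k _ => isQuasipolynomial_mul_coshPS _ _)
      (Submodule.sum_mem _ fun k _ => isQuasipolynomial_mul_sinhPS _ _))
      (Submodule.smul_mem _ _ ?_)
    have := isQuasipolynomial_mul_coshPS 1 (1 / 2)
    rwa [Polynomial.coe_one, one_mul] at this
  · have h1 : PowerSeries.rescale (-1 : ℂ) Γ = -Γ := by
      ext n
      rw [PowerSeries.coeff_rescale,
        show PowerSeries.coeff n (-Γ) = -PowerSeries.coeff n Γ from map_neg _ _]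
      by_cases hn : Odd n
      · rw [hn.neg_one_pow, neg_one_mul]
      · rw [hΓodd n hn, mul_zero, neg_zero]
    have h2 : PowerSeries.rescale (-1 : ℂ) ((2 : ℂ) • sinhPS (1 / 2 : ℂ))
        = -((2 : ℂ) • sinhPS (1 / 2 : ℂ)) := by
      ext n
      rw [PowerSeries.coeff_rescale, map_neg, PowerSeries.coeff_smul, coeff_sinhPS]
      split_ifs with hn
      · rw [hn.neg_one_pow, neg_one_mul]
      · rw [smul_zero, mul_zero, neg_zero]
    rw [hφ, map_mul, h1, h2, neg_mul_neg]
  · rw [hφ, map_mul, ← PowerSeries.coeff_zero_eq_constantCoeff_apply, hΓodd 0 (by decide), zero_mul]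
  · ext n
    rw [deltaSeries, PowerSeries.coeff_mk, PowerSeries.coeff_derivative]
    split_ifs with hn
    · rw [hΓsucc n hn, Nat.factorial_succ]
      have h1 : (n.factorial : ℂ) ≠ 0 := Nat.cast_ne_zero.2 n.factorial_ne_zero
      have h2 : ((n : ℂ) + 1) ≠ 0 := by exact_mod_cast n.succ_ne_zero
      push_cast
      field_simp
    · rw [hΓodd (n + 1) (by rw [Nat.not_odd_iff_even]; exact Nat.even_add_one.2 hn), zero_mul]
  · rw [hφsum]
    exact congrArg₂ (· + ·) hepsum.symm hemsum.symm

end Exponents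

end Circle

/-! ### The restriction of a quasifinite module and its exponents -/

theorem mainTheorem6 (ε : ℤˣ) (m : ℕ) (lam : Module.Dual ℂ (GHatGrade ε m 0))
    {V : Type*} [AddCommGroup V] [Module ℂ V] [LieRingModule (GHat ε m) V]
    [LieModule ℂ (GHat ε m) V] (𝒱 : ℤ → Submodule ℂ V)
    (hV : IsIrreducibleHighestWeight (GHatGrade ε m) lam 𝒱) (hfin : IsQuasifinite 𝒱) :
    IsL ε (Pullback.grading (phiHat ε m) 𝒱) (ePlus lam) (eMinus lam) ∧
    LieModule.IsIrreducible ℂ (DHat ε) (Pullback (phiHat ε m) V) ∧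
    ∀ {W : Type*} [AddCommGroup W] [Module ℂ W] [LieRingModule (DHat ε) W]
      [LieModule ℂ (DHat ε) W] (𝒲 : ℤ → Submodule ℂ W),
      IsL ε 𝒲 (ePlus lam) (eMinus lam) →
        Nonempty (Pullback (phiHat ε m) V ≃ₗ⁅ℂ, DHat ε⁆ W) := by
  have hHW := pullback_isIrreducibleHighestWeight hV hfin
  obtain ⟨N, hN⟩ := exists_forall_weight_eq_zero_of_far hV hfin
  have hexp := hasExponents_pullbackWeight lam hN
  refine ⟨⟨pullbackWeight lam, hHW, hfin, hexp⟩, pullback_isIrreducible hV hfin, ?_⟩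
  intro W _ _ _ _ 𝒲 hW
  obtain ⟨Lam, hLam, -, hexp'⟩ := hW
  obtain rfl := hexp.weight_eq hexp'
  -- `D` is the element of degree zero that acts on the component of degree `k` with eigenvalue `k`.
  exact nonempty_equiv_of_highestWeight (isLieGrading_DHat ε) (opDpow ε 0 Even.zero)
    (fun k x hx => opDpow_zero_lie ε k x hx) hHW hLam
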